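/- Let $\theta$ be the theta graph, i.e. the topological space consisting of two vertices $q^+,q^-$ and three edges, each of which joins $q^+$ to $q^-$. Let $f:\theta\to\mathbb R^3$ be a continuous embedding and $\Gamma=f(\theta)$. For unit vectors $T_1,\dots,T_d\in S^2$ (the unit tangent vectors of the edges at a vertex $q$ of a polygonal graph, pointing into the edges) let $\chi_i:S^2\to\{-1,+1\}$ be $-1$ on the hemisphere centred at $T_i$ and $+1$ on the opposite hemisphere (modulo null sets), and put $$\mathrm{ntc}(q)=\frac14\int_{S^2}\Big[\sum_{i=1}^d\chi_i(e)\Big]^+\,dA_{S^2}(e).$$ The net total curvature of a polygonal graph $P$ with vertices $q_1,\dots,q_N$ (including those of degree 2) is $\mathrm{NTC}(P)=\sum_{j=1}^N\mathrm{ntc}(q_j)$. The net total curvature $\mathrm{NTC}(\Gamma)\in[0,\infty]$ is the supremum of $\mathrm{NTC}(P)$ over all polygonal theta graphs $P$ inscribed in $\Gamma$, i.e. obtained by choosing on each of the three edges of $\Gamma$ finitely many points, in order from one vertex to the other and including both vertices, and joining consecutive points by straight segments. Then: 1. $\mathrm{NTC}(\Gamma)\ge 3\pi$. 2. $\mathrm{NTC}(\Gamma)=3\pi$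 if and only if $\Gamma$ is a planar convex curve plus a straight chord, i.e. $\Gamma=C\cup[p,q]$ where $C$ is the relative boundary of a two-dimensional compact convex set in $\mathbb R^3$, $p\ne q$ are points of $C$, and the open segment from $p$ to $q$ does not meet $C$. 3. If $\mathrm{NTC}(\Gamma)<4\pi$, then $\Gamma$ is isotopic in $\mathbb R^3$ to the standard planar theta graph: there is a continuous family $H_t$ ($0\le t\le 1$) of homeomorphisms of $\mathbb R^3$ with $H_0=\mathrm{id}$ such that $H_1(\Gamma)$ is the union of a circle in a plane and a diameter of it. -/

import Mathlib

open MeasureTheory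
open scoped ENNReal unitInterval

noncomputable section

namespace ThetaNTC

/-- Euclidean three-space. -/
abbrev E3 : Type := EuclideanSpace ℝ (Fin 3)

/-! ### The theta graph -/

/-- Three copies of `[0, 1]`, glued at all the left endpoints and at all the right endpoints. -/
def thetaSetoid : Setoid (Fin 3 × I) where
  r x y := x = y ∨ (x.2 = 0 ∧ y.2 = 0) ∨ (x.2 = 1 ∧ y.2 = 1)
  iseqv :=
    { refl := fun x => Or.inl rfl
      symm := by
        rintro x y (h | ⟨h, h'⟩ | ⟨h, h'⟩)
        · exact Or.inl h.symm
        · exact Or.inr (Or.inl ⟨h', h⟩)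
        · exact Or.inr (Or.inr ⟨h', h⟩)
      trans := by
        rintro x y z (rfl | ⟨h, h'⟩ | ⟨h, h'⟩) (rfl | ⟨k, k'⟩ | ⟨k, k'⟩)
        · exact Or.inl rfl
        · exact Or.inr (Or.inl ⟨k, k'⟩)
        · exact Or.inr (Or.inr ⟨k, k'⟩)
        · exact Or.inr (Or.inl ⟨h, h'⟩)
        · exact Or.inr (Or.inl ⟨h, k'⟩)
        · exact absurd (h'.symm.trans k) zero_ne_one
        · exact Or.inr (Or.inr ⟨h, h'⟩)
        · exact absurd (k.symm.trans h') zero_ne_one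
        · exact Or.inr (Or.inr ⟨h, k'⟩) }

/-- The theta graph as a topological space (quotient topology): two vertices joined by three
edges. -/
abbrev Theta : Type := Quotient thetaSetoid

/-- The point with parameter `t` on the `i`-th edge of the theta graph; the two vertices are
`edgePt i 0` and `edgePt i 1`, for any `i`. -/
def edgePt (i : Fin 3) (t : I) : Theta := Quotient.mk thetaSetoid (i, t)

/-! ### Net total curvature -/

/-- The unit vector at `x` that points towards `y` (for `x ≠ y`). -/
def dir (x y : E3) : E3 := ‖y - x‖⁻¹ • (y - x)

/-- The function on the unit sphere equal to `-1` on the open hemisphere centred at `T` and to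
`+1` on the complementary hemisphere. -/
def chi (T : E3) (e : Metric.sphere (0 : E3) 1) : ℝ :=
  if 0 < inner ℝ T (e : E3) then -1 else 1

/-- The net curvature of a vertex with unit tangent vectors `T i`: one quarter of the integral,
with respect to surface area on the unit sphere, of the positive part of `∑ i, chi (T i)`
(the map `ENNReal.ofReal` takes the positive part). -/
def ntc {d : ℕ} (T : Fin d → E3) : ℝ≥0∞ :=
  4⁻¹ * ∫⁻ e : Metric.sphere (0 : E3) 1, ENNReal.ofReal (∑ i, chi (T i) e)
    ∂((volume : Measure E3).toSphere)

/-- A finite subdivision `0 = node 0 < node 1 < ⋯ < node (n + 1) = 1` of the unit interval. -/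
structure Subdivision where
  n : ℕ
  node : Fin (n + 2) → I
  strictMono : StrictMono node
  node_zero : node 0 = 0
  node_last : node (Fin.last (n + 1)) = 1

/-- The position of the `k`-th node on the `i`-th edge of the polygonal theta graph inscribed in
`f` along the subdivisions `S`. -/
def vertex (f : Theta → E3) (S : Fin 3 → Subdivision) (i : Fin 3) (k : Fin ((S i).n + 2)) : E3 :=
  f (edgePt i ((S i).node k))

/-- The net total curvature of the polygonal theta graph inscribed in `f` along the subdivisions
`S`: the sum of `ntc` over the two vertices of degree three and over the vertices of degree two,
which are the interior nodes of the three subdivisions. -/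
def polygonNTC (f : Theta → E3) (S : Fin 3 → Subdivision) : ℝ≥0∞ :=
  ntc (fun i : Fin 3 => dir (vertex f S i 0) (vertex f S i 1))
  + ntc (fun i : Fin 3 =>
      dir (vertex f S i (Fin.last _)) (vertex f S i (Fin.last (S i).n).castSucc))
  + ∑ i : Fin 3, ∑ k : Fin (S i).n,
      ntc ![dir (vertex f S i k.castSucc.succ) (vertex f S i k.castSucc.castSucc),
            dir (vertex f S i k.castSucc.succ) (vertex f S i k.succ.succ)]

/-- The net total curvature of a continuous theta graph: the supremum over all inscribed
polygonal theta graphs with the same two vertices of degree three. -/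
def netTotalCurvature (f : Theta → E3) : ℝ≥0∞ :=
  ⨆ S : Fin 3 → Subdivision, polygonNTC f S

/-! ### Planar convex curves with a chord, isotopy -/

/-- A planar convex curve: the relative boundary of a two-dimensional compact convex set. -/
def IsPlanarConvexCurve (C : Set E3) : Prop :=
  ∃ K : Set E3, Convex ℝ K ∧ IsCompact K ∧ Module.finrank ℝ (vectorSpan ℝ K) = 2 ∧
    C = intrinsicFrontier ℝ K

/-- A planar convex curve together with a straight chord, that is, a line segment which joins two
different points of the curve and does not meet the curve elsewhere. -/
def IsConvexCurveWithChord (Γ : Set E3) : Prop :=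
  ∃ (C : Set E3) (p q : E3), IsPlanarConvexCurve C ∧ p ∈ C ∧ q ∈ C ∧ p ≠ q ∧
    Disjoint (openSegment ℝ p q) C ∧ Γ = C ∪ segment ℝ p q

/-- Ambient isotopy of subsets of three-space. -/
def AmbientIsotopic (A B : Set E3) : Prop :=
  ∃ H : I → (E3 ≃ₜ E3), Continuous (fun x : I × E3 => H x.1 x.2) ∧
    H 0 = Homeomorph.refl E3 ∧ H 1 '' A = B

/-- The standard planar theta graph: the unit circle in the `xy`-plane and a diameter. -/
def standardTheta : Set E3 :=
  {x | x 0 ^ 2 + x 1 ^ 2 = 1 ∧ x 2 = 0} ∪ segment ℝ !₂[(-1 : ℝ), 0, 0] !₂[(1 : ℝ), 0, 0]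

end ThetaNTC

end

noncomputable section

namespace ThetaNTC

open Filter Topology

/-! ### Net total curvature as an integral over directions -/

/-! The proof is integral geometry. For a direction `e`, consider the height `inner ℝ (f x) e` on
the graph. `polygonNTC_eq` writes the net total curvature of an inscribed polygon as a quarter of
the integral over the sphere of the count `polySum`, in which each vertex contributes the positive
part of (edges going down) minus (edges going up). Since the sphere has area `4π`, an almost
everywhere bound `a` on the count becomes a bound `aπ` on the curvature. The key inequality
`crossings_le_polySum` says that the count is at least the number of times the polygon crosses any
level.

Lower bound: if `e` separates the heights of the two vertices, which holds almost everywhere, some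
level is crossed by all three edges, so the count is at least 3.

Isotopy: four crossings of a level survive rounding to a fine subdivision. If they occurred in
almost every direction, Fatou's lemma would give curvature at least `4π`
(`exists_direction_of_lt_four_pi`). So below `4π` there is a generic direction in which no level is
crossed four times. There each edge, followed from the higher vertex to the lower, goes up, down and
up, with at most one edge rising at its start and at most one at its end (`exists_pieces`). A middle
level cuts the graph into an upper and a lower piece. `exists_turn_branch` turns a rising branch
over so that the vertex becomes the top and all three edges descend from it. The pieces are then
cones over three points of the plane, and three strands converging to a point can always be
unbraided: the infinitely many twists are pushed into the tip (`exists_tubeMap_straight`).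
`exists_isotopicToId_cones` assembles the standard graph up to an affine map.

Equality: four crossings are stable under small changes of direction, so curvature `3π` excludes
them in every direction. Then the components orthogonal to the line through the vertices of points
on two different edges, when nonzero, are antiparallel (`orthPart_antiparallel`). Three edges cannot
be pairwise antiparallel, so one of them is the chord and the other two lie in a plane. The closed
curve they form is crossed at most twice by each line, hence is the boundary of its convex hull
(`image_cycle_eq_frontier`). Conversely, a generic plane meets a convex curve with a chord in at
most 2 + 1 points, and without four crossings Abel summation bounds the count by 3
(`polySum_le_three_of_pieces`). -/

/-- The value of `chi` at a vertex of height `a` for an edge whose other end has height `b`. -/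
def heightSign (a b : ℝ) : ℝ := if a < b then -1 else 1

theorem chi_dir (x y : E3) (e : Metric.sphere (0 : E3) 1) :
    chi (dir x y) e = heightSign (inner ℝ x (e : E3)) (inner ℝ y (e : E3)) := by
  unfold chi dir heightSign
  have : inner ℝ (‖y - x‖⁻¹ • (y - x)) (e : E3) =
      ‖y - x‖⁻¹ * (inner ℝ y (e : E3) - inner ℝ x (e : E3)) := by
    rw [real_inner_smul_left, inner_sub_left]
  rw [this]
  -- For `y = x` the direction is the zero vector, and both sides take the default value `1`.
  rcases eq_or_ne y x with rfl | h
  · simp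
  · have h' : 0 < ‖y - x‖⁻¹ := by
      rw [inv_pos]; exact norm_pos_iff.2 (sub_ne_zero.2 h)
    simp [mul_pos_iff_of_pos_left h']

theorem measurable_chi (T : E3) : Measurable (chi T) := by
  unfold chi
  refine Measurable.ite ?_ measurable_const measurable_const
  exact measurableSet_lt measurable_const (by fun_prop)

/-- The sum over the vertices of a polygonal theta graph of the positive parts of the signed
counts of edges, in terms of the heights `x i k` of the vertices on the `i`-th edge. -/
def polySum (n : Fin 3 → ℕ) (x : Fin 3 → ℕ → ℝ) : ℝ :=
  max 0 (∑ i, heightSign (x i 0) (x i 1))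
  + max 0 (∑ i, heightSign (x i (n i + 1)) (x i (n i)))
  + ∑ i, ∑ k ∈ Finset.range (n i),
      max 0 (heightSign (x i (k + 1)) (x i k) + heightSign (x i (k + 1)) (x i (k + 2)))

/-- The nodes of a subdivision, indexed by natural numbers. -/
def Subdivision.nodeNat (S : Subdivision) (k : ℕ) : I :=
  S.node ⟨min k (S.n + 1), by omega⟩

/-- The heights of the vertices of an inscribed polygonal theta graph. -/
def heights (f : Theta → E3) (S : Fin 3 → Subdivision) (e : E3) (i : Fin 3) (k : ℕ) : ℝ :=
  inner ℝ (f (edgePt i ((S i).nodeNat k))) e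

theorem ofReal_max_zero (x : ℝ) : ENNReal.ofReal (max 0 x) = ENNReal.ofReal x := by
  rcases le_total 0 x with h | h
  · rw [max_eq_right h]
  · rw [max_eq_left h, ENNReal.ofReal_of_nonpos h, ENNReal.ofReal_zero]

theorem ofReal_polySum (n : Fin 3 → ℕ) (x : Fin 3 → ℕ → ℝ) :
    ENNReal.ofReal (polySum n x) = ENNReal.ofReal (∑ i, heightSign (x i 0) (x i 1))
      + ENNReal.ofReal (∑ i, heightSign (x i (n i + 1)) (x i (n i)))
      + ∑ i, ∑ k ∈ Finset.range (n i), ENNReal.ofReal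
        (heightSign (x i (k + 1)) (x i k) + heightSign (x i (k + 1)) (x i (k + 2))) := by
  unfold polySum
  rw [ENNReal.ofReal_add (by positivity)
    (Finset.sum_nonneg fun i _ => Finset.sum_nonneg fun k _ => le_max_left _ _),
    ENNReal.ofReal_add (by positivity) (by positivity), ofReal_max_zero, ofReal_max_zero,
    ENNReal.ofReal_sum_of_nonneg
      (fun i _ => Finset.sum_nonneg fun k _ => le_max_left _ _)]
  congr 1
  refine Finset.sum_congr rfl fun i _ => ?_
  rw [ENNReal.ofReal_sum_of_nonneg fun k _ => le_max_left _ _]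
  exact Finset.sum_congr rfl fun k _ => ofReal_max_zero _

theorem measurable_ofReal_sum_chi {d : ℕ} (T : Fin d → E3) :
    Measurable fun e => ENNReal.ofReal (∑ i, chi (T i) e) :=
  (Finset.measurable_sum _ fun i _ => measurable_chi (T i)).ennreal_ofReal

theorem heights_eq (f : Theta → E3) (S : Fin 3 → Subdivision) (e : E3) (i : Fin 3)
    (k : Fin ((S i).n + 2)) : inner ℝ (vertex f S i k) e = heights f S e i k := by
  have : (⟨min (k : ℕ) ((S i).n + 1), by omega⟩ : Fin ((S i).n + 2)) = k := by
    ext; simp; omega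
  simp only [vertex, heights, Subdivision.nodeNat, this]

/-- The Crofton-type formula: all vertex integrals are over the same sphere, and at a vertex the
sign `chi` of an edge only records whether its other end is higher in the direction `e`. -/
theorem polygonNTC_eq (f : Theta → E3) (S : Fin 3 → Subdivision) :
    polygonNTC f S = 4⁻¹ * ∫⁻ e : Metric.sphere (0 : E3) 1,
      ENNReal.ofReal (polySum (fun i => (S i).n) (heights f S e))
        ∂((volume : Measure E3).toSphere) := by
  simp only [ofReal_polySum]
  unfold polygonNTC ntc
  simp only [← Finset.mul_sum, ← mul_add]
  have key : ∀ e : Metric.sphere (0 : E3) 1, ∀ i : Fin 3,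
      (∑ k ∈ Finset.range (S i).n, ENNReal.ofReal
        (heightSign (heights f S e i (k + 1)) (heights f S e i k)
          + heightSign (heights f S e i (k + 1)) (heights f S e i (k + 2))))
      = ∑ k : Fin (S i).n, ENNReal.ofReal (∑ j, chi
          (![dir (vertex f S i k.castSucc.succ) (vertex f S i k.castSucc.castSucc),
            dir (vertex f S i k.castSucc.succ) (vertex f S i k.succ.succ)] j) e) := by
    intro e i
    rw [Finset.sum_range]
    refine Finset.sum_congr rfl fun k _ => ?_
    rw [Fin.sum_univ_two]
    simp only [Matrix.cons_val_zero, Matrix.cons_val_one, chi_dir, heights_eq]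
    simp
  simp only [key]
  have h0 : ∀ e : Metric.sphere (0 : E3) 1,
      (∑ i, heightSign (heights f S e i 0) (heights f S e i 1))
        = ∑ i, chi (dir (vertex f S i 0) (vertex f S i 1)) e := by
    intro e
    refine Finset.sum_congr rfl fun i _ => ?_
    rw [chi_dir, heights_eq, heights_eq]; simp
  have h1 : ∀ e : Metric.sphere (0 : E3) 1,
      (∑ i, heightSign (heights f S e i ((S i).n + 1)) (heights f S e i (S i).n))
        = ∑ i, chi (dir (vertex f S i (Fin.last _))
            (vertex f S i (Fin.last (S i).n).castSucc)) e := by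
    intro e
    refine Finset.sum_congr rfl fun i _ => ?_
    rw [chi_dir, heights_eq, heights_eq]; simp
  simp only [h0, h1]
  rw [lintegral_add_left, lintegral_add_left, lintegral_finsetSum]
  · congr 3
    ext i
    rw [lintegral_finsetSum]
    exact fun k _ => measurable_ofReal_sum_chi _
  · exact fun i _ => Finset.measurable_sum _ fun k _ => measurable_ofReal_sum_chi _
  · exact measurable_ofReal_sum_chi _
  · exact (measurable_ofReal_sum_chi _).add (measurable_ofReal_sum_chi _)

/-! ### Area of the sphere and generic directions -/

theorem sphere_area : (volume : Measure E3).toSphere Set.univ = ENNReal.ofReal (4 * Real.pi) := by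
  rw [Measure.toSphere_apply_univ, EuclideanSpace.volume_ball_fin_three]
  simp only [finrank_euclideanSpace, Fintype.card_fin]
  simp only [ENNReal.ofReal_one, one_pow, one_mul]
  rw [← ENNReal.ofReal_natCast, ← ENNReal.ofReal_mul (by positivity)]
  congr 1; push_cast; ring

/-- The cone over this great circle lies in the hyperplane orthogonal to `v`, which is null in
space. -/
theorem toSphere_orthogonal {v : E3} (hv : v ≠ 0) :
    (volume : Measure E3).toSphere {e | inner ℝ v (e : E3) = 0} = 0 := by
  have hm : MeasurableSet {e : Metric.sphere (0 : E3) 1 | inner ℝ v (e : E3) = 0} :=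
    measurableSet_eq_fun (by fun_prop) measurable_const
  rw [Measure.toSphere_apply' _ hm]
  have : volume ((Submodule.span ℝ {v})ᗮ : Set E3) = 0 := by
    apply Measure.addHaar_submodule
    intro h
    have h2 : v ∈ (Submodule.span ℝ {v})ᗮ := by rw [h]; trivial
    rw [Submodule.mem_orthogonal_singleton_iff_inner_right] at h2
    exact hv (inner_self_eq_zero.1 h2)
  rw [measure_mono_null ?_ this, mul_zero]
  rintro _ ⟨r, -, _, ⟨e, he, rfl⟩, rfl⟩
  rw [SetLike.mem_coe, Submodule.mem_orthogonal_singleton_iff_inner_right]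
  rw [Set.mem_ofPred_eq] at he
  change inner ℝ v (r • (e : E3)) = 0
  rw [inner_smul_right, he, mul_zero]

theorem ae_inner_ne {x y : E3} (h : x ≠ y) :
    ∀ᵐ e : Metric.sphere (0 : E3) 1 ∂((volume : Measure E3).toSphere),
      inner ℝ x (e : E3) ≠ inner ℝ y (e : E3) := by
  have := toSphere_orthogonal (sub_ne_zero.2 h)
  rw [ae_iff]
  refine measure_mono_null (fun e he => ?_) this
  simp only [ne_eq, not_not, Set.mem_ofPred_eq] at he ⊢
  rw [inner_sub_left, he, sub_self]

/-! ### Level crossings -/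

/-- The indicator of the heights above the level `c`. -/
def above (c a : ℝ) : ℝ := if c < a then 1 else 0

/-- Regroups a sum over vertices as a sum over edges: `A k` is the sign of the `k`-th edge at its
first end, `B k` the one at its second end, and `ω` is a weight on the vertices. -/
theorem sum_weighted_signs (A B ω : ℕ → ℝ) (n : ℕ) :
    ω 0 * A 0 + ω (n + 1) * B n + ∑ k ∈ Finset.range n, ω (k + 1) * (B k + A (k + 1))
      = ∑ k ∈ Finset.range (n + 1), (ω k * A k + ω (k + 1) * B k) := by
  induction n with
  | zero => simp
  | succ n ih => rw [Finset.sum_range_succ _ (n + 1), ← ih, Finset.sum_range_succ]; ring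

/-- The positive part dominates every multiple by a weight in `[0, 1]`, so any choice of vertex
weights bounds `polySum` from below. -/
theorem mul_le_max {a x : ℝ} (h0 : 0 ≤ a) (h1 : a ≤ 1) : a * x ≤ max 0 x := by
  rcases le_total 0 x with h | h
  · rw [max_eq_right h]; nlinarith
  · exact (mul_nonpos_of_nonneg_of_nonpos h0 h).trans (le_max_left _ _)

theorem above_nonneg (c a : ℝ) : 0 ≤ above c a := by unfold above; split_ifs <;> norm_num

theorem above_le_one (c a : ℝ) : above c a ≤ 1 := by unfold above; split_ifs <;> norm_num

/-- For every level, the number of times a polygonal theta graph crosses the level is bounded by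
its sum of positive parts. -/
theorem crossings_le_polySum (n : Fin 3 → ℕ) (x : Fin 3 → ℕ → ℝ) (hp : ∀ i j, x i 0 = x j 0)
    (hq : ∀ i j, x i (n i + 1) = x j (n j + 1)) (c : ℝ) :
    ∑ i, ∑ k ∈ Finset.range (n i + 1), |above c (x i k) - above c (x i (k + 1))|
      ≤ polySum n x := by
  -- The weight of a vertex is `1` above the level and `0` otherwise. An edge crossing the level has
  -- sign `1` at its upper end and contributes exactly `1`; otherwise it contributes `0`, or `2`
  -- when its ends have the same height above the level.
  have h1 : ∑ i, ∑ k ∈ Finset.range (n i + 1), |above c (x i k) - above c (x i (k + 1))| ≤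
      ∑ i, ∑ k ∈ Finset.range (n i + 1), (above c (x i k) * heightSign (x i k) (x i (k + 1))
        + above c (x i (k + 1)) * heightSign (x i (k + 1)) (x i k)) := by
    refine Finset.sum_le_sum fun i _ => Finset.sum_le_sum fun k _ => ?_
    generalize x i k = a
    generalize x i (k + 1) = b
    unfold above heightSign
    split_ifs <;> first | (exfalso; linarith) | norm_num
  refine h1.trans ?_
  simp only [← sum_weighted_signs (fun k => heightSign (x _ k) (x _ (k + 1)))
    (fun k => heightSign (x _ (k + 1)) (x _ k)) (fun k => above c (x _ k))]
  rw [Finset.sum_add_distrib, Finset.sum_add_distrib]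
  unfold polySum
  refine add_le_add (add_le_add ?_ ?_) ?_
  -- The weight depends only on the height, so the three edges share it at a common vertex.
  · simp only [fun i => hp i 0, ← Finset.mul_sum]
    exact mul_le_max (above_nonneg _ _) (above_le_one _ _)
  · simp only [fun i => hq i 0, ← Finset.mul_sum]
    exact mul_le_max (above_nonneg _ _) (above_le_one _ _)
  · exact Finset.sum_le_sum fun i _ => Finset.sum_le_sum fun k _ =>
      mul_le_max (above_nonneg _ _) (above_le_one _ _)

theorem abs_sub_le_sum (y : ℕ → ℝ) {a b : ℕ} (h : a ≤ b) :
    |y a - y b| ≤ ∑ k ∈ Finset.Ico a b, |y k - y (k + 1)| := by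
  simpa [Real.dist_eq] using dist_le_Ico_sum_dist y h

/-- A polygonal theta graph crosses each level at least as often as a coarser chain of heights. -/
theorem chain_le_crossings (y : ℕ → ℝ) (m N : ℕ) (κ : ℕ → ℕ) (hκ : Monotone κ) (h0 : κ 0 = 0)
    (hN : κ m = N) : ∑ j ∈ Finset.range m, |y (κ j) - y (κ (j + 1))|
      ≤ ∑ k ∈ Finset.range N, |y k - y (k + 1)| := by
  subst hN
  induction m with
  | zero => simp [h0]
  | succ m ih =>
    rw [Finset.sum_range_succ, Finset.range_eq_Ico (κ (m + 1)),
      ← Finset.sum_Ico_consecutive _ (Nat.zero_le (κ m)) (hκ m.le_succ), ← Finset.range_eq_Ico]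
    exact add_le_add ih (abs_sub_le_sum y (hκ m.le_succ))

theorem three_le_polySum (n : Fin 3 → ℕ) (x : Fin 3 → ℕ → ℝ) (hp : ∀ i j, x i 0 = x j 0)
    (hq : ∀ i j, x i (n i + 1) = x j (n j + 1)) (hpq : x 0 0 ≠ x 0 (n 0 + 1)) :
    3 ≤ polySum n x := by
  -- As `above` is strict, the level of the lower vertex separates the two vertices, and every edge
  -- has to cross it.
  refine le_trans ?_ (crossings_le_polySum n x hp hq (min (x 0 0) (x 0 (n 0 + 1))))
  have : ∀ i : Fin 3, (1 : ℝ) ≤ ∑ k ∈ Finset.range (n i + 1),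
      |above (min (x 0 0) (x 0 (n 0 + 1))) (x i k)
        - above (min (x 0 0) (x 0 (n 0 + 1))) (x i (k + 1))| := by
    intro i
    rw [Finset.range_eq_Ico]
    refine le_trans ?_ (abs_sub_le_sum (fun k => above _ (x i k)) (Nat.zero_le (n i + 1)))
    simp only [hp i 0, hq i 0]
    unfold above
    rcases lt_or_gt_of_ne hpq with h | h
    · rw [min_eq_left h.le]; simp [h]
    · rw [min_eq_right h.le]; simp [h]
  calc (3 : ℝ) = ∑ i : Fin 3, 1 := by simp
    _ ≤ _ := Finset.sum_le_sum fun i _ => this i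

/-! ### Approximation by uniform subdivisions -/

/-- The subdivision of the unit interval into `N + 1` intervals of the same length. -/
def uniformSubdivision (N : ℕ) : Subdivision where
  n := N
  node k := ⟨(k : ℕ) / ((N : ℝ) + 1), by positivity, by
    rw [div_le_one (by positivity)]; exact_mod_cast Nat.le_of_lt_succ k.2⟩
  strictMono := by
    intro a b h
    rw [← Subtype.coe_lt_coe]
    simp only
    gcongr
    exact_mod_cast h
  node_zero := by ext; simp
  node_last := by
    ext; simp only [Fin.val_last, Nat.cast_add, Nat.cast_one, Set.Icc.coe_one]
    exact div_self (by positivity)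

theorem nodeNat_zero (S : Subdivision) : S.nodeNat 0 = 0 := by
  rw [← S.node_zero]; rfl

theorem nodeNat_last (S : Subdivision) : S.nodeNat (S.n + 1) = 1 := by
  rw [← S.node_last]; unfold Subdivision.nodeNat; congr 1; ext; simp

theorem edgePt_zero (i j : Fin 3) : edgePt i 0 = edgePt j 0 :=
  Quotient.sound (Or.inr (Or.inl ⟨rfl, rfl⟩))

theorem edgePt_one (i j : Fin 3) : edgePt i 1 = edgePt j 1 :=
  Quotient.sound (Or.inr (Or.inr ⟨rfl, rfl⟩))

theorem edgePt_eq_iff {i j : Fin 3} {s t : I} : edgePt i s = edgePt j t ↔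
    (i = j ∧ s = t) ∨ (s = 0 ∧ t = 0) ∨ (s = 1 ∧ t = 1) := by
  unfold edgePt
  rw [Quotient.eq]
  change ((i, s) = (j, t) ∨ _) ↔ _
  rw [Prod.mk.injEq]

theorem continuous_edgePt (i : Fin 3) : Continuous (edgePt i) :=
  continuous_quotient_mk'.comp (by fun_prop)

theorem vertices_ne : edgePt 0 0 ≠ edgePt 0 1 := by
  rw [Ne, edgePt_eq_iff]; simp

/-- A function on the theta graph crosses the level `c` at least four times, as witnessed by a
chain of six points on each edge. -/
def FourCrossing (h : Theta → ℝ) (c : ℝ) : Prop :=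
  ∃ τ : Fin 3 → ℕ → I, (∀ i, Monotone (τ i)) ∧ (∀ i, τ i 0 = 0) ∧ (∀ i, τ i 5 = 1) ∧
    (∀ i j, h (edgePt i (τ i j)) ≠ c) ∧
    4 ≤ ∑ i, ∑ j ∈ Finset.range 5,
      |above c (h (edgePt i (τ i j))) - above c (h (edgePt i (τ i (j + 1))))|

theorem eventually_above_eq {a c : ℝ} (h : a ≠ c) :
    ∀ᶠ b in 𝓝 a, b ≠ c ∧ above c b = above c a := by
  rcases lt_or_gt_of_ne h with h | h
  · filter_upwards [gt_mem_nhds h] with b hb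
    exact ⟨hb.ne, by simp [above, hb.not_gt, h.not_gt]⟩
  · filter_upwards [lt_mem_nhds h] with b hb
    exact ⟨hb.ne', by simp [above, hb, h]⟩

theorem tendsto_uniform_nodeNat (t : I) :
    Tendsto (fun N : ℕ => (uniformSubdivision N).nodeNat ⌊(t : ℝ) * (N + 1)⌋₊) atTop (𝓝 t) := by
  rw [tendsto_subtype_rng]
  have h1 : Tendsto (fun x : ℕ => (⌊(t : ℝ) * ((x : ℝ) + 1)⌋₊ : ℝ) / ((x : ℝ) + 1)) atTop
      (𝓝 (t : ℝ)) :=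
    (tendsto_nat_floor_mul_div_atTop t.2.1).comp
      (tendsto_atTop_add_const_right _ 1 tendsto_natCast_atTop_atTop)
  refine h1.congr fun N => ?_
  have : ⌊(t : ℝ) * (N + 1)⌋₊ ≤ N + 1 := by
    apply Nat.floor_le_of_le
    push_cast
    exact mul_le_of_le_one_left (by positivity) t.2.2
  simp [Subdivision.nodeNat, uniformSubdivision, this]

theorem heights_zero (f : Theta → E3) (S : Fin 3 → Subdivision) (e : E3) (i : Fin 3) :
    heights f S e i 0 = inner ℝ (f (edgePt 0 0)) e := by
  rw [heights, nodeNat_zero, edgePt_zero i 0]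

theorem heights_last (f : Theta → E3) (S : Fin 3 → Subdivision) (e : E3) (i : Fin 3) :
    heights f S e i ((S i).n + 1) = inner ℝ (f (edgePt 0 1)) e := by
  rw [heights, nodeNat_last, edgePt_one i 0]

/-- The six chain points on each edge have heights different from `c`, so their sides of the level
do not change when they are rounded to nodes of a fine subdivision, nor when the direction is then
slightly moved. -/
theorem FourCrossing.eventually_four_le {f : Theta → E3} (hf : Continuous f) {e₀ : E3} {c : ℝ}
    (h : FourCrossing (fun x => inner ℝ (f x) e₀) c) :
    ∀ᶠ N in atTop, ∀ᶠ e in 𝓝 e₀,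
      4 ≤ polySum (fun _ => N) (heights f (fun _ => uniformSubdivision N) e) := by
  obtain ⟨τ, hm, h0, h5, hc, h4⟩ := h
  have h1 : ∀ᶠ N : ℕ in atTop, ∀ i : Fin 3, ∀ j ∈ Finset.range 6, ∀ᶠ e in 𝓝 e₀,
      above c (heights f (fun _ => uniformSubdivision N) e i ⌊(τ i j : ℝ) * (N + 1)⌋₊)
        = above c (inner ℝ (f (edgePt i (τ i j))) e₀) := by
    rw [eventually_all]
    intro i
    rw [eventually_all_finset]
    intro j _
    have hcont : Continuous fun t => inner ℝ (f (edgePt i t)) e₀ :=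
      (hf.comp (continuous_edgePt i)).inner continuous_const
    have := (hcont.tendsto _).comp (tendsto_uniform_nodeNat (τ i j))
    filter_upwards [this.eventually (eventually_above_eq (hc i j))] with N hN
    have hcont2 : Continuous fun e => heights f (fun _ => uniformSubdivision N) e i
        ⌊(τ i j : ℝ) * (N + 1)⌋₊ := by
      unfold heights; fun_prop
    filter_upwards [(hcont2.tendsto e₀).eventually (eventually_above_eq hN.1)] with e he
    rw [he.2]; exact hN.2
  filter_upwards [h1] with N hN
  filter_upwards [eventually_all.2 fun i => (eventually_all_finset _).2 (hN i)] with e he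
  refine h4.trans (le_trans ?_ (crossings_le_polySum _ _
    (fun i j => by rw [heights_zero, heights_zero])
    (fun i j => (heights_last f (fun _ => uniformSubdivision N) e i).trans
      (heights_last f (fun _ => uniformSubdivision N) e j).symm) c))
  refine Finset.sum_le_sum fun i _ => ?_
  -- The chain point with parameter `t` is rounded to the node with index `⌊t * (N + 1)⌋`;
  -- monotonicity of the chain makes these indices monotone.
  refine le_trans (le_of_eq ?_) (chain_le_crossings
    (fun k => above c (heights f (fun _ => uniformSubdivision N) e i k)) 5 (N + 1)
    (fun j => ⌊(τ i j : ℝ) * (N + 1)⌋₊) ?_ ?_ ?_)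
  · refine Finset.sum_congr rfl fun j hj => ?_
    rw [Finset.mem_range] at hj
    simp only
    rw [he i j (by simp; omega), he i (j + 1) (by simp; omega)]
  · intro a b hab
    apply Nat.floor_mono
    have : (τ i a : ℝ) ≤ τ i b := hm i hab
    gcongr
  · simp [h0]
  · simp only [h5, Set.Icc.coe_one, one_mul]
    exact_mod_cast Nat.floor_natCast (N + 1)

theorem measurable_polySum_heights (f : Theta → E3) (S : Fin 3 → Subdivision) :
    Measurable fun e : Metric.sphere (0 : E3) 1 =>
      ENNReal.ofReal (polySum (fun i => (S i).n) (heights f S e)) := by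
  have h : ∀ i k, Measurable fun e : Metric.sphere (0 : E3) 1 => heights f S e i k := by
    intro i k; unfold heights; fun_prop
  have hs : ∀ i k l, Measurable fun e : Metric.sphere (0 : E3) 1 =>
      heightSign (heights f S e i k) (heights f S e i l) := by
    intro i k l
    exact Measurable.ite (measurableSet_lt (h i k) (h i l)) measurable_const measurable_const
  refine Measurable.ennreal_ofReal ?_
  unfold polySum
  refine ((measurable_const.max (Finset.measurable_fun_sum _ fun i _ => hs i _ _)).add
    (measurable_const.max (Finset.measurable_fun_sum _ fun i _ => hs i _ _))).add
    (Finset.measurable_fun_sum _ fun i _ => Finset.measurable_fun_sum _ fun k _ =>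
      measurable_const.max ((hs i _ _).add (hs i _ _)))

theorem ae_three_le {f : Theta → E3} (hne : f (edgePt 0 0) ≠ f (edgePt 0 1))
    (S : Fin 3 → Subdivision) :
    ∀ᵐ e : Metric.sphere (0 : E3) 1 ∂((volume : Measure E3).toSphere),
      3 ≤ polySum (fun i => (S i).n) (heights f S e) := by
  filter_upwards [ae_inner_ne hne] with e he
  refine three_le_polySum _ _ (fun i j => by rw [heights_zero, heights_zero])
    (fun i j => by rw [heights_last, heights_last]) ?_
  rw [heights_zero, heights_last]; exact he

/-! ### Bounds on the curvature and bounds in almost every direction -/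

theorem ofReal_mul_pi (a : ℝ) (ha : 0 ≤ a) :
    ENNReal.ofReal (a * Real.pi) = 4⁻¹ * (ENNReal.ofReal a * ENNReal.ofReal (4 * Real.pi)) := by
  rw [← ENNReal.ofReal_mul ha, show (4 : ℝ≥0∞)⁻¹ = ENNReal.ofReal (4⁻¹) by
    rw [ENNReal.ofReal_inv_of_pos (by norm_num)]; norm_num, ← ENNReal.ofReal_mul (by norm_num)]
  congr 1; ring

theorem three_pi_le_netTotalCurvature {f : Theta → E3}
    (hne : f (edgePt 0 0) ≠ f (edgePt 0 1)) :
    ENNReal.ofReal (3 * Real.pi) ≤ netTotalCurvature f := by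
  -- Even the coarsest polygon, in which all three edges become the same chord, has a count of at
  -- least 3 in almost every direction.
  refine le_trans ?_ (le_iSup _ fun _ => uniformSubdivision 0)
  rw [polygonNTC_eq, ofReal_mul_pi 3 (by norm_num), ← sphere_area, ← lintegral_const]
  gcongr 4⁻¹ * ?_
  refine lintegral_mono_ae ?_
  filter_upwards [ae_three_le hne fun _ => uniformSubdivision 0] with e he
  exact ENNReal.ofReal_le_ofReal he

theorem netTotalCurvature_le_three_pi {f : Theta → E3}
    (h : ∀ S : Fin 3 → Subdivision,
      ∀ᵐ e : Metric.sphere (0 : E3) 1 ∂((volume : Measure E3).toSphere),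
        polySum (fun i => (S i).n) (heights f S e) ≤ 3) :
    netTotalCurvature f ≤ ENNReal.ofReal (3 * Real.pi) := by
  refine iSup_le fun S => ?_
  rw [polygonNTC_eq, ofReal_mul_pi 3 (by norm_num), ← sphere_area, ← lintegral_const]
  gcongr 4⁻¹ * ?_
  refine lintegral_mono_ae ?_
  filter_upwards [h S] with e he
  exact ENNReal.ofReal_le_ofReal he

theorem lintegral_polySum_le {f : Theta → E3} {a : ℝ} (ha : 0 ≤ a)
    (h : netTotalCurvature f ≤ ENNReal.ofReal (a * Real.pi)) (S : Fin 3 → Subdivision) :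
    ∫⁻ e : Metric.sphere (0 : E3) 1, ENNReal.ofReal (polySum (fun i => (S i).n) (heights f S e))
      ∂((volume : Measure E3).toSphere) ≤ ENNReal.ofReal a * ENNReal.ofReal (4 * Real.pi) := by
  have := (le_iSup (polygonNTC f) S).trans h
  rw [polygonNTC_eq, ofReal_mul_pi a ha] at this
  exact (ENNReal.mul_le_mul_iff_right (by simp) (by simp)).1 this

/-- A four-crossing in one direction makes the count at least 4 on a nonempty open set, while it is
at least 3 almost everywhere; the integral would exceed `3 * 4π`. -/
theorem not_fourCrossing_of_le_three_pi {f : Theta → E3} (hf : Continuous f)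
    (hne : f (edgePt 0 0) ≠ f (edgePt 0 1))
    (h : netTotalCurvature f ≤ ENNReal.ofReal (3 * Real.pi)) (e₀ : Metric.sphere (0 : E3) 1)
    (c : ℝ) : ¬ FourCrossing (fun x => inner ℝ (f x) (e₀ : E3)) c := by
  intro hc
  obtain ⟨N, hN⟩ := (hc.eventually_four_le hf).exists
  have hN' : ∀ᶠ e : Metric.sphere (0 : E3) 1 in 𝓝 e₀,
      4 ≤ polySum (fun _ => N) (heights f (fun _ => uniformSubdivision N) e) :=
    (continuous_subtype_val.tendsto e₀).eventually hN
  obtain ⟨U, hU, hUo, heU⟩ := eventually_nhds_iff.1 hN'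
  set μ := (volume : Measure E3).toSphere with hμ
  have hpos : 0 < μ U := hUo.measure_pos μ ⟨e₀, heU⟩
  have h1 := lintegral_polySum_le (by norm_num) h fun _ => uniformSubdivision N
  have h2 : ∫⁻ e, ((fun _ => ENNReal.ofReal 3) e + U.indicator 1 e) ∂μ ≤
      ∫⁻ e : Metric.sphere (0 : E3) 1, ENNReal.ofReal
        (polySum (fun _ => N) (heights f (fun _ => uniformSubdivision N) e)) ∂μ := by
    refine lintegral_mono_ae ?_
    filter_upwards [ae_three_le hne fun _ => uniformSubdivision N] with e he
    by_cases heu : e ∈ U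
    · rw [Set.indicator_of_mem heu, Pi.one_apply, ← ENNReal.ofReal_one,
        ← ENNReal.ofReal_add (by norm_num) (by norm_num)]
      refine ENNReal.ofReal_le_ofReal (le_trans (by norm_num) (hU e heu))
    · rw [Set.indicator_of_notMem heu, add_zero]
      exact ENNReal.ofReal_le_ofReal he
  rw [lintegral_add_left measurable_const, lintegral_const, lintegral_indicator_one
    hUo.measurableSet, sphere_area] at h2
  have h3 := h2.trans h1
  have h4 : ENNReal.ofReal 3 * ENNReal.ofReal (4 * Real.pi) ≠ ∞ :=
    ENNReal.mul_ne_top ENNReal.ofReal_ne_top ENNReal.ofReal_ne_top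
  exact absurd h3 (not_le.2 (ENNReal.lt_add_right h4 hpos.ne'))

/-- Otherwise the count for fine uniform subdivisions is eventually at least 4 in almost every
direction, and Fatou's lemma gives curvature at least `4π`. The property `Q` allows further
genericity of the direction. -/
theorem exists_direction_of_lt_four_pi {f : Theta → E3} (hf : Continuous f)
    (h : netTotalCurvature f < ENNReal.ofReal (4 * Real.pi))
    {Q : Metric.sphere (0 : E3) 1 → Prop} (hQ : ∀ᵐ e ∂((volume : Measure E3).toSphere), Q e) :
    ∃ e : Metric.sphere (0 : E3) 1, Q e ∧
      ∀ c, ¬ FourCrossing (fun x => inner ℝ (f x) (e : E3)) c := by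
  set μ := (volume : Measure E3).toSphere with hμ
  by_contra! hcon
  have h1 : ∀ᵐ e : Metric.sphere (0 : E3) 1 ∂μ, ENNReal.ofReal 4 ≤ liminf (fun N : ℕ =>
      ENNReal.ofReal (polySum (fun _ => N)
        (heights f (fun _ => uniformSubdivision N) e))) atTop := by
    filter_upwards [hQ] with e he
    obtain ⟨c, hc⟩ := hcon e he
    refine le_liminf_of_le (by isBoundedDefault) ?_
    filter_upwards [hc.eventually_four_le hf] with N hN
    exact ENNReal.ofReal_le_ofReal hN.self_of_nhds
  have h2 := lintegral_mono_ae h1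
  rw [lintegral_const, sphere_area] at h2
  have h3 := h2.trans (lintegral_liminf_le
    fun N => measurable_polySum_heights f fun _ => uniformSubdivision N)
  have h4 : liminf (fun N : ℕ => ∫⁻ e : Metric.sphere (0 : E3) 1,
      ENNReal.ofReal (polySum (fun _ => N) (heights f (fun _ => uniformSubdivision N) e)) ∂μ) atTop
      ≤ 4 * netTotalCurvature f := by
    refine liminf_le_of_le (by isBoundedDefault) fun b hb => ?_
    obtain ⟨N, hN⟩ := hb.exists
    refine hN.trans ?_
    have := le_iSup (polygonNTC f) fun _ => uniformSubdivision N
    rw [polygonNTC_eq] at this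
    calc _ = 4 * (4⁻¹ * ∫⁻ e : Metric.sphere (0 : E3) 1, ENNReal.ofReal (polySum (fun _ => N)
          (heights f (fun _ => uniformSubdivision N) e)) ∂μ) := by
            rw [← mul_assoc, ENNReal.mul_inv_cancel (by simp) (by simp), one_mul]
      _ ≤ _ := by gcongr; exact this
  have h5 := h3.trans h4
  rw [ENNReal.ofReal_ofNat, ENNReal.mul_le_mul_iff_right (by simp) (by simp)] at h5
  exact absurd h5 (not_le.2 h)

/-! ### Functions on the theta graph with few level crossings -/

/-- No chain of points on the edges shows four crossings of a level. -/
def NoFourCrossing (h : Theta → ℝ) : Prop :=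
  ∀ c, ∀ τ : Fin 3 → ℕ → I, (∀ i, Monotone (τ i)) → (∀ i, τ i 0 = 0) → (∀ i, τ i 5 = 1) →
    ∑ i, ∑ j ∈ Finset.range 5,
      |above c (h (edgePt i (τ i j))) - above c (h (edgePt i (τ i (j + 1))))| < 4

theorem eventually_above_level (a c : ℝ) :
    ∀ᶠ c' in 𝓝[>] c, a ≠ c' ∧ above c' a = above c a := by
  rcases le_or_gt a c with h | h
  · filter_upwards [self_mem_nhdsWithin] with c' hc'
    have hc' : c < c' := hc'
    exact ⟨(h.trans_lt hc').ne, by simp [above, h.not_gt, (h.trans_lt hc').not_gt]⟩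
  · filter_upwards [mem_nhdsWithin_of_mem_nhds (gt_mem_nhds h)] with c' hc'
    have hc' : c' < a := hc'
    exact ⟨hc'.ne', by simp [above, h, hc']⟩

/-- `NoFourCrossing` also covers chains that touch the level. Raising the level slightly makes the
finitely many chain points avoid it and, since `above` is strict, does not change their sides. -/
theorem noFourCrossing_of_forall {h : Theta → ℝ} (H : ∀ c, ¬ FourCrossing h c) :
    NoFourCrossing h := by
  intro c τ hm h0 h5
  by_contra! hcon
  have h1 : ∀ᶠ c' in 𝓝[>] c, ∀ i : Fin 3, ∀ j ∈ Finset.range 6,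
      h (edgePt i (τ i j)) ≠ c' ∧ above c' (h (edgePt i (τ i j)))
        = above c (h (edgePt i (τ i j))) :=
    eventually_all.2 fun i => (eventually_all_finset _).2 fun j _ => eventually_above_level _ _
  obtain ⟨c', hc'⟩ := h1.exists
  refine H c' ⟨τ, hm, h0, h5, fun i j => ?_, hcon.trans (le_of_eq ?_)⟩
  · rcases le_or_gt j 5 with hj | hj
    · exact (hc' i j (by simp; omega)).1
    -- Beyond index 5 a monotone chain stays at the end of the edge.
    · have : τ i j = τ i 5 := le_antisymm (by rw [h5]; exact unitInterval.le_one') (hm i hj.le)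
      rw [this]
      exact (hc' i 5 (by simp)).1
  · refine Finset.sum_congr rfl fun i _ => Finset.sum_congr rfl fun j hj => ?_
    rw [Finset.mem_range] at hj
    rw [(hc' i j (by simp; omega)).2, (hc' i (j + 1) (by simp; omega)).2]

/-- A chain of six points on an edge from one vertex to the other. -/
def chain (a b c d : I) : ℕ → I
  | 0 => 0
  | 1 => a
  | 2 => b
  | 3 => c
  | 4 => d
  | _ => 1

theorem monotone_chain {a b c d : I} (hab : a ≤ b) (hbc : b ≤ c) (hcd : c ≤ d) :
    Monotone (chain a b c d) := by
  refine monotone_nat_of_le_succ fun n => ?_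
  match n with
  | 0 => exact unitInterval.nonneg'
  | 1 => exact hab
  | 2 => exact hbc
  | 3 => exact hcd
  | 4 => exact unitInterval.le_one'
  | _ + 5 => exact le_rfl

/-- The number of level crossings along a chain of points of an edge. -/
def edgeVar (h : Theta → ℝ) (l : ℝ) (i : Fin 3) (a b c d : I) : ℝ :=
  |above l (h (edgePt i 0)) - above l (h (edgePt i a))|
  + |above l (h (edgePt i a)) - above l (h (edgePt i b))|
  + |above l (h (edgePt i b)) - above l (h (edgePt i c))|
  + |above l (h (edgePt i c)) - above l (h (edgePt i d))|
  + |above l (h (edgePt i d)) - above l (h (edgePt i 1))|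

theorem NoFourCrossing.two_edges {h : Theta → ℝ} (H : NoFourCrossing h) {i j : Fin 3} (hij : i ≠ j)
    (l : ℝ) {a b c d a' b' c' d' : I} (h1 : a ≤ b) (h2 : b ≤ c) (h3 : c ≤ d) (h1' : a' ≤ b')
    (h2' : b' ≤ c') (h3' : c' ≤ d') :
    edgeVar h l i a b c d + edgeVar h l j a' b' c' d' +
      |above l (h (edgePt 0 0)) - above l (h (edgePt 0 1))| < 4 := by
  obtain ⟨k, hk, hki, hkj⟩ : ∃ k : Fin 3, (Finset.univ : Finset (Fin 3)) = {i, j, k} ∧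
      k ≠ i ∧ k ≠ j := by
    revert i j; decide
  -- The third edge gets the trivial chain, whose variation only compares the two vertices.
  have := H l (fun m => if m = i then chain a b c d else if m = j then chain a' b' c' d'
    else chain 0 0 0 0) ?_ ?_ ?_
  · rw [hk, Finset.sum_insert (by simp [hij, hki.symm]), Finset.sum_insert (by simp [hkj.symm]),
      Finset.sum_singleton] at this
    simp only [Finset.sum_range_succ, Finset.sum_range_zero, if_true, hij.symm, hki, hkj, if_false,
      chain, sub_self, abs_zero, zero_add] at this
    rw [edgePt_zero 0 k, edgePt_one 0 k]
    unfold edgeVar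
    linarith
  · intro m
    split_ifs
    exacts [monotone_chain h1 h2 h3, monotone_chain h1' h2' h3',
      monotone_chain le_rfl le_rfl le_rfl]
  · intro m
    split_ifs <;> rfl
  · intro m
    split_ifs <;> rfl

theorem above_of_lt {c a : ℝ} (h : c < a) : above c a = 1 := by simp [above, h]

theorem above_of_le {c a : ℝ} (h : a ≤ c) : above c a = 0 := by simp [above, h.not_gt]

theorem above_eq_zero_or_one (c a : ℝ) : above c a = 0 ∨ above c a = 1 := by
  unfold above; split_ifs <;> simp

/-- With three changes of side on one edge there are already four crossings: if the vertices are on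
the same side, the number of changes on this edge is even; if not, each of the other two edges adds
one. -/
theorem NoFourCrossing.alternating {h : Theta → ℝ} (H : NoFourCrossing h) {i : Fin 3} {l : ℝ}
    {a b c d : I} (h1 : a ≤ b) (h2 : b ≤ c) (h3 : c ≤ d)
    (hab : above l (h (edgePt i a)) ≠ above l (h (edgePt i b)))
    (hbc : above l (h (edgePt i b)) ≠ above l (h (edgePt i c)))
    (hcd : above l (h (edgePt i c)) ≠ above l (h (edgePt i d))) : False := by
  obtain ⟨j, hj⟩ : ∃ j : Fin 3, i ≠ j := (exists_ne i).imp fun _ h => h.symm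
  have := H.two_edges hj l h1 h2 h3 (le_refl (0 : I)) (le_refl (0 : I)) (le_refl (0 : I))
  unfold edgeVar at this
  rw [edgePt_zero i 0, edgePt_zero j 0, edgePt_one i 0, edgePt_one j 0] at this
  revert this hab hbc hcd
  rcases above_eq_zero_or_one l (h (edgePt i a)) with e1 | e1 <;>
  rcases above_eq_zero_or_one l (h (edgePt i b)) with e2 | e2 <;>
  rcases above_eq_zero_or_one l (h (edgePt i c)) with e3 | e3 <;>
  rcases above_eq_zero_or_one l (h (edgePt i d)) with e4 | e4 <;>
  rcases above_eq_zero_or_one l (h (edgePt 0 0)) with e5 | e5 <;>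
  rcases above_eq_zero_or_one l (h (edgePt 0 1)) with e6 | e6 <;>
  rw [e1, e2, e3, e4, e5, e6] <;> norm_num

theorem NoFourCrossing.high_low {h : Theta → ℝ} (H : NoFourCrossing h) {i : Fin 3} {l : ℝ}
    {a b c d : I} (h1 : a ≤ b) (h2 : b ≤ c) (h3 : c ≤ d) (ha : l < h (edgePt i a))
    (hb : h (edgePt i b) ≤ l) (hc : l < h (edgePt i c)) (hd : h (edgePt i d) ≤ l) : False :=
  H.alternating (i := i) (l := l) h1 h2 h3 (by simp [above_of_lt ha, above_of_le hb])
    (by simp [above_of_lt hc, above_of_le hb]) (by simp [above_of_lt hc, above_of_le hd])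

theorem NoFourCrossing.low_high {h : Theta → ℝ} (H : NoFourCrossing h) {i : Fin 3} {l : ℝ}
    {a b c d : I} (h1 : a ≤ b) (h2 : b ≤ c) (h3 : c ≤ d) (ha : h (edgePt i a) ≤ l)
    (hb : l < h (edgePt i b)) (hc : h (edgePt i c) ≤ l) (hd : l < h (edgePt i d)) : False :=
  H.alternating (i := i) (l := l) h1 h2 h3 (by simp [above_of_lt hb, above_of_le ha])
    (by simp [above_of_lt hb, above_of_le hc]) (by simp [above_of_lt hd, above_of_le hc])

/-- Each of the two edges would cross the level on the way up and on the way back. -/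
theorem NoFourCrossing.not_both_above {h : Theta → ℝ} (H : NoFourCrossing h) {i j : Fin 3}
    (hij : i ≠ j) {l : ℝ} (hp : h (edgePt 0 0) ≤ l) (hq : h (edgePt 0 1) ≤ l) {s t : I}
    (hs : l < h (edgePt i s)) (ht : l < h (edgePt j t)) : False := by
  have := H.two_edges hij l (le_refl s) (le_refl s) (le_refl s) (le_refl t) (le_refl t) (le_refl t)
  unfold edgeVar at this
  rw [edgePt_zero i 0, edgePt_zero j 0, edgePt_one i 0, edgePt_one j 0, above_of_lt hs,
    above_of_lt ht, above_of_le hp, above_of_le hq] at this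
  norm_num at this

theorem NoFourCrossing.not_both_below {h : Theta → ℝ} (H : NoFourCrossing h) {i j : Fin 3}
    (hij : i ≠ j) {l : ℝ} (hp : l < h (edgePt 0 0)) (hq : l < h (edgePt 0 1)) {s t : I}
    (hs : h (edgePt i s) ≤ l) (ht : h (edgePt j t) ≤ l) : False := by
  have := H.two_edges hij l (le_refl s) (le_refl s) (le_refl s) (le_refl t) (le_refl t) (le_refl t)
  unfold edgeVar at this
  rw [edgePt_zero i 0, edgePt_zero j 0, edgePt_one i 0, edgePt_one j 0, above_of_le hs,
    above_of_le ht, above_of_lt hp, above_of_lt hq] at this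
  norm_num at this

/-- If a function on the unit interval does not alternate four times around a level and its first
value exceeds its last value, then it does not go down, up and down again. -/
theorem not_down_up_down {g : I → ℝ}
    (H1 : ∀ l : ℝ, ∀ a b c d : I, a ≤ b → b ≤ c → c ≤ d →
      l < g a → g b ≤ l → l < g c → g d ≤ l → False)
    (H2 : ∀ l : ℝ, ∀ a b c d : I, a ≤ b → b ≤ c → c ≤ d →
      g a ≤ l → l < g b → g c ≤ l → l < g d → False)
    (hpq : g 1 < g 0) {a b c d : I} (h1 : a < b) (h2 : b < c) (h3 : c < d) :
    ¬ (g b < g a ∧ g b < g c ∧ g d < g c) := by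
  rintro ⟨hba, hbc, hdc⟩
  have h0 : (0 : I) ≤ a := unitInterval.nonneg'
  have h0' : (0 : I) ≤ b := unitInterval.nonneg'
  have h4 : d ≤ (1 : I) := unitInterval.le_one'
  have h4' : c ≤ (1 : I) := unitInterval.le_one'
  -- Each case finds four points among `0, a, b, c, d, 1` and a level around which they alternate.
  rcases lt_or_ge (g d) (g a) with hda | hda
  · exact H1 (max (g b) (g d)) a b c d h1.le h2.le h3.le (max_lt hba hda) (le_max_left _ _)
      (max_lt hbc hdc) (le_max_right _ _)
  rcases le_or_gt (g 0) (g b) with hb0 | hb0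
  · exact H2 (g b) 0 a b c h0 h1.le h2.le hb0 hba le_rfl hbc
  rcases lt_or_ge (g 1) (g c) with hc1 | hc1
  · exact H1 (max (g b) (g 1)) 0 b c 1 h0' h2.le h4' (max_lt hb0 hpq) (le_max_left _ _)
      (max_lt hbc hc1) (le_max_right _ _)
  · exact H2 (g d) b c d 1 h2.le h3.le h4 (by linarith) hdc le_rfl (by linarith)

/-- A function which never goes down, up and down again is increasing up to its maximum,
decreasing between the maximum and the minimum, and increasing thereafter. -/
theorem monotone_pieces {ι : Type*} [LinearOrder ι] {g : ι → ℝ} {z o α β : ι}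
    (hz : ∀ t, z ≤ t) (ho : ∀ t, t ≤ o) (hzo : g o < g z) (hα : ∀ t, g t ≤ g α)
    (hβ : ∀ t, g β ≤ g t)
    (hpat : ∀ a b c d, a < b → b < c → c < d → ¬ (g b < g a ∧ g b < g c ∧ g d < g c)) :
    α < β ∧ MonotoneOn g (Set.Iic α) ∧ AntitoneOn g (Set.Icc α β) ∧ MonotoneOn g (Set.Ici β) := by
  -- If the minimum came before the maximum, then `z, β, α, o` would go down, up and down.
  have hαβ : α < β := by
    by_contra! hle
    have h1 : g β < g z := (hβ o).trans_lt hzo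
    have h2 : g o < g α := hzo.trans_le (hα z)
    have h3 : β ≠ α := fun h => by
      have h4 := hα z; have h5 := hβ o; rw [h] at h5; linarith
    exact hpat z β α o (lt_of_le_of_ne (hz β) fun h => by rw [← h] at h1; exact lt_irrefl _ h1)
      (lt_of_le_of_ne hle h3) (lt_of_le_of_ne (ho α) fun h => by
        rw [h] at h2; exact lt_irrefl _ h2) ⟨h1, (hβ o).trans_lt h2, h2⟩
  -- Any two points violating one of the three claims form, together with `α` and `β`, a forbidden
  -- pattern.
  refine ⟨hαβ, fun a ha b hb hab => ?_, fun a ha b hb hab => ?_, fun a ha b hb hab => ?_⟩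
  · by_contra! hlt
    have hb1 : g b < g α := hlt.trans_le (hα a)
    exact hpat a b α β (lt_of_le_of_ne hab fun h => by rw [h] at hlt; exact lt_irrefl _ hlt)
      (lt_of_le_of_ne hb fun h => by rw [h] at hb1; exact lt_irrefl _ hb1) hαβ
      ⟨hlt, hb1, (hβ b).trans_lt hb1⟩
  · by_contra! hlt
    have ha1 : g a < g α := hlt.trans_le (hα b)
    have hb1 : g β < g b := (hβ a).trans_lt hlt
    exact hpat α a b β (lt_of_le_of_ne ha.1 fun h => by rw [h] at ha1; exact lt_irrefl _ ha1)
      (lt_of_le_of_ne hab fun h => by rw [h] at hlt; exact lt_irrefl _ hlt)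
      (lt_of_le_of_ne hb.2 fun h => by rw [h] at hb1; exact lt_irrefl _ hb1)
      ⟨ha1, hlt, hb1⟩
  · by_contra! hlt
    have ha1 : g β < g a := (hβ b).trans_lt hlt
    exact hpat α β a b hαβ (lt_of_le_of_ne ha fun h => by rw [h] at ha1; exact lt_irrefl _ ha1)
      (lt_of_le_of_ne hab fun h => by rw [h] at hlt; exact lt_irrefl _ hlt)
      ⟨ha1.trans_le (hα a), ha1, hlt⟩

theorem NoFourCrossing.not_down_up_down {h : Theta → ℝ} (H : NoFourCrossing h)
    (hpq : h (edgePt 0 1) < h (edgePt 0 0)) (i : Fin 3) (a b c d : I) (h1 : a < b) (h2 : b < c)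
    (h3 : c < d) : ¬ (h (edgePt i b) < h (edgePt i a) ∧ h (edgePt i b) < h (edgePt i c) ∧
      h (edgePt i d) < h (edgePt i c)) :=
  ThetaNTC.not_down_up_down (g := fun t => h (edgePt i t))
    (fun _ _ _ _ _ k1 k2 k3 => H.high_low k1 k2 k3)
    (fun _ _ _ _ _ k1 k2 k3 => H.low_high k1 k2 k3)
    (by rwa [edgePt_one i 0, edgePt_zero i 0]) h1 h2 h3

/-- A monotone function with equal values at two points is constant between them, which `hc`
excludes. -/
theorem strictMonoOn_of_monotoneOn {g : I → ℝ} {s : Set I} (hs : s.OrdConnected)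
    (hg : MonotoneOn g s)
    (hc : ∀ a b : I, a < b → ∃ r s : I, a ≤ r ∧ r ≤ b ∧ a ≤ s ∧ s ≤ b ∧ g r ≠ g s) :
    StrictMonoOn g s := by
  intro a ha b hb hab
  refine lt_of_le_of_ne (hg ha hb hab.le) fun heq => ?_
  obtain ⟨r, t, h1, h2, h3, h4, hne⟩ := hc a b hab
  have hr := hs.out ha hb ⟨h1, h2⟩
  have ht := hs.out ha hb ⟨h3, h4⟩
  have := hg ha hr h1
  have := hg hr hb h2
  have := hg ha ht h3
  have := hg ht hb h4
  exact hne (by linarith)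

/-- The pieces of strict monotonicity of a function on the theta graph with few level crossings:
on each edge it goes up, down and up, and going up at the start (or the end) happens on at most
one edge. -/
theorem NoFourCrossing.exists_pieces {h : Theta → ℝ} (hcont : Continuous h) (H : NoFourCrossing h)
    (hpq : h (edgePt 0 1) < h (edgePt 0 0))
    (hc : ∀ i, ∀ a b : I, a < b → ∃ r s : I, a ≤ r ∧ r ≤ b ∧ a ≤ s ∧ s ≤ b ∧
      h (edgePt i r) ≠ h (edgePt i s)) :
    ∃ α β : Fin 3 → I, (∀ i, α i < β i) ∧
      (∀ i, StrictMonoOn (fun t => h (edgePt i t)) (Set.Iic (α i))) ∧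
      (∀ i, StrictAntiOn (fun t => h (edgePt i t)) (Set.Icc (α i) (β i))) ∧
      (∀ i, StrictMonoOn (fun t => h (edgePt i t)) (Set.Ici (β i))) ∧
      (∀ i j, i ≠ j → α i = 0 ∨ α j = 0) ∧ (∀ i j, i ≠ j → β i = 1 ∨ β j = 1) := by
  have hi : ∀ i, Continuous fun t => h (edgePt i t) := fun i => hcont.comp (continuous_edgePt i)
  have hmax : ∀ i, ∃ α : I, ∀ t, h (edgePt i t) ≤ h (edgePt i α) := fun i => by
    obtain ⟨x, -, hx⟩ := isCompact_univ.exists_isMaxOn Set.univ_nonempty (hi i).continuousOn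
    exact ⟨x, fun t => hx (Set.mem_univ t)⟩
  have hmin : ∀ i, ∃ β : I, ∀ t, h (edgePt i β) ≤ h (edgePt i t) := fun i => by
    obtain ⟨x, -, hx⟩ := isCompact_univ.exists_isMinOn Set.univ_nonempty (hi i).continuousOn
    exact ⟨x, fun t => hx (Set.mem_univ t)⟩
  choose α hα using hmax
  choose β hβ using hmin
  have hp := fun i => monotone_pieces (g := fun t => h (edgePt i t)) (z := 0) (o := 1)
    (fun _ => unitInterval.nonneg') (fun _ => unitInterval.le_one')
    (by rwa [edgePt_one i 0, edgePt_zero i 0]) (hα i) (hβ i) (H.not_down_up_down hpq i)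
  have hs1 := fun i => strictMonoOn_of_monotoneOn Set.ordConnected_Iic (hp i).2.1 (hc i)
  have hs3 := fun i => strictMonoOn_of_monotoneOn Set.ordConnected_Ici (hp i).2.2.2 (hc i)
  have hs2 : ∀ i, StrictAntiOn (fun t => h (edgePt i t)) (Set.Icc (α i) (β i)) := fun i => by
    have := strictMonoOn_of_monotoneOn (g := fun t => - h (edgePt i t)) Set.ordConnected_Icc
      (hp i).2.2.1.neg (fun a b hab => by
        obtain ⟨r, s, h1, h2, h3, h4, hne⟩ := hc i a b hab
        exact ⟨r, s, h1, h2, h3, h4, fun h => hne (neg_injective h)⟩)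
    intro a ha b hb hab
    exact neg_lt_neg_iff.1 (this ha hb hab)
  refine ⟨α, β, fun i => (hp i).1, hs1, hs2, hs3, fun i j hij => ?_, fun i j hij => ?_⟩
  -- Two edges rising at the start would both exceed the level of the upper vertex, giving four
  -- crossings there.
  · by_contra! hne
    have h1 := hs1 i (unitInterval.nonneg' : (0 : I) ≤ α i) (Set.self_mem_Iic)
      (unitInterval.pos_iff_ne_zero.2 hne.1)
    have h2 := hs1 j (unitInterval.nonneg' : (0 : I) ≤ α j) (Set.self_mem_Iic)
      (unitInterval.pos_iff_ne_zero.2 hne.2)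
    simp only at h1 h2
    rw [edgePt_zero i 0] at h1
    rw [edgePt_zero j 0] at h2
    exact H.not_both_above hij le_rfl hpq.le h1 h2
  · by_contra! hne
    have h1 := hs3 i (Set.self_mem_Ici) (unitInterval.le_one' : β i ≤ 1)
      (unitInterval.lt_one_iff_ne_one.2 hne.1)
    have h2 := hs3 j (Set.self_mem_Ici) (unitInterval.le_one' : β j ≤ 1)
      (unitInterval.lt_one_iff_ne_one.2 hne.2)
    simp only at h1 h2
    rw [edgePt_one i 0] at h1
    rw [edgePt_one j 0] at h2
    have h3 := max_lt h1 h2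
    exact H.not_both_below hij (h3.trans hpq) h3 (le_max_left _ _) (le_max_right _ _)

/-! ### Isotopies -/

/-- A homeomorphism which is the end of an isotopy that starts at the identity. -/
def IsotopicToId {X : Type*} [TopologicalSpace X] (Φ : X ≃ₜ X) : Prop :=
  ∃ H : I → (X ≃ₜ X), Continuous (fun x : I × X => H x.1 x.2) ∧ H 0 = Homeomorph.refl X ∧ H 1 = Φ

theorem IsotopicToId.trans {X : Type*} [TopologicalSpace X] {Φ Ψ : X ≃ₜ X} (h : IsotopicToId Φ)
    (h' : IsotopicToId Ψ) : IsotopicToId (Φ.trans Ψ) := by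
  obtain ⟨H, h1, h2, h3⟩ := h
  obtain ⟨K, k1, k2, k3⟩ := h'
  refine ⟨fun t => (H t).trans (K t), ?_, ?_, ?_⟩
  · exact k1.comp (continuous_fst.prodMk h1)
  · ext x; simp [h2, k2]
  · simp [h3, k3]

theorem IsotopicToId.conj {X Y : Type*} [TopologicalSpace X] [TopologicalSpace Y] {Φ : X ≃ₜ X}
    (h : IsotopicToId Φ) (g : X ≃ₜ Y) : IsotopicToId ((g.symm.trans Φ).trans g) := by
  obtain ⟨H, h1, h2, h3⟩ := h
  refine ⟨fun t => (g.symm.trans (H t)).trans g, ?_, ?_, ?_⟩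
  · exact g.continuous.comp (h1.comp (continuous_fst.prodMk (g.symm.continuous.comp continuous_snd)))
  · ext x; simp [h2]
  · simp [h3]

/-- A continuous bijection which is the identity far away is a homeomorphism. -/
theorem exists_homeomorph_of_bijective {X : Type*} [NormedAddCommGroup X] [ProperSpace X]
    {F : X → X} (hF : Continuous F) (hb : Function.Bijective F) {R : ℝ}
    (hR : ∀ x, R ≤ ‖x‖ → F x = x) : ∃ Φ : X ≃ₜ X, ⇑Φ = F := by
  -- Being the identity near infinity makes the map proper, hence closed.
  have hp : IsProperMap F := by
    rw [isProperMap_iff_tendsto_cocompact]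
    refine ⟨hF, tendsto_id.congr' ?_⟩
    filter_upwards [tendsto_norm_cocompact_atTop.eventually_ge_atTop R] with x hx
    exact (hR x hx).symm
  exact ⟨(isHomeomorph_iff_continuous_isClosedMap_bijective.2
    ⟨hF, hp.isClosedMap, hb⟩).homeomorph F, rfl⟩

/-- A homeomorphism with bounded support is isotopic to the identity (Alexander's trick). -/
theorem isotopicToId_of_bounded_support {X : Type*} [NormedAddCommGroup X] [NormedSpace ℝ X]
    [ProperSpace X] (Φ : X ≃ₜ X) {R : ℝ} (hR : ∀ x, R ≤ ‖x‖ → Φ x = x) : IsotopicToId Φ := by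
  obtain ⟨C, hC⟩ : ∃ C, ∀ x, ‖Φ x - x‖ ≤ C := by
    obtain ⟨C, hC⟩ := (isCompact_closedBall (0 : X) R).exists_bound_of_continuousOn
      (f := fun x => Φ x - x) (by fun_prop)
    refine ⟨max C 0, fun x => ?_⟩
    rcases le_total R ‖x‖ with h | h
    · simp [hR x h]
    · exact (hC x (by simpa using h)).trans (le_max_left _ _)
  -- The isotopy is `x ↦ t • Φ (t⁻¹ • x)`, and the identity at `t = 0`. Its displacement is at most
  -- `C * t`, which yields continuity at `t = 0`.
  refine ⟨fun t => if h : (t : ℝ) = 0 then Homeomorph.refl X else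
    ((Homeomorph.smulOfNeZero (t : ℝ) h).symm.trans Φ).trans (Homeomorph.smulOfNeZero (t : ℝ) h),
    ?_, ?_, ?_⟩
  · rw [continuous_iff_continuousAt]
    rintro ⟨t, x⟩
    by_cases ht : (t : ℝ) = 0
    · rw [ContinuousAt, tendsto_iff_norm_sub_tendsto_zero]
      have hlim : Tendsto (fun p : I × X => C * |(p.1 : ℝ)| + ‖p.2 - x‖) (𝓝 (t, x)) (𝓝 0) := by
        have : Continuous fun p : I × X => C * |(p.1 : ℝ)| + ‖p.2 - x‖ := by fun_prop
        simpa [ht] using this.tendsto (t, x)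
      refine squeeze_zero (fun _ => norm_nonneg _) (fun p => ?_) hlim
      simp only [ht, dif_pos, Homeomorph.refl_apply, id]
      split_ifs with hp
      · simp [hp]
      · have h1 : ((p.1 : ℝ) • Φ ((p.1 : ℝ)⁻¹ • p.2)) - x =
            (p.1 : ℝ) • (Φ ((p.1 : ℝ)⁻¹ • p.2) - (p.1 : ℝ)⁻¹ • p.2) + (p.2 - x) := by
          rw [smul_sub, smul_inv_smul₀ hp]; abel
        change ‖((p.1 : ℝ) • Φ ((p.1 : ℝ)⁻¹ • p.2)) - x‖ ≤ _
        rw [h1]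
        refine (norm_add_le _ _).trans ?_
        rw [norm_smul, Real.norm_eq_abs, mul_comm C]
        gcongr
        exact hC _
    · have hev : ∀ᶠ p : I × X in 𝓝 (t, x), (p.1 : ℝ) ≠ 0 :=
        (continuous_subtype_val.comp continuous_fst).continuousAt.eventually_ne ht
      have h2 : ContinuousAt (fun p : I × X => (p.1 : ℝ) • Φ ((p.1 : ℝ)⁻¹ • p.2)) (t, x) := by
        have hinv : ContinuousAt (fun p : I × X => (p.1 : ℝ)⁻¹) (t, x) :=
          (continuous_subtype_val.comp continuous_fst).continuousAt.inv₀ ht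
        exact (continuous_subtype_val.comp continuous_fst).continuousAt.smul
          (Φ.continuous.continuousAt.comp (hinv.smul continuous_snd.continuousAt))
      refine h2.congr ?_
      filter_upwards [hev] with p hp
      simp only [hp, dif_neg, not_false_eq_true]
      rfl
  · simp
  · ext x
    simp only [Set.Icc.coe_one, one_ne_zero, dif_neg, not_false_eq_true]
    change (1 : ℝ) • Φ ((1 : ℝ)⁻¹ • x) = Φ x
    simp

theorem isotopicToId_addRight {X : Type*} [NormedAddCommGroup X] [NormedSpace ℝ X] (v : X) :
    IsotopicToId (Homeomorph.addRight v) := by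
  refine ⟨fun t => Homeomorph.addRight ((t : ℝ) • v), ?_, ?_, ?_⟩
  · simp only [Homeomorph.coe_addRight]; fun_prop
  · ext; simp
  · simp

/-! ### Linear images of the standard theta graph -/

/-- Multiplication of the coordinates by nonzero numbers. -/
def scaleHomeo (s : Fin 3 → ℝ) (hs : ∀ i, s i ≠ 0) : (Fin 3 → ℝ) ≃ₜ (Fin 3 → ℝ) :=
  Homeomorph.piCongrRight fun i => Homeomorph.mulLeft₀ (s i) (hs i)

@[simp] theorem scaleHomeo_apply (s : Fin 3 → ℝ) (hs : ∀ i, s i ≠ 0) (x : Fin 3 → ℝ) :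
    scaleHomeo s hs x = fun i => s i * x i := rfl

theorem isotopicToId_scaleHomeo (s : Fin 3 → ℝ) (hs : ∀ i, 0 < s i) :
    IsotopicToId (scaleHomeo s fun i => (hs i).ne') := by
  have hpos : ∀ (t : I) (i : Fin 3), 0 < 1 - (t : ℝ) + t * s i := by
    intro t i
    have h0 := t.2.1
    have h1 := t.2.2
    have := hs i
    rcases eq_or_lt_of_le h1 with h | h
    · rw [h]; linarith
    · have := mul_nonneg h0 this.le; linarith
  refine ⟨fun t => scaleHomeo (fun i => 1 - (t : ℝ) + t * s i) fun i => (hpos t i).ne', ?_, ?_, ?_⟩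
  · simp only [scaleHomeo_apply]; fun_prop
  · ext; simp
  · ext; simp

/-- A shear of the coordinate `i` in the direction of the coordinate `j`. -/
def shearHomeo (i j : Fin 3) (hij : i ≠ j) (c : ℝ) : (Fin 3 → ℝ) ≃ₜ (Fin 3 → ℝ) where
  toFun x := x + Pi.single i (c * x j)
  invFun x := x + Pi.single i (-c * x j)
  left_inv x := by ext k; simp [Pi.single_apply, hij.symm, add_assoc]; split_ifs <;> simp
  right_inv x := by ext k; simp [Pi.single_apply, hij.symm, add_assoc]; split_ifs <;> simp
  continuous_toFun := by
    refine continuous_id.add (continuous_pi fun k => ?_)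
    simp only [Pi.single_apply]; split_ifs <;> fun_prop
  continuous_invFun := by
    refine continuous_id.add (continuous_pi fun k => ?_)
    simp only [Pi.single_apply]; split_ifs <;> fun_prop

theorem isotopicToId_shearHomeo (i j : Fin 3) (hij : i ≠ j) (c : ℝ) :
    IsotopicToId (shearHomeo i j hij c) := by
  refine ⟨fun t => shearHomeo i j hij (t * c), ?_, ?_, ?_⟩
  · change Continuous fun x : I × (Fin 3 → ℝ) => x.2 + Pi.single i ((x.1 * c) * x.2 j)
    refine continuous_snd.add (continuous_pi fun k => ?_)
    simp only [Pi.single_apply]; split_ifs <;> fun_prop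
  · ext x k; simp [shearHomeo]
  · simp

/-- Transvections and positive diagonal matrices are isotopic to the identity. The signs of the
coordinates cannot be removed when the determinant is negative; they are collected on the right and
later absorbed by the symmetry of the standard theta graph. -/
theorem exists_isotopicToId_of_det_ne_zero (M : Matrix (Fin 3) (Fin 3) ℝ) (hM : M.det ≠ 0) :
    ∃ s : Fin 3 → ℝ, (∀ i, s i = 1 ∨ s i = -1) ∧ ∃ Φ : (Fin 3 → ℝ) ≃ₜ (Fin 3 → ℝ),
      IsotopicToId Φ ∧ ∀ x, M.mulVec x = Φ fun i => s i * x i := by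
  refine Matrix.diagonal_transvection_induction_of_det_ne_zero (fun M => ∃ s : Fin 3 → ℝ,
    (∀ i, s i = 1 ∨ s i = -1) ∧ ∃ Φ : (Fin 3 → ℝ) ≃ₜ (Fin 3 → ℝ),
      IsotopicToId Φ ∧ ∀ x, M.mulVec x = Φ fun i => s i * x i) M hM ?_ ?_ ?_
  · intro D hD
    rw [Matrix.det_diagonal, Finset.prod_ne_zero_iff] at hD
    have hD' : ∀ i, D i ≠ 0 := fun i => hD i (Finset.mem_univ i)
    refine ⟨fun i => SignType.sign (D i), fun i => ?_, _,
      isotopicToId_scaleHomeo (fun i => |D i|) fun i => abs_pos.2 (hD' i), fun x => ?_⟩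
    · rcases lt_or_gt_of_ne (hD' i) with h | h
      · simp [sign_neg h]
      · simp [sign_pos h]
    · ext i
      rw [scaleHomeo_apply, Matrix.mulVec_diagonal]
      simp only
      rw [← mul_assoc, abs_mul_sign]
  · intro t
    refine ⟨fun _ => 1, fun _ => Or.inl rfl, _, isotopicToId_shearHomeo t.i t.j t.hij t.c,
      fun x => ?_⟩
    ext k
    simp [Matrix.TransvectionStruct.toMatrix, Matrix.transvection, Matrix.add_mulVec, shearHomeo,
      Matrix.single_mulVec, Pi.single_apply, Function.update_apply]
  · rintro A B - - ⟨s, hs, Φ, hΦ, hA⟩ ⟨s', hs', Φ', hΦ', hB⟩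
    have hs0 : ∀ i, s i ≠ 0 := fun i => by rcases hs i with h | h <;> rw [h] <;> norm_num
    have hss : ∀ i, s i * s i = 1 := fun i => by rcases hs i with h | h <;> rw [h] <;> norm_num
    -- With sign changes `S` and `S'`, the product `Φ S Φ' S'` equals `Φ (S Φ' S⁻¹) (S S')`.
    refine ⟨fun i => s i * s' i, fun i => ?_, _, (hΦ'.conj (scaleHomeo s hs0)).trans hΦ,
      fun x => ?_⟩
    · rcases hs i with h | h <;> rcases hs' i with h' | h' <;> simp [h, h']
    · rw [← Matrix.mulVec_mulVec, hA, hB]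
      simp only [Homeomorph.trans_apply]
      congr 1
      have : (scaleHomeo s hs0).symm (fun i => s i * s' i * x i) = fun i => s' i * x i := by
        rw [Homeomorph.symm_apply_eq]
        ext i; simp [mul_assoc]
      rw [this]; rfl

theorem mem_standardTheta {x : E3} : x ∈ standardTheta ↔
    (x 0 ^ 2 + x 1 ^ 2 = 1 ∧ x 2 = 0) ∨ (|x 0| ≤ 1 ∧ x 1 = 0 ∧ x 2 = 0) := by
  unfold standardTheta
  refine or_congr Iff.rfl ?_
  rw [segment_eq_image']
  constructor
  · rintro ⟨t, ⟨h0, h1⟩, rfl⟩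
    simp only [PiLp.add_apply, PiLp.smul_apply, PiLp.sub_apply]
    simp
    rw [abs_le]; constructor <;> linarith
  · rintro ⟨h0, h1, h2⟩
    rw [abs_le] at h0
    refine ⟨(x 0 + 1) / 2, ⟨by linarith, by linarith⟩, ?_⟩
    ext i
    fin_cases i
    · simp; ring
    · simp [h1]
    · simp [h2]

/-- A linear image of the standard theta graph is isotopic to it. -/
theorem exists_isotopicToId_image_standardTheta (A : E3 ≃L[ℝ] E3) :
    ∃ Φ : E3 ≃ₜ E3, IsotopicToId Φ ∧ Φ '' (A '' standardTheta) = standardTheta := by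
  set w := (EuclideanSpace.equiv (Fin 3) ℝ) with hw
  set B : (Fin 3 → ℝ) ≃L[ℝ] (Fin 3 → ℝ) := (w.symm.trans A.symm).trans w with hB
  set M := LinearMap.toMatrix' (B : (Fin 3 → ℝ) →ₗ[ℝ] (Fin 3 → ℝ)) with hM
  have hdet : M.det ≠ 0 := by
    rw [hM, LinearMap.det_toMatrix']
    exact (LinearEquiv.isUnit_det' B.toLinearEquiv).ne_zero
  obtain ⟨s, hs, Φ, hΦ, hM'⟩ := exists_isotopicToId_of_det_ne_zero M hdet
  have hMB : ∀ x, M.mulVec x = B x := fun x => by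
    rw [← Matrix.toLin'_apply, hM, Matrix.toLin'_toMatrix']; rfl
  have hs0 : ∀ i, s i ≠ 0 := fun i => by rcases hs i with h | h <;> rw [h] <;> norm_num
  have hss : ∀ i, s i * s i = 1 := fun i => by rcases hs i with h | h <;> rw [h] <;> norm_num
  -- The matrix `M` represents the inverse of `A` and equals `Φ S` with `S = S⁻¹`. Hence `S Φ S⁻¹`
  -- composed with `A` is `S`, which preserves the standard theta graph.
  refine ⟨_, (hΦ.conj (scaleHomeo s hs0)).conj w.symm.toHomeomorph, ?_⟩
  have key : ∀ x : E3, ((w.symm.toHomeomorph.symm.trans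
      (((scaleHomeo s hs0).symm.trans Φ).trans (scaleHomeo s hs0))).trans
      w.symm.toHomeomorph) (A x) = w.symm fun i => s i * (w x) i := by
    intro x
    change w.symm (scaleHomeo s hs0 (Φ ((scaleHomeo s hs0).symm (w (A x))))) = _
    have h1 : (scaleHomeo s hs0).symm (w (A x)) = fun i => s i * w (A x) i := by
      rw [Homeomorph.symm_apply_eq]; ext i; simp [← mul_assoc, hss]
    rw [h1, ← hM', hMB]
    simp [hB]
  rw [Set.image_image]
  simp only [key]
  have hinv : ∀ x : E3, x ∈ standardTheta → (w.symm fun i => s i * (w x) i) ∈ standardTheta := by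
    intro x hx
    have hss' : ∀ i, s i ^ 2 = 1 := fun i => by rw [sq, hss]
    have habs : ∀ i, |s i| = 1 := fun i => by rcases hs i with h | h <;> rw [h] <;> norm_num
    rw [mem_standardTheta] at hx ⊢
    change ((s 0 * x 0) ^ 2 + (s 1 * x 1) ^ 2 = 1 ∧ s 2 * x 2 = 0) ∨
      (|s 0 * x 0| ≤ 1 ∧ s 1 * x 1 = 0 ∧ s 2 * x 2 = 0)
    simpa [mul_pow, hss', abs_mul, habs, hs0] using hx
  apply Set.Subset.antisymm
  · rintro _ ⟨x, hx, rfl⟩; exact hinv x hx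
  · intro x hx
    refine ⟨_, hinv x hx, ?_⟩
    simp [← mul_assoc, hss]

/-! ### Straightening of strands in a disc -/

/-- A perturbation of the identity by a contraction: a preimage of `y` is a fixed point of `x ↦ y -
g x`. -/
theorem bijective_add_of_lipschitz {E : Type*} [NormedAddCommGroup E] [CompleteSpace E]
    {g : E → E} {K : NNReal} (hK : K < 1) (hg : LipschitzWith K g) :
    Function.Bijective fun x => x + g x := by
  constructor
  · intro x y hxy
    have h1 : x - y = g y - g x := by
      simp only at hxy
      rw [sub_eq_sub_iff_add_eq_add, hxy, add_comm]
    have h2 : dist x y ≤ K * dist x y := by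
      calc dist x y = dist (g y) (g x) := by rw [dist_eq_norm, dist_eq_norm, h1]
        _ ≤ K * dist x y := by rw [dist_comm x y]; exact hg.dist_le_mul y x
    have hK' : (K : ℝ) < 1 := hK
    exact dist_le_zero.1 (by nlinarith [dist_nonneg (x := x) (y := y)])
  · intro y
    have hc : ContractingWith K fun x => y - g x := by
      refine ⟨hK, LipschitzWith.of_dist_le_mul fun a b => ?_⟩
      rw [dist_sub_left]
      exact hg.dist_le_mul a b
    refine ⟨hc.fixedPoint _, ?_⟩
    have := hc.fixedPoint_isFixedPt
    unfold Function.IsFixedPt at this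
    simp only
    nth_rewrite 1 [← this]
    simp

/-- A family of bijections of the plane, supported in the unit disc, that is the identity up to the
time `a` and takes the strands `c i` back to their positions at the time `a` up to the time `b`. -/
def Straightens {n : ℕ} (c : Fin n → ℝ → ℂ) (a b : ℝ) (φ : ℝ → ℂ → ℂ) : Prop :=
  Continuous (fun x : ℝ × ℂ => φ x.1 x.2) ∧ (∀ t, Function.Bijective (φ t)) ∧
    (∀ t w, 1 ≤ ‖w‖ → φ t w = w) ∧ (∀ t ≤ a, φ t = id) ∧
    ∀ t, a ≤ t → t ≤ b → ∀ i, φ t (c i t) = c i a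

/-- At a time after `b`, first `ψ` brings the strands back to their positions at `b`, and then `φ`,
frozen at the time `b`, brings them back to those at `a`. -/
theorem Straightens.comp {n : ℕ} {c : Fin n → ℝ → ℂ} {a b d : ℝ} {φ ψ : ℝ → ℂ → ℂ}
    (hab : a ≤ b) (hφ : Straightens c a b φ) (hψ : Straightens c b d ψ) :
    Straightens c a d fun t w => φ (min t b) (ψ t w) := by
  obtain ⟨h1, h2, h3, h4, h5⟩ := hφ
  obtain ⟨k1, k2, k3, k4, k5⟩ := hψ
  refine ⟨?_, fun t => (h2 _).comp (k2 t), fun t w hw => ?_, fun t ht => ?_, fun t ht ht' i => ?_⟩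
  · exact h1.comp ((by fun_prop : Continuous fun x : ℝ × ℂ => min x.1 b).prodMk k1)
  · simp only; rw [k3 t w hw, h3 _ w hw]
  · ext w
    simp only
    rw [k4 t (ht.trans hab), h4 _ ((min_le_left _ _).trans ht)]; rfl
  · simp only
    rcases le_total t b with h | h
    · rw [k4 t h, min_eq_left h]; exact h5 t ht h i
    · rw [k5 t h ht', min_eq_right h]; exact h5 b hab le_rfl i

/-- A push of finitely many points. -/
def push {n : ℕ} (ρ : ℝ) (p v : Fin n → ℂ) (w : ℂ) : ℂ :=
  ∑ i, ((max 0 (1 - ‖w - p i‖ / ρ) : ℝ) : ℂ) * v i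

/-- Each of the `n` tents has slope `1 / ρ` and moves points by at most `ρ / (2 * (n + 1))`, so
their sum has Lipschitz constant below `1 / 2`. -/
theorem lipschitz_push {n : ℕ} {ρ : ℝ} (hρ : 0 < ρ) (p v : Fin n → ℂ)
    (hv : ∀ i, ‖v i‖ ≤ ρ / (2 * (n + 1))) : LipschitzWith (1 / 2) (push ρ p v) := by
  refine LipschitzWith.of_dist_le_mul fun x y => ?_
  have hb : ∀ i, |max 0 (1 - ‖x - p i‖ / ρ) - max 0 (1 - ‖y - p i‖ / ρ)| ≤ ‖x - y‖ / ρ := by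
    intro i
    rw [max_comm 0, max_comm 0]
    refine (abs_max_sub_max_le_abs (1 - ‖x - p i‖ / ρ) (1 - ‖y - p i‖ / ρ) 0).trans ?_
    rw [show (1 - ‖x - p i‖ / ρ) - (1 - ‖y - p i‖ / ρ) = (‖y - p i‖ - ‖x - p i‖) / ρ by ring,
      abs_div, abs_of_pos hρ]
    gcongr
    refine (abs_norm_sub_norm_le _ _).trans ?_
    rw [sub_sub_sub_cancel_right, norm_sub_rev]
  rw [dist_eq_norm, dist_eq_norm]
  unfold push
  rw [← Finset.sum_sub_distrib]
  calc _ ≤ ∑ i : Fin n, ‖x - y‖ / ρ * (ρ / (2 * (n + 1))) := by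
        refine (norm_sum_le _ _).trans (Finset.sum_le_sum fun i _ => ?_)
        rw [← sub_mul, norm_mul, ← Complex.ofReal_sub, Complex.norm_real, Real.norm_eq_abs]
        exact mul_le_mul (hb i) (hv i) (norm_nonneg _) (by positivity)
    _ = (n / (n + 1) : ℝ) * (1 / 2 * ‖x - y‖) := by
        rw [Finset.sum_const, Finset.card_univ, Fintype.card_fin, nsmul_eq_mul]
        field_simp
    _ ≤ 1 * (1 / 2 * ‖x - y‖) := by
        gcongr
        rw [div_le_one (by positivity)]; linarith
    _ = _ := by simp

/-- Over a short time the strands move little compared with `ρ`, which bounds from below their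
mutual distances and their distances to the unit circle. A tent of radius `ρ` at each strand pushes
it back, without affecting the other strands or the exterior of the disc. -/
theorem exists_straightens_short {n : ℕ} {c : Fin n → ℝ → ℂ} (hc : ∀ i, Continuous (c i))
    {s u ρ : ℝ} (hsu : s ≤ u) (hρ : 0 < ρ) (h1 : ∀ i, ∀ t ∈ Set.Icc s u, ‖c i t‖ ≤ 1 - ρ)
    (h2 : ∀ i j, i ≠ j → ∀ t ∈ Set.Icc s u, ρ ≤ ‖c i t - c j t‖)
    (h3 : ∀ i, ∀ t ∈ Set.Icc s u, ‖c i s - c i t‖ ≤ ρ / (2 * (n + 1))) :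
    ∃ φ, Straightens c s u φ := by
  have hcl : ∀ t, max s (min t u) ∈ Set.Icc s u := fun t =>
    ⟨le_max_left _ _, max_le hsu (min_le_right _ _)⟩
  -- Clamping the time to `[s, u]` makes the push vanish before `s` and stay fixed after `u`.
  refine ⟨fun t w => w + push ρ (fun i => c i (max s (min t u)))
    (fun i => c i s - c i (max s (min t u))) w, ?_, fun t => ?_, fun t w hw => ?_,
    fun t ht => ?_, fun t ht ht' i => ?_⟩
  · unfold push; fun_prop
  · exact bijective_add_of_lipschitz (K := 1 / 2)
      (by rw [← NNReal.coe_lt_coe]; norm_num) (lipschitz_push hρ _ _ fun i => h3 i _ (hcl t))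
  · simp only [add_eq_left, push]
    refine Finset.sum_eq_zero fun i _ => ?_
    rw [max_eq_left, Complex.ofReal_zero, zero_mul]
    rw [sub_nonpos, one_le_div hρ]
    have := norm_sub_norm_le w (c i (max s (min t u)))
    have := h1 i _ (hcl t)
    linarith
  · ext w
    simp only [push, max_eq_left ((min_le_left t u).trans ht), sub_self, mul_zero,
      Finset.sum_const_zero, add_zero, id]
  · simp only [min_eq_left ht', max_eq_right ht, push]
    rw [Finset.sum_eq_single i]
    · simp
    · intro j _ hj
      rw [max_eq_left, Complex.ofReal_zero, zero_mul]
      rw [sub_nonpos, one_le_div hρ]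
      exact h2 i j hj.symm t ⟨ht, ht'⟩
    · simp

/-- Compactness gives a common `ρ`, uniform continuity a step length `δ`, and `Straightens.comp`
joins the short intervals. -/
theorem exists_straightens_interval {n : ℕ} {c : Fin n → ℝ → ℂ} (hc : ∀ i, Continuous (c i))
    (h1 : ∀ i t, ‖c i t‖ < 1) (h2 : ∀ t, Function.Injective fun i => c i t) {a b : ℝ}
    (hab : a ≤ b) : ∃ φ, Straightens c a b φ := by
  obtain ⟨ρ, hρ, hρ1, hρ2⟩ : ∃ ρ : ℝ, 0 < ρ ∧ (∀ i, ∀ t ∈ Set.Icc a b, ‖c i t‖ ≤ 1 - ρ) ∧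
      ∀ i j, i ≠ j → ∀ t ∈ Set.Icc a b, ρ ≤ ‖c i t - c j t‖ := by
    have hp : ∀ f : ℝ → ℝ, Continuous f → (∀ t, 0 < f t) → ∃ ρ : ℝ, 0 < ρ ∧
        ∀ t ∈ Set.Icc a b, ρ ≤ f t := by
      intro f hf hpos
      obtain ⟨x, -, hx⟩ := isCompact_Icc.exists_isMinOn (Set.nonempty_Icc.2 hab) hf.continuousOn
      exact ⟨f x, hpos x, fun t ht => hx ht⟩
    have e1 : ∀ i, ∀ᶠ ρ in 𝓝[>] (0 : ℝ), ∀ t ∈ Set.Icc a b, ‖c i t‖ ≤ 1 - ρ := by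
      intro i
      obtain ⟨ρ, hρ, h⟩ := hp (fun t => 1 - ‖c i t‖) (by fun_prop) (fun t => by linarith [h1 i t])
      filter_upwards [mem_nhdsWithin_of_mem_nhds (gt_mem_nhds hρ)] with r hr t ht
      have : r < ρ := hr
      linarith [h t ht]
    have e2 : ∀ i j, i ≠ j → ∀ᶠ ρ in 𝓝[>] (0 : ℝ), ∀ t ∈ Set.Icc a b, ρ ≤ ‖c i t - c j t‖ := by
      intro i j hij
      obtain ⟨ρ, hρ, h⟩ := hp (fun t => ‖c i t - c j t‖) (by fun_prop)
        (fun t => norm_pos_iff.2 (sub_ne_zero.2 fun h => hij (h2 t h)))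
      filter_upwards [mem_nhdsWithin_of_mem_nhds (gt_mem_nhds hρ)] with r hr t ht
      have : r < ρ := hr
      linarith [h t ht]
    have e2' : ∀ᶠ ρ in 𝓝[>] (0 : ℝ), ∀ i j, i ≠ j → ∀ t ∈ Set.Icc a b, ρ ≤ ‖c i t - c j t‖ := by
      simp only [eventually_all]
      exact e2
    obtain ⟨ρ, h, h', hρ⟩ := ((eventually_all.2 e1).and (e2'.and self_mem_nhdsWithin)).exists
    exact ⟨ρ, hρ, h, h'⟩
  obtain ⟨δ, hδ, hδc⟩ : ∃ δ > 0, ∀ i, ∀ x ∈ Set.Icc a b, ∀ y ∈ Set.Icc a b, dist x y ≤ δ →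
      ‖c i x - c i y‖ ≤ ρ / (2 * (n + 1)) := by
    have hu : UniformContinuousOn (fun t i => c i t) (Set.Icc a b) :=
      isCompact_Icc.uniformContinuousOn_of_continuous (by fun_prop)
    rw [Metric.uniformContinuousOn_iff_le] at hu
    obtain ⟨δ, hδ, h⟩ := hu (ρ / (2 * (n + 1))) (by positivity)
    refine ⟨δ, hδ, fun i x hx y hy hxy => ?_⟩
    rw [← dist_eq_norm]
    exact (dist_le_pi_dist (fun i => c i x) (fun i => c i y) i).trans (h x hx y hy hxy)
  have key : ∀ k : ℕ, ∃ φ, Straightens c a (min b (a + k * δ)) φ := by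
    intro k
    induction k with
    | zero =>
      refine ⟨fun _ => id, continuous_snd, fun _ => Function.bijective_id, fun _ _ _ => rfl,
        fun _ _ => rfl, fun t ht ht' i => ?_⟩
      have : t = a := le_antisymm (ht'.trans (by simp)) ht
      rw [this]; rfl
    | succ k ih =>
      obtain ⟨φ, hφ⟩ := ih
      have ha : a ≤ min b (a + k * δ) := le_min hab (by nlinarith [Nat.cast_nonneg (α := ℝ) k])
      have hle : min b (a + k * δ) ≤ min b (a + (k + 1 : ℕ) * δ) := by
        refine min_le_min le_rfl ?_
        push_cast; nlinarith
      have hsub : ∀ t ∈ Set.Icc (min b (a + k * δ)) (min b (a + (k + 1 : ℕ) * δ)),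
          t ∈ Set.Icc a b := fun t ht => ⟨ha.trans ht.1, ht.2.trans (min_le_left _ _)⟩
      obtain ⟨ψ, hψ⟩ := exists_straightens_short hc hle hρ (fun i t ht => hρ1 i t (hsub t ht))
        (fun i j hij t ht => hρ2 i j hij t (hsub t ht)) (fun i t ht => by
          refine hδc i _ ⟨ha, min_le_left _ _⟩ t (hsub t ht) ?_
          rw [dist_comm, Real.dist_eq, abs_of_nonneg (by linarith [ht.1])]
          have h2 := ht.2
          have h1 := ht.1
          rcases le_total b (a + k * δ) with h | h
          · rw [min_eq_left h] at h1 ⊢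
            have := h2.trans (min_le_left _ _)
            linarith
          · rw [min_eq_right h] at h1 ⊢
            have := h2.trans (min_le_right _ _)
            push_cast at this
            linarith)
      exact ⟨_, hφ.comp ha hψ⟩
  obtain ⟨k, hk⟩ := exists_nat_ge ((b - a) / δ)
  rw [div_le_iff₀ hδ] at hk
  have := key k
  rwa [min_eq_left (by linarith)] at this

/-- Moving strands in the open unit disc can be brought to rest by bijections of the plane which
are supported in the disc and depend continuously on the time. -/
theorem exists_straightens {n : ℕ} {c : Fin n → ℝ → ℂ} (hc : ∀ i, Continuous (c i))
    (h1 : ∀ i t, ‖c i t‖ < 1) (h2 : ∀ t, Function.Injective fun i => c i t) :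
    ∃ φ : ℝ → ℂ → ℂ, ∀ b, Straightens c 0 b φ := by
  have hs : ∀ k : ℕ, ∃ φ, Straightens c k (k + 1 : ℕ) φ := fun k =>
    exists_straightens_interval hc h1 h2 (by push_cast; linarith)
  choose ψ hψ using hs
  -- `Φ k` treats the times up to `k`. Later stages do not alter earlier times, so `Φ ⌈t⌉₊ t` agrees
  -- locally with one stage and is continuous.
  let Φ : ℕ → ℝ → ℂ → ℂ := fun k => Nat.rec (fun _ => id)
    (fun k Φk t w => Φk (min t k) (ψ k t w)) k
  have hΦ : ∀ k : ℕ, Straightens c 0 k (Φ k) := by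
    intro k
    induction k with
    | zero =>
      refine ⟨continuous_snd, fun _ => Function.bijective_id, fun _ _ _ => rfl,
        fun _ _ => rfl, fun t ht ht' i => ?_⟩
      have : t = 0 := le_antisymm (by simpa using ht') ht
      rw [this]; rfl
    | succ k ih => exact ih.comp (Nat.cast_nonneg k) (hψ k)
  have hstep : ∀ (k : ℕ) (t : ℝ), t ≤ k → Φ (k + 1) t = Φ k t := by
    intro k t ht
    ext w
    change Φ k (min t k) (ψ k t w) = _
    rw [min_eq_left ht, (hψ k).2.2.2.1 t ht]; rfl
  have hmono : ∀ (k m : ℕ) (t : ℝ), t ≤ k → k ≤ m → Φ m t = Φ k t := by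
    intro k m t ht hkm
    induction m, hkm using Nat.le_induction with
    | base => rfl
    | succ m hm ih => rw [hstep m t (ht.trans (by exact_mod_cast hm)), ih]
  have heq : ∀ (k : ℕ) (t : ℝ), t ≤ k → Φ ⌈t⌉₊ t = Φ k t := fun k t ht =>
    (hmono _ _ t (Nat.le_ceil t) (Nat.ceil_le.2 ht)).symm
  refine ⟨fun t => Φ ⌈t⌉₊ t, fun b => ⟨?_, fun t => (hΦ _).2.1 t, fun t => (hΦ _).2.2.1 t,
    fun t => (hΦ _).2.2.2.1 t, fun t ht _ => (hΦ _).2.2.2.2 t ht (Nat.le_ceil t)⟩⟩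
  rw [continuous_iff_continuousAt]
  rintro ⟨t, w⟩
  obtain ⟨k, hk⟩ := exists_nat_gt t
  refine ((hΦ k).1.continuousAt (x := (t, w))).congr ?_
  have : ∀ᶠ x : ℝ × ℂ in 𝓝 (t, w), x.1 < k := continuous_fst.continuousAt.eventually_lt_const hk
  filter_upwards [this] with x hx
  rw [heq k x.1 hx.le]

/-- A map that preserves the levels of `ℂ × ℝ` and is the identity outside the tube around the
curve `o` with radius `r` over the interval between `a` and `b`. -/
def IsTubeMap (o : ℝ → ℂ) (r : ℝ → ℝ) (a b : ℝ) (Φ : ℂ × ℝ ≃ₜ ℂ × ℝ) : Prop :=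
  (∀ x, (Φ x).2 = x.2) ∧
    ∀ x, ¬ (x.2 ∈ Set.Ioo a b ∧ ‖x.1 - o x.2‖ < r x.2) → Φ x = x

theorem IsTubeMap.symm {o : ℝ → ℂ} {r : ℝ → ℝ} {a b : ℝ} {Φ : ℂ × ℝ ≃ₜ ℂ × ℝ}
    (h : IsTubeMap o r a b Φ) : IsTubeMap o r a b Φ.symm := by
  refine ⟨fun x => ?_, fun x hx => ?_⟩
  · rw [← h.1, Φ.apply_symm_apply]
  · rw [Φ.symm_apply_eq, h.2 x hx]

theorem IsTubeMap.trans {o : ℝ → ℂ} {r : ℝ → ℝ} {a b : ℝ} {Φ Ψ : ℂ × ℝ ≃ₜ ℂ × ℝ}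
    (h : IsTubeMap o r a b Φ) (h' : IsTubeMap o r a b Ψ) : IsTubeMap o r a b (Φ.trans Ψ) := by
  refine ⟨fun x => ?_, fun x hx => ?_⟩
  · simp [h.1, h'.1]
  · simp [h.2 x hx, h'.2 x hx]

theorem exists_bound_of_eq_off_tube {o : ℝ → ℂ} {r : ℝ → ℝ} {a b : ℝ} {F : ℂ × ℝ → ℂ × ℝ}
    (h : ∀ x, ¬ (x.2 ∈ Set.Ioo a b ∧ ‖x.1 - o x.2‖ < r x.2) → F x = x)
    (ho : ContinuousOn o (Set.Icc a b)) (hr : ContinuousOn r (Set.Icc a b)) :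
    ∃ R : ℝ, ∀ x, R ≤ ‖x‖ → F x = x := by
  obtain ⟨C₁, h₁⟩ := isCompact_Icc.exists_bound_of_continuousOn ho
  obtain ⟨C₂, h₂⟩ := isCompact_Icc.exists_bound_of_continuousOn hr
  refine ⟨max (|a| + |b| + 1) (C₁ + C₂), fun x hx => h x ?_⟩
  rintro ⟨hx1, hx2⟩
  have hx1' := Set.Ioo_subset_Icc_self hx1
  have e1 : ‖x.1‖ < C₁ + C₂ := by
    have k1 := h₁ _ hx1'
    have k2 := (le_abs_self _).trans (h₂ _ hx1')
    have k3 := norm_sub_norm_le x.1 (o x.2)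
    linarith
  have e2 : ‖x.2‖ < |a| + |b| + 1 := by
    rw [Real.norm_eq_abs, abs_lt]
    constructor
    · linarith [neg_abs_le a, abs_nonneg b, hx1.1]
    · linarith [le_abs_self b, abs_nonneg a, hx1.2]
  rw [Prod.norm_def] at hx
  exact absurd hx (not_le.2 (max_lt (e1.trans_le (le_max_right _ _))
    (e2.trans_le (le_max_left _ _))))

theorem IsTubeMap.isotopicToId {o : ℝ → ℂ} {r : ℝ → ℝ} {a b : ℝ} {Φ : ℂ × ℝ ≃ₜ ℂ × ℝ}
    (h : IsTubeMap o r a b Φ) (ho : ContinuousOn o (Set.Icc a b))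
    (hr : ContinuousOn r (Set.Icc a b)) : IsotopicToId Φ := by
  obtain ⟨R, hR⟩ := exists_bound_of_eq_off_tube h.2 ho hr
  exact isotopicToId_of_bounded_support Φ hR

/-- The map that rescales the bijections `φ` of the unit disc to the cross sections of a tube. -/
def tubeFun (o : ℝ → ℂ) (r : ℝ → ℝ) (a b : ℝ) (φ : ℝ → ℂ → ℂ) (x : ℂ × ℝ) : ℂ × ℝ :=
  if x.2 ∈ Set.Ioo a b then
    (o x.2 + r x.2 • φ ((x.2 - a) / (b - x.2)) ((r x.2)⁻¹ • (x.1 - o x.2)), x.2)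
  else x

theorem tubeFun_snd (o : ℝ → ℂ) (r : ℝ → ℝ) (a b : ℝ) (φ : ℝ → ℂ → ℂ) (x : ℂ × ℝ) :
    (tubeFun o r a b φ x).2 = x.2 := by
  unfold tubeFun; split_ifs <;> rfl

/-- Below `a` the rescaled time is nonpositive and `φ` is the identity, so one formula is valid on
both sides of `a`; this gives continuity at that level. -/
theorem tubeFun_eq {o : ℝ → ℂ} {r : ℝ → ℝ} {a b : ℝ} {φ : ℝ → ℂ → ℂ}
    (h0 : ∀ t ≤ 0, φ t = id) {x : ℂ × ℝ} (hb : x.2 < b) (hr : 0 < r x.2) :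
    tubeFun o r a b φ x =
      (o x.2 + r x.2 • φ ((x.2 - a) / (b - x.2)) ((r x.2)⁻¹ • (x.1 - o x.2)), x.2) := by
  unfold tubeFun
  split_ifs with h
  · rfl
  · have ha : x.2 ≤ a := by
      by_contra! h'
      exact h ⟨h', hb⟩
    rw [h0 _ (div_nonpos_of_nonpos_of_nonneg (by linarith) (by linarith)), id,
      smul_inv_smul₀ hr.ne']
    simp

/-- An injective map fixing all points outside the open unit disc cannot send a point of the disc
outside the closed disc. -/
theorem norm_sub_le_two {φ : ℂ → ℂ} (hb : Function.Injective φ)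
    (h1 : ∀ w, 1 ≤ ‖w‖ → φ w = w) (w : ℂ) : ‖φ w - w‖ ≤ 2 := by
  rcases le_or_gt 1 ‖w‖ with h | h
  · simp [h1 w h]
  · have : ‖φ w‖ ≤ 1 := by
      by_contra! h'
      have := hb (h1 _ h'.le)
      rw [this] at h'
      linarith
    linarith [norm_sub_le (φ w) w]

theorem norm_tubeFun_sub_le {o : ℝ → ℂ} {r : ℝ → ℝ} {a b : ℝ} {φ : ℝ → ℂ → ℂ}
    (hφ : ∀ t, Function.Injective (φ t)) (h1 : ∀ t w, 1 ≤ ‖w‖ → φ t w = w)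
    (hr : ∀ z ∈ Set.Ico a b, 0 < r z) (x : ℂ × ℝ) :
    ‖tubeFun o r a b φ x - x‖ ≤ 2 * |r x.2| := by
  unfold tubeFun
  split_ifs with h
  · have hr' := hr _ (Set.Ioo_subset_Ico_self h)
    rw [Prod.norm_def]
    refine max_le ?_ (by simp)
    have : o x.2 + r x.2 • φ ((x.2 - a) / (b - x.2)) ((r x.2)⁻¹ • (x.1 - o x.2)) - x.1 =
        r x.2 • (φ ((x.2 - a) / (b - x.2)) ((r x.2)⁻¹ • (x.1 - o x.2))
          - (r x.2)⁻¹ • (x.1 - o x.2)) := by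
      have hu := smul_inv_smul₀ hr'.ne' (x.1 - o x.2)
      generalize (r x.2)⁻¹ • (x.1 - o x.2) = u at hu ⊢
      rw [smul_sub, hu]; ring
    simp only [Prod.fst_sub]
    rw [this, norm_smul, Real.norm_eq_abs, mul_comm]
    gcongr
    exact norm_sub_le_two (hφ _) (h1 _) _
  · simp

/-- The rescaled time tends to infinity at `b`, where `φ` need not converge. Continuity at the tip
holds all the same, since the displacement is at most twice the radius, which tends to `0`. -/
theorem continuous_tubeFun {o : ℝ → ℂ} {r : ℝ → ℝ} {a b : ℝ} {φ : ℝ → ℂ → ℂ}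
    (ho : Continuous o) (hrc : Continuous r)
    (hc : Continuous fun x : ℝ × ℂ => φ x.1 x.2)
    (hφ : ∀ t, Function.Injective (φ t)) (h1 : ∀ t w, 1 ≤ ‖w‖ → φ t w = w)
    (h0 : ∀ t ≤ 0, φ t = id) (hr : ∀ z ∈ Set.Ico a b, 0 < r z) (hrb : r b = 0) :
    Continuous (tubeFun o r a b φ) := by
  rw [continuous_iff_continuousAt]
  intro x
  rcases lt_trichotomy x.2 b with hx | hx | hx
  · rcases lt_or_ge x.2 a with ha | ha
    · refine continuousAt_id.congr ?_
      filter_upwards [continuous_snd.continuousAt.eventually_lt_const ha] with y hy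
      simp [tubeFun, hy.not_gt]
    · have hpos := hr x.2 ⟨ha, hx⟩
      have : ContinuousAt (fun x : ℂ × ℝ => (o x.2 + r x.2 • φ ((x.2 - a) / (b - x.2))
          ((r x.2)⁻¹ • (x.1 - o x.2)), x.2)) x := by
        have e1 : ContinuousAt (fun x : ℂ × ℝ => (x.2 - a) / (b - x.2)) x :=
          (by fun_prop : ContinuousAt (fun x : ℂ × ℝ => x.2 - a) x).div (by fun_prop)
            (by linarith)
        have e2 : ContinuousAt (fun x : ℂ × ℝ => (r x.2)⁻¹) x :=
          (by fun_prop : ContinuousAt (fun x : ℂ × ℝ => r x.2) x).inv₀ hpos.ne'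
        have e3 : ContinuousAt (fun x : ℂ × ℝ => φ ((x.2 - a) / (b - x.2))
            ((r x.2)⁻¹ • (x.1 - o x.2))) x :=
          ContinuousAt.comp (g := fun y : ℝ × ℂ => φ y.1 y.2) hc.continuousAt
            (e1.prodMk (e2.smul (by fun_prop)))
        exact ((by fun_prop : ContinuousAt (fun x : ℂ × ℝ => o x.2) x).add
          ((by fun_prop : ContinuousAt (fun x : ℂ × ℝ => r x.2) x).smul e3)).prodMk
          continuous_snd.continuousAt
      refine this.congr ?_
      filter_upwards [continuous_snd.continuousAt.eventually_lt_const hx,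
        (hrc.comp continuous_snd).continuousAt.eventually_const_lt hpos] with y hy hy'
      rw [tubeFun_eq h0 hy hy']
  · rw [ContinuousAt, tendsto_iff_norm_sub_tendsto_zero]
    have hxx : tubeFun o r a b φ x = x := by simp [tubeFun, hx]
    have hlim : Tendsto (fun y : ℂ × ℝ => 2 * |r y.2| + ‖y - x‖) (𝓝 x) (𝓝 0) := by
      have : Continuous fun y : ℂ × ℝ => 2 * |r y.2| + ‖y - x‖ := by fun_prop
      simpa [hx, hrb] using this.tendsto x
    refine squeeze_zero (fun _ => norm_nonneg _) (fun y => ?_) hlim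
    rw [hxx]
    calc ‖tubeFun o r a b φ y - x‖ = ‖(tubeFun o r a b φ y - y) + (y - x)‖ := by congr 1; abel
      _ ≤ _ := (norm_add_le _ _).trans (by gcongr; exact norm_tubeFun_sub_le hφ h1 hr y)
  · refine continuousAt_id.congr ?_
    filter_upwards [continuous_snd.continuousAt.eventually_const_lt hx] with y hy
    simp [tubeFun, hy.not_gt]

theorem bijective_tubeFun {o : ℝ → ℂ} {r : ℝ → ℝ} {a b : ℝ} {φ : ℝ → ℂ → ℂ}
    (hφ : ∀ t, Function.Bijective (φ t)) (hr : ∀ z ∈ Set.Ico a b, 0 < r z) :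
    Function.Bijective (tubeFun o r a b φ) := by
  constructor
  · rintro ⟨w, z⟩ ⟨w', z'⟩ h
    have hz : z = z' := by
      have := congrArg Prod.snd h
      rwa [tubeFun_snd, tubeFun_snd] at this
    subst hz
    unfold tubeFun at h
    split_ifs at h with hz
    · have hr' := hr _ (Set.Ioo_subset_Ico_self hz)
      simp only [Prod.mk.injEq, add_right_inj, and_true] at h
      have h2 := (hφ _).1 (smul_right_injective ℂ hr'.ne' h)
      have h3 := smul_right_injective ℂ (inv_ne_zero hr'.ne') h2
      rw [sub_left_inj] at h3
      rw [h3]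
    · exact h
  · rintro ⟨w, z⟩
    by_cases hz : z ∈ Set.Ioo a b
    · have hr' := hr _ (Set.Ioo_subset_Ico_self hz)
      obtain ⟨u, hu⟩ := (hφ ((z - a) / (b - z))).2 ((r z)⁻¹ • (w - o z))
      refine ⟨(o z + r z • u, z), ?_⟩
      simp only [tubeFun, hz, if_true, add_sub_cancel_left, inv_smul_smul₀ hr'.ne', hu,
        smul_inv_smul₀ hr'.ne', add_sub_cancel]
    · exact ⟨(w, z), by simp only [tubeFun, hz, if_false]⟩

/-- Strands in a tube which shrinks to a point at one end can be made straight, relative to the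
other end. -/
theorem exists_tubeMap_straight {n : ℕ} {c : Fin n → ℝ → ℂ} {o : ℝ → ℂ} {r : ℝ → ℝ} {a b : ℝ}
    (hab : a < b) (hc : ∀ i, Continuous (c i)) (ho : Continuous o) (hrc : Continuous r)
    (hr : ∀ z ∈ Set.Ico a b, 0 < r z) (hrb : r b = 0)
    (hcr : ∀ i, ∀ z ∈ Set.Ico a b, ‖c i z - o z‖ < r z)
    (hinj : ∀ z ∈ Set.Ico a b, Function.Injective fun i => c i z) :
    ∃ Φ, IsTubeMap o r a b Φ ∧ ∀ i, ∀ z ∈ Set.Ico a b,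
      Φ (c i z, z) = (o z + r z • ((r a)⁻¹ • (c i a - o a)), z) := by
  -- `ζ` is the inverse of `z ↦ (z - a) / (b - z)`, from `[0, ∞)` to `[a, b)`, extended by the value
  -- `a` to negative times. The strands in the tube become strands in the unit disc for all times.
  set ζ : ℝ → ℝ := fun t => (a + max t 0 * b) / (1 + max t 0) with hζ
  have hpos : ∀ t : ℝ, 0 < 1 + max t 0 := fun t => by positivity
  have hζm : ∀ t, ζ t ∈ Set.Ico a b := by
    intro t
    have h0 : 0 ≤ max t 0 := le_max_right _ _
    constructor
    · rw [hζ, le_div_iff₀ (hpos t)]; nlinarith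
    · rw [hζ, div_lt_iff₀ (hpos t)]; nlinarith
  have hζc : Continuous ζ := by
    have : Continuous fun t : ℝ => a + max t 0 * b := by fun_prop
    exact this.div (by fun_prop) fun t => (hpos t).ne'
  have hζ0 : ζ 0 = a := by simp [hζ]
  have hζτ : ∀ z ∈ Set.Ico a b, ζ ((z - a) / (b - z)) = z := by
    intro z hz
    have h1 : 0 < b - z := by linarith [hz.2]
    have h2 : 0 ≤ (z - a) / (b - z) := div_nonneg (by linarith [hz.1]) h1.le
    have h3 : b - a ≠ 0 := by linarith
    simp only [hζ, max_eq_left h2]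
    have h4 : 1 + (z - a) / (b - z) = (b - a) / (b - z) := by field_simp; ring
    rw [h4]
    field_simp
    ring
  obtain ⟨φ, hφ⟩ := exists_straightens
    (c := fun i t => (r (ζ t))⁻¹ • (c i (ζ t) - o (ζ t))) (fun i => by
      have : Continuous fun t => (r (ζ t))⁻¹ :=
        (hrc.comp hζc).inv₀ fun t => (hr _ (hζm t)).ne'
      exact this.smul (((hc i).comp hζc).sub (ho.comp hζc)))
    (fun i t => by
      have h := hr _ (hζm t)
      rw [norm_smul, norm_inv, Real.norm_eq_abs, abs_of_pos h, inv_mul_lt_one₀ h]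
      exact hcr i _ (hζm t))
    (fun t i j hij => by
      have h2 := smul_right_injective ℂ (inv_ne_zero (hr _ (hζm t)).ne') hij
      rw [sub_left_inj] at h2
      exact hinj _ (hζm t) h2)
  obtain ⟨k1, k2, k3, k4, -⟩ := hφ 0
  have hbij := bijective_tubeFun (o := o) k2 hr
  have hcont := continuous_tubeFun ho hrc k1 (fun t => (k2 t).1) k3 k4 hr hrb
  have htube : ∀ x : ℂ × ℝ, ¬ (x.2 ∈ Set.Ioo a b ∧ ‖x.1 - o x.2‖ < r x.2) →
      tubeFun o r a b φ x = x := by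
    intro x hx
    unfold tubeFun
    split_ifs with h
    · have hr' := hr _ (Set.Ioo_subset_Ico_self h)
      rw [k3, smul_inv_smul₀ hr'.ne', add_sub_cancel]
      rw [norm_smul, norm_inv, Real.norm_eq_abs, abs_of_pos hr', ← div_eq_inv_mul,
        one_le_div hr']
      by_contra! h'
      exact hx ⟨h, h'⟩
    · rfl
  obtain ⟨R, hR⟩ := exists_bound_of_eq_off_tube htube ho.continuousOn hrc.continuousOn
  obtain ⟨Φ, hΦ⟩ := exists_homeomorph_of_bijective hcont hbij hR
  refine ⟨Φ, ⟨fun x => by rw [hΦ, tubeFun_snd], fun x hx => by rw [hΦ, htube x hx]⟩,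
    fun i z hz => ?_⟩
  rw [hΦ, tubeFun_eq k4 hz.2 (hr z hz)]
  have h2 : 0 ≤ (z - a) / (b - z) := div_nonneg (by linarith [hz.1]) (by linarith [hz.2])
  have := (hφ ((z - a) / (b - z))).2.2.2.2 _ h2 le_rfl i
  simp only [hζτ z hz, hζ0] at this
  simp only
  rw [this]

/-- Strands in a tube which shrinks to a point at one end can be moved to any other such strands
with the same initial positions. -/
theorem exists_tubeMap {n : ℕ} {c d : Fin n → ℝ → ℂ} {o : ℝ → ℂ} {r : ℝ → ℝ} {a b : ℝ}
    (hab : a < b) (hc : ∀ i, ContinuousOn (c i) (Set.Icc a b))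
    (hd : ∀ i, ContinuousOn (d i) (Set.Icc a b)) (ho : ContinuousOn o (Set.Icc a b))
    (hrc : ContinuousOn r (Set.Icc a b)) (hr : ∀ z ∈ Set.Ico a b, 0 < r z) (hrb : r b = 0)
    (hcr : ∀ i, ∀ z ∈ Set.Ico a b, ‖c i z - o z‖ < r z)
    (hdr : ∀ i, ∀ z ∈ Set.Ico a b, ‖d i z - o z‖ < r z)
    (hci : ∀ z ∈ Set.Ico a b, Function.Injective fun i => c i z)
    (hdi : ∀ z ∈ Set.Ico a b, Function.Injective fun i => d i z)
    (ha : ∀ i, c i a = d i a) (hb : ∀ i, c i b = d i b) :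
    ∃ Φ, IsTubeMap o r a b Φ ∧ IsotopicToId Φ ∧
      ∀ i, ∀ z ∈ Set.Icc a b, Φ (c i z, z) = (d i z, z) := by
  -- Clamping the level to `[a, b]` extends the curves continuously to the whole line.
  have hcl : ∀ z : ℝ, max a (min z b) ∈ Set.Icc a b := fun z =>
    ⟨le_max_left _ _, max_le hab.le (min_le_right _ _)⟩
  have hclc : Continuous fun z : ℝ => max a (min z b) := by fun_prop
  have hcle : ∀ z ∈ Set.Icc a b, max a (min z b) = z := fun z hz => by
    rw [min_eq_left hz.2, max_eq_right hz.1]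
  have hcle' : ∀ z ∈ Set.Ico a b, max a (min z b) = z := fun z hz =>
    hcle z (Set.Ico_subset_Icc_self hz)
  have haa : max a (min a b) = a := hcle a ⟨le_rfl, hab.le⟩
  have main : ∀ c : Fin n → ℝ → ℂ, (∀ i, ContinuousOn (c i) (Set.Icc a b)) →
      (∀ i, ∀ z ∈ Set.Ico a b, ‖c i z - o z‖ < r z) →
      (∀ z ∈ Set.Ico a b, Function.Injective fun i => c i z) →
      ∃ Φ, IsTubeMap o r a b Φ ∧ ∀ i, ∀ z ∈ Set.Ico a b,
        Φ (c i z, z) = (o z + r z • ((r a)⁻¹ • (c i a - o a)), z) := by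
    intro c hc hcr hci
    obtain ⟨Φ, ⟨h1, h2⟩, h3⟩ := exists_tubeMap_straight (c := fun i z => c i (max a (min z b)))
      (o := fun z => o (max a (min z b))) (r := fun z => r (max a (min z b))) hab
      (fun i => (hc i).comp_continuous hclc hcl) (ho.comp_continuous hclc hcl)
      (hrc.comp_continuous hclc hcl) (fun z hz => by rw [hcle' z hz]; exact hr z hz)
      (by rw [hcle b ⟨hab.le, le_rfl⟩]; exact hrb)
      (fun i z hz => by rw [hcle' z hz]; exact hcr i z hz)
      (fun z hz => by rw [hcle' z hz]; exact hci z hz)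
    refine ⟨Φ, ⟨h1, fun x hx => h2 x ?_⟩, fun i z hz => ?_⟩
    · rintro ⟨hx1, hx2⟩
      simp only [hcle _ (Set.Ioo_subset_Icc_self hx1)] at hx2
      exact hx ⟨hx1, hx2⟩
    · have := h3 i z hz
      simp only [hcle' z hz, haa] at this
      exact this
  obtain ⟨Φ, hΦ, hΦc⟩ := main c hc hcr hci
  obtain ⟨Ψ, hΨ, hΨd⟩ := main d hd hdr hdi
  -- Both systems are carried to the same straight strands, as these depend only on the common
  -- initial positions.
  have ht := hΦ.trans hΨ.symm
  refine ⟨Φ.trans Ψ.symm, ht, ht.isotopicToId ho hrc, fun i z hz => ?_⟩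
  rcases eq_or_lt_of_le hz.2 with rfl | hzb
  · rw [ht.2 _ (by simp), hb]
  · rw [Homeomorph.trans_apply, hΦc i z ⟨hz.1, hzb⟩, Homeomorph.symm_apply_eq,
      hΨd i z ⟨hz.1, hzb⟩, ha]

/-- Strands which meet at one end can be moved to any other strands with the same ends. -/
theorem exists_homeomorph_strands {n : ℕ} {c d : Fin n → ℝ → ℂ} {a b : ℝ} {w : ℂ} (hab : a < b)
    (hc : ∀ i, ContinuousOn (c i) (Set.Icc a b)) (hd : ∀ i, ContinuousOn (d i) (Set.Icc a b))
    (hci : ∀ z ∈ Set.Ico a b, Function.Injective fun i => c i z)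
    (hdi : ∀ z ∈ Set.Ico a b, Function.Injective fun i => d i z)
    (ha : ∀ i, c i a = d i a) (hcb : ∀ i, c i b = w) (hdb : ∀ i, d i b = w) :
    ∃ Φ : ℂ × ℝ ≃ₜ ℂ × ℝ, IsotopicToId Φ ∧ (∀ x, (Φ x).2 = x.2) ∧ (∀ x, x.2 ≤ a → Φ x = x) ∧
      ∀ i, ∀ z ∈ Set.Icc a b, Φ (c i z, z) = (d i z, z) := by
  obtain ⟨Φ, h1, h2, h3⟩ := exists_tubeMap (o := fun _ => w)
    -- The sums make the tube contain all strands, the term `b - z` keeps the radius positive before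
    -- `b`, and everything vanishes at `b`.
    (r := fun z => (b - z) + (∑ i, ‖c i z - w‖ + ∑ i, ‖d i z - w‖)) hab hc hd
    continuousOn_const (by fun_prop)
    (fun z hz => by
      have : 0 < b - z := by linarith [hz.2]
      positivity)
    (by simp [hcb, hdb])
    (fun i z hz => by
      have h1 : ‖c i z - w‖ ≤ ∑ i, ‖c i z - w‖ :=
        Finset.single_le_sum (f := fun i => ‖c i z - w‖) (fun _ _ => norm_nonneg _)
          (Finset.mem_univ i)
      have h2 : 0 ≤ ∑ i, ‖d i z - w‖ := by positivity
      linarith [hz.2])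
    (fun i z hz => by
      have h1 : ‖d i z - w‖ ≤ ∑ i, ‖d i z - w‖ :=
        Finset.single_le_sum (f := fun i => ‖d i z - w‖) (fun _ _ => norm_nonneg _)
          (Finset.mem_univ i)
      have h2 : 0 ≤ ∑ i, ‖c i z - w‖ := by positivity
      linarith [hz.2]) hci hdi ha (fun i => by rw [hcb, hdb])
  exact ⟨Φ, h2, h1.1, fun x hx => h1.2 x fun h => absurd h.1.1 (not_lt.2 hx), h3⟩

/-! ### Strands and cones -/

/-- The graph of a curve in the plane over a closed interval of levels. -/
def strandGraph (c : ℝ → ℂ) (a b : ℝ) : Set (ℂ × ℝ) := (fun z => (c z, z)) '' Set.Icc a b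

/-- A compact set that meets every level between `a` and `b` in exactly one point. -/
structure IsStrand (A : Set (ℂ × ℝ)) (a b : ℝ) : Prop where
  isCompact : IsCompact A
  injOn : Set.InjOn Prod.snd A
  image_snd : Prod.snd '' A = Set.Icc a b

theorem isStrand_of_strictMonoOn {w : ℝ → ℂ} {F : ℝ → ℝ} {a b : ℝ} (hab : a ≤ b)
    (hw : ContinuousOn w (Set.Icc a b)) (hF : ContinuousOn F (Set.Icc a b))
    (hm : StrictMonoOn F (Set.Icc a b)) :
    IsStrand ((fun z => (w z, F z)) '' Set.Icc a b) (F a) (F b) := by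
  refine ⟨isCompact_Icc.image_of_continuousOn (hw.prodMk hF), ?_, ?_⟩
  · rintro _ ⟨z, hz, rfl⟩ _ ⟨z', hz', rfl⟩ h
    rw [hm.injOn hz hz' h]
  · rw [Set.image_image]
    refine Set.Subset.antisymm ?_ (intermediate_value_Icc hab hF)
    rintro _ ⟨z, hz, rfl⟩
    exact ⟨hm.monotoneOn (Set.left_mem_Icc.2 hab) hz hz.1,
      hm.monotoneOn hz (Set.right_mem_Icc.2 hab) hz.2⟩

theorem isStrand_strandGraph {c : ℝ → ℂ} {a b : ℝ} (hab : a ≤ b)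
    (hc : ContinuousOn c (Set.Icc a b)) : IsStrand (strandGraph c a b) a b :=
  isStrand_of_strictMonoOn hab hc continuousOn_id (strictMono_id.strictMonoOn _)

/-- The height is a continuous bijection from a compact set onto the interval, hence a
homeomorphism; its inverse gives the curve. -/
theorem IsStrand.exists_strandGraph {A : Set (ℂ × ℝ)} {a b : ℝ} (h : IsStrand A a b) :
    ∃ c : ℝ → ℂ, ContinuousOn c (Set.Icc a b) ∧ A = strandGraph c a b := by
  have hm : ∀ x : A, x.1.2 ∈ Set.Icc a b := fun x => by
    rw [← h.image_snd]; exact Set.mem_image_of_mem _ x.2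
  let g : A → Set.Icc a b := fun x => ⟨x.1.2, hm x⟩
  have hg : Function.Bijective g := by
    constructor
    · intro x y hxy
      exact Subtype.ext (h.injOn x.2 y.2 (congrArg Subtype.val hxy))
    · rintro ⟨z, hz⟩
      rw [← h.image_snd] at hz
      obtain ⟨x, hx, rfl⟩ := hz
      exact ⟨⟨x, hx⟩, rfl⟩
  have : CompactSpace A := isCompact_iff_compactSpace.1 h.isCompact
  have hgc : Continuous (Equiv.ofBijective g hg) := by
    change Continuous g
    fun_prop
  let e := hgc.homeoOfEquivCompactToT2
  have he : ∀ x, e x = g x := fun x => rfl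
  refine ⟨fun z => if hz : z ∈ Set.Icc a b then (e.symm ⟨z, hz⟩).1.1 else 0, ?_, ?_⟩
  · rw [continuousOn_iff_continuous_domRestrict]
    have : Set.domRestrict (Set.Icc a b)
        (fun z => if hz : z ∈ Set.Icc a b then (e.symm ⟨z, hz⟩).1.1 else 0)
        = fun z => (e.symm z).1.1 := by
      ext z
      change (if hz : z.1 ∈ Set.Icc a b then (e.symm ⟨z, hz⟩).1.1 else 0) = _
      rw [dif_pos z.2]
    rw [this]
    fun_prop
  · have key : ∀ x (hx : x ∈ A), e.symm ⟨x.2, hm ⟨x, hx⟩⟩ = ⟨x, hx⟩ := fun x hx => by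
      rw [Homeomorph.symm_apply_eq, he]
    ext x
    constructor
    · intro hx
      refine ⟨x.2, hm ⟨x, hx⟩, ?_⟩
      simp only [hm ⟨x, hx⟩, dif_pos, key x hx]
    · rintro ⟨z, hz, rfl⟩
      simp only [hz, dif_pos]
      have h1 : (e.symm ⟨z, hz⟩).1.2 = z := congrArg Subtype.val (e.apply_symm_apply ⟨z, hz⟩)
      have h2 : ((e.symm ⟨z, hz⟩).1.1, z) = (e.symm ⟨z, hz⟩).1 := Prod.ext rfl h1.symm
      rw [h2]
      exact (e.symm ⟨z, hz⟩).2

/-- Three disjoint strands which start at the points `p i` of the level `s` and meet at a point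
above that level. -/
def IsTopCone (s : ℝ) (p : Fin 3 → ℂ) (T : Set (ℂ × ℝ)) : Prop :=
  ∃ b > s, ∃ c : Fin 3 → ℝ → ℂ, (∀ i, ContinuousOn (c i) (Set.Icc s b)) ∧ (∀ i, c i s = p i) ∧
    (∀ z ∈ Set.Ico s b, Function.Injective fun i => c i z) ∧ (∀ i j, c i b = c j b) ∧
    T = ⋃ i, strandGraph (c i) s b

theorem isTopCone_of_strands {s b : ℝ} (hsb : s < b) {p : Fin 3 → ℂ} {w : ℂ}
    {A : Fin 3 → Set (ℂ × ℝ)} (hA : ∀ i, IsStrand (A i) s b) (hp : ∀ i, (p i, s) ∈ A i)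
    (hw : ∀ i, (w, b) ∈ A i) (hd : ∀ i j, i ≠ j → ∀ x ∈ A i, x ∈ A j → x.2 = b) :
    IsTopCone s p (⋃ i, A i) := by
  choose c hc hAc using fun i => (hA i).exists_strandGraph
  have hmem : ∀ i, ∀ z ∈ Set.Icc s b, (c i z, z) ∈ A i := fun i z hz => by
    rw [hAc i]; exact ⟨z, hz, rfl⟩
  have huniq : ∀ i u z, (u, z) ∈ A i → c i z = u := fun i u z h => by
    rw [hAc i] at h
    obtain ⟨z', -, h'⟩ := h
    simp only [Prod.mk.injEq] at h'
    rw [← h'.2]; exact h'.1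
  refine ⟨b, hsb, c, hc, fun i => huniq i _ _ (hp i), fun z hz i j hij => ?_,
    fun i j => by rw [huniq i _ _ (hw i), huniq j _ _ (hw j)], Set.iUnion_congr hAc⟩
  by_contra hne
  have h1 := hmem i z (Set.Ico_subset_Icc_self hz)
  have h2 := hmem j z (Set.Ico_subset_Icc_self hz)
  simp only at hij
  rw [← hij] at h2
  exact hz.2.ne (hd i j hne _ h1 h2)

theorem image_strandGraph {Φ : ℂ × ℝ → ℂ × ℝ} {c d : ℝ → ℂ} {a b : ℝ}
    (h : ∀ z ∈ Set.Icc a b, Φ (c z, z) = (d z, z)) :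
    Φ '' strandGraph c a b = strandGraph d a b := by
  unfold strandGraph
  rw [Set.image_image]
  exact Set.image_congr h

theorem image_eq_self_of_forall {α : Type*} {Φ : α → α} {B : Set α} (h : ∀ x ∈ B, Φ x = x) :
    Φ '' B = B := by
  rw [Set.image_congr h, Set.image_id']

theorem strandGraph_union {c : ℝ → ℂ} {a m b : ℝ} (h1 : a ≤ m) (h2 : m ≤ b) :
    strandGraph c a m ∪ strandGraph c m b = strandGraph c a b := by
  unfold strandGraph
  rw [← Set.image_union, Set.Icc_union_Icc_eq_Icc h1 h2]

theorem IsTopCone.le_snd {s : ℝ} {p : Fin 3 → ℂ} {T : Set (ℂ × ℝ)} (h : IsTopCone s p T)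
    {x : ℂ × ℝ} (hx : x ∈ T) : s ≤ x.2 := by
  obtain ⟨b, -, c, -, -, -, -, rfl⟩ := h
  obtain ⟨i, z, hz, rfl⟩ := Set.mem_iUnion.1 hx
  exact hz.1

theorem IsTopCone.reindex {s : ℝ} {p : Fin 3 → ℂ} {T : Set (ℂ × ℝ)} (h : IsTopCone s p T)
    (e : Equiv.Perm (Fin 3)) : IsTopCone s (p ∘ e) T := by
  obtain ⟨b, hb, c, h1, h2, h3, h4, rfl⟩ := h
  refine ⟨b, hb, c ∘ e, fun i => h1 _, fun i => h2 _, fun z hz => (h3 z hz).comp e.injective,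
    fun i j => h4 _ _, ?_⟩
  exact (e.surjective.iUnion_comp fun i => strandGraph (c i) s b).symm

/-! ### Turning a branch upwards -/

/-- A cut-off function: it increases from `0` to `1` between `a` and `b`, is `1` between `b` and
`m`, and decreases to `0` with slope `-1 / (2 * K)` above `m`. -/
def cutoff (a b m K z : ℝ) : ℝ :=
  max 0 (min ((z - a) / (b - a)) (min 1 (1 - (z - m) / (2 * K))))

/-- The cut-off never falls faster than with slope `1 / (2 * K)`, so adding `K` times it, weighted
by a factor in `[0, 1]`, to the level keeps the level strictly increasing. -/
theorem cutoff_le_add {a b m K z z' : ℝ} (hab : a < b) (hK : 0 < K) (h : z ≤ z') :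
    cutoff a b m K z ≤ cutoff a b m K z' + (z' - z) / (2 * K) := by
  have hε : 0 ≤ (z' - z) / (2 * K) := div_nonneg (by linarith) (by linarith)
  unfold cutoff
  rw [← max_add_add_right, ← min_add_add_right, ← min_add_add_right]
  refine max_le_max (by linarith) (min_le_min ?_ (min_le_min (by linarith) ?_))
  · have : (z - a) / (b - a) ≤ (z' - a) / (b - a) := by
      have : 0 < b - a := by linarith
      gcongr
    linarith
  · apply le_of_eq; field_simp; ring

theorem cutoff_mono {a b m K z z' : ℝ} (hab : a < b) (hbm : b ≤ m) (hK : 0 < K) (h : z ≤ z')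
    (hb : z' ≤ b) : cutoff a b m K z ≤ cutoff a b m K z' := by
  have hpos : 0 < b - a := by linarith
  have e : ∀ u ≤ b, min ((u - a) / (b - a)) (min 1 (1 - (u - m) / (2 * K))) =
      (u - a) / (b - a) := by
    intro u hu
    have h1 : (u - m) / (2 * K) ≤ 0 := div_nonpos_of_nonpos_of_nonneg (by linarith) (by linarith)
    rw [min_eq_left (by linarith : (1 : ℝ) ≤ 1 - (u - m) / (2 * K)), min_eq_left]
    rw [div_le_one hpos]; linarith
  unfold cutoff
  rw [e z (h.trans hb), e z' hb]
  gcongr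

theorem cutoff_of_le {a b m K z : ℝ} (hab : a < b) (h : z ≤ a) : cutoff a b m K z = 0 := by
  unfold cutoff
  rw [max_eq_left]
  exact (min_le_left _ _).trans (div_nonpos_of_nonpos_of_nonneg (by linarith) (by linarith))

theorem cutoff_of_ge {a b m K z : ℝ} (hK : 0 < K) (h : m + 2 * K ≤ z) : cutoff a b m K z = 0 := by
  unfold cutoff
  rw [max_eq_left]
  refine (min_le_right _ _).trans ((min_le_right _ _).trans ?_)
  rw [sub_nonpos, one_le_div (by linarith)]
  linarith

theorem cutoff_eq_one {a b m K z : ℝ} (hab : a < b) (hK : 0 < K) (h1 : b ≤ z) (h2 : z ≤ m) :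
    cutoff a b m K z = 1 := by
  unfold cutoff
  have h3 : (z - m) / (2 * K) ≤ 0 := div_nonpos_of_nonpos_of_nonneg (by linarith) (by linarith)
  rw [min_eq_left (by linarith : (1 : ℝ) ≤ 1 - (z - m) / (2 * K)), min_eq_right, max_eq_right]
  · norm_num
  · rw [one_le_div (by linarith)]; linarith

theorem cutoff_nonneg (a b m K z : ℝ) : 0 ≤ cutoff a b m K z := le_max_left _ _

theorem cutoff_le_one (a b m K z : ℝ) : cutoff a b m K z ≤ 1 :=
  max_le zero_le_one ((min_le_right _ _).trans (min_le_left _ _))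

/-- A bump function on the plane. -/
def bump (w₀ : ℂ) (η : ℝ) (w : ℂ) : ℝ := max 0 (1 - ‖w - w₀‖ / η)

theorem bump_nonneg (w₀ : ℂ) (η : ℝ) (w : ℂ) : 0 ≤ bump w₀ η w := le_max_left _ _

theorem bump_le_one (w₀ : ℂ) {η : ℝ} (hη : 0 < η) (w : ℂ) : bump w₀ η w ≤ 1 :=
  max_le zero_le_one (by have : 0 ≤ ‖w - w₀‖ / η := by positivity
                         linarith)

theorem bump_of_le {w₀ : ℂ} {η : ℝ} (hη : 0 < η) {w : ℂ} (h : η ≤ ‖w - w₀‖) :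
    bump w₀ η w = 0 := by
  unfold bump
  rw [max_eq_left]
  rw [sub_nonpos, one_le_div hη]; exact h

/-- A homeomorphism that lifts a neighbourhood of the line above `w₀`. -/
theorem exists_lift {a b m K η : ℝ} (hab : a < b) (hK : 0 < K) (hη : 0 < η) (w₀ : ℂ) :
    ∃ Φ : ℂ × ℝ ≃ₜ ℂ × ℝ, IsotopicToId Φ ∧
      ∀ w z, Φ (w, z) = (w, z + K * (bump w₀ η w * cutoff a b m K z)) := by
  have hmono : ∀ w, StrictMono fun z => z + K * (bump w₀ η w * cutoff a b m K z) := by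
    intro w z z' hz
    have h1 := cutoff_le_add (m := m) hab hK hz.le
    have h2 := bump_nonneg w₀ η w
    have h3 := bump_le_one w₀ hη w
    have h4 : K * (bump w₀ η w * cutoff a b m K z) ≤
        K * (bump w₀ η w * cutoff a b m K z') + K * (1 * ((z' - z) / (2 * K))) := by
      rw [← mul_add]
      refine mul_le_mul_of_nonneg_left ?_ hK.le
      calc _ ≤ bump w₀ η w * (cutoff a b m K z' + (z' - z) / (2 * K)) := by gcongr
        _ ≤ _ := by
          rw [mul_add]
          have : 0 ≤ (z' - z) / (2 * K) := div_nonneg (by linarith) (by linarith)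
          gcongr
    have h5 : K * (1 * ((z' - z) / (2 * K))) = (z' - z) / 2 := by field_simp
    simp only
    linarith
  have hbc : ∀ w z, 0 ≤ K * (bump w₀ η w * cutoff a b m K z) ∧
      K * (bump w₀ η w * cutoff a b m K z) ≤ K := by
    intro w z
    have h2 := bump_nonneg w₀ η w
    have h3 := bump_le_one w₀ hη w
    have h4 := cutoff_nonneg a b m K z
    have h5 := cutoff_le_one a b m K z
    exact ⟨by positivity, mul_le_of_le_one_right hK.le (mul_le_one₀ h3 h4 h5)⟩
  have hcont : Continuous fun x : ℂ × ℝ =>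
      (x.1, x.2 + K * (bump w₀ η x.1 * cutoff a b m K x.2)) := by
    unfold bump cutoff; fun_prop
  -- The lift moves levels by an amount between `0` and `K`, so it is unbounded in both directions
  -- along each vertical line.
  have hsurj : ∀ w, Function.Surjective fun z => z + K * (bump w₀ η w * cutoff a b m K z) := by
    intro w
    refine Continuous.surjective (by unfold cutoff; fun_prop) ?_ ?_
    · exact tendsto_atTop_mono (fun z => by have := (hbc w z).1; simp only [id]; linarith)
        tendsto_id
    · exact tendsto_atBot_mono (fun z => by have := (hbc w z).2; simp only [id]; linarith)
        (tendsto_atBot_add_const_right _ K tendsto_id)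
  have hbij : Function.Bijective fun x : ℂ × ℝ =>
      (x.1, x.2 + K * (bump w₀ η x.1 * cutoff a b m K x.2)) := by
    constructor
    · rintro ⟨w, z⟩ ⟨w', z'⟩ h
      simp only [Prod.mk.injEq] at h
      obtain ⟨rfl, h⟩ := h
      rw [(hmono w).injective h]
    · rintro ⟨w, z⟩
      obtain ⟨z', hz'⟩ := hsurj w z
      exact ⟨(w, z'), by simp only at hz' ⊢; rw [hz']⟩
  obtain ⟨R, hR⟩ := exists_bound_of_eq_off_tube
    (F := fun x : ℂ × ℝ => (x.1, x.2 + K * (bump w₀ η x.1 * cutoff a b m K x.2)))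
    (o := fun _ => w₀) (r := fun _ => η) (a := a) (b := m + 2 * K) (fun x hx => by
      have : bump w₀ η x.1 * cutoff a b m K x.2 = 0 := by
        by_cases h1 : ‖x.1 - w₀‖ < η
        · have h2 : x.2 ∉ Set.Ioo a (m + 2 * K) := fun h => hx ⟨h, h1⟩
          rw [Set.mem_Ioo, not_and_or, not_lt, not_lt] at h2
          rcases h2 with h2 | h2
          · rw [cutoff_of_le hab h2, mul_zero]
          · rw [cutoff_of_ge hK h2, mul_zero]
        · rw [bump_of_le hη (not_lt.1 h1), zero_mul]
      simp only [this, mul_zero, add_zero]) continuousOn_const continuousOn_const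
  obtain ⟨Φ, hΦ⟩ := exists_homeomorph_of_bijective hcont hbij hR
  refine ⟨Φ, isotopicToId_of_bounded_support Φ (by rw [hΦ]; exact hR), fun w z => by rw [hΦ]⟩

/-- The lift of a strand that is straight near the top. -/
theorem strictMonoOn_lift {s a b m K η : ℝ} {w₀ κ : ℂ} {w : ℝ → ℂ} (hab : a < b) (hbm : b ≤ m)
    (hK : 0 < K) (hη : 0 < η) (hw : ∀ z ∈ Set.Icc a b, w z - w₀ = (b - z) • κ) :
    StrictMonoOn (fun z => z + K * (bump w₀ η (w z) * cutoff a b m K z)) (Set.Icc s b) := by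
  intro z hz z' hz' h
  refine add_lt_add_of_lt_of_le h (mul_le_mul_of_nonneg_left ?_ hK.le)
  -- Up to `a` the cut-off vanishes. Between `a` and `b` the strand approaches `w₀` along a line, so
  -- the bump and the cut-off both grow with the level.
  rcases le_or_gt z a with hza | hza
  · rw [cutoff_of_le hab hza, mul_zero]
    exact mul_nonneg (bump_nonneg _ _ _) (cutoff_nonneg _ _ _ _ _)
  · refine mul_le_mul ?_ (cutoff_mono hab hbm hK h.le hz'.2) (cutoff_nonneg _ _ _ _ _)
      (bump_nonneg _ _ _)
    unfold bump
    rw [hw z ⟨hza.le, hz.2⟩, hw z' ⟨(hza.trans h).le, hz'.2⟩, norm_smul, norm_smul,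
      Real.norm_eq_abs, Real.norm_eq_abs, abs_of_nonneg (by linarith [hz.2]),
      abs_of_nonneg (by linarith [hz'.2])]
    gcongr

theorem iUnion_fin_three {α : Type*} (A : Fin 3 → Set α) : ⋃ i, A i = A 0 ∪ A 1 ∪ A 2 := by
  ext x
  simp [Fin.exists_fin_succ, or_assoc]

theorem mem_image_iff_of_homeomorph {X : Type*} [TopologicalSpace X] (Φ : X ≃ₜ X) {A : Set X}
    {x : X} : Φ x ∈ Φ '' A ↔ x ∈ A := Φ.injective.mem_set_image

set_option maxHeartbeats 1000000 in
/-- A branch that goes up to a maximum, and leads from there down to a point where it splits into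
two, can be turned upwards: the resulting three strands meet at their common highest point. -/
theorem exists_turn_branch {s q m : ℝ} (hsq : s < q) (hqm : q < m) {a b c : ℝ → ℂ}
    (ha : ContinuousOn a (Set.Icc s m)) (hb : ContinuousOn b (Set.Icc s m))
    (hc : ContinuousOn c (Set.Icc s q)) (hab : ∀ z ∈ Set.Ico s m, a z ≠ b z) (habm : a m = b m)
    (hca : ∀ z ∈ Set.Icc s q, c z ≠ a z) (hcb : ∀ z ∈ Set.Ico s q, c z ≠ b z)
    (hcq : c q = b q) :
    ∃ Φ : ℂ × ℝ ≃ₜ ℂ × ℝ, IsotopicToId Φ ∧ (∀ x, x.2 ≤ s → Φ x = x) ∧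
      IsTopCone s ![a s, b s, c s]
        (Φ '' (strandGraph a s m ∪ strandGraph b s m ∪ strandGraph c s q)) := by
  have hsm : s < m := hsq.trans hqm
  set δ : ℂ := (a s - b s) / 2 with hδ
  have hδ0 : δ ≠ 0 := div_ne_zero (sub_ne_zero.2 (hab s ⟨le_rfl, hsm⟩)) two_ne_zero
  set s₁ : ℝ := (s + q) / 2 with hs₁
  have hss₁ : s < s₁ := by rw [hs₁]; linarith
  have hs₁q : s₁ < q := by rw [hs₁]; linarith
  set μ : ℝ → ℝ := fun z => (m - z) / (m - s) with hμ
  -- `l` is the midpoint of the straightened strands `l ± μ • δ`. It moves from the midpoint of `a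
  -- s` and `b s` to `a m` and is constant from `s₁` on, so that these strands are straight segments
  -- near the level `q`.
  set l : ℝ → ℂ := fun z => a m + max 0 (1 - (z - s) / (s₁ - s)) • ((a s + b s) / 2 - a m) with hl
  have hμs : μ s = 1 := div_self (by linarith)
  have hμm : μ m = 0 := by simp [hμ]
  have hμpos : ∀ z < m, 0 < μ z := fun z hz => div_pos (by linarith) (by linarith)
  have hls : l s = (a s + b s) / 2 := by simp [hl]
  have hl1 : ∀ z, s₁ ≤ z → l z = a m := by
    intro z hz
    simp only [hl]
    rw [max_eq_left, zero_smul, add_zero]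
    rw [sub_nonpos, one_le_div (by linarith)]; linarith
  have hlc : Continuous l := by simp only [hl]; fun_prop
  have hμc : Continuous μ := by simp only [hμ]; fun_prop
  set a' : ℝ → ℂ := fun z => l z + μ z • δ with ha'
  set b' : ℝ → ℂ := fun z => l z - μ z • δ with hb'
  have ha'c : Continuous a' := by simp only [ha']; fun_prop
  have hb'c : Continuous b' := by simp only [hb']; fun_prop
  have hab' : ∀ z < m, a' z ≠ b' z := by
    intro z hz h
    have h1 : (2 * μ z) • δ = 0 := by
      have : (2 * μ z) • δ = a' z - b' z := by simp only [ha', hb']; rw [mul_smul, two_smul]; ring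
      rw [this, h, sub_self]
    rcases smul_eq_zero.1 h1 with h2 | h2
    · linarith [hμpos z hz]
    · exact hδ0 h2
  have ha's : a' s = a s := by simp only [ha', hls, hμs, hδ, one_smul]; ring
  have hb's : b' s = b s := by simp only [hb', hls, hμs, hδ, one_smul]; ring
  have hinj2 : ∀ u v : ℂ, u ≠ v → Function.Injective (![u, v] : Fin 2 → ℂ) := by
    intro u v h i j
    fin_cases i <;> fin_cases j <;> simp [h, h.symm]
  -- the two long strands are made straight
  obtain ⟨Φ₁, hI₁, hlev₁, hid₁, hΦ₁⟩ := exists_homeomorph_strands (n := 2)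
    (c := fun i z => ![a z, b z] i) (d := fun i z => ![a' z, b' z] i) (w := a m) hsm
    (by intro i; fin_cases i; exacts [ha, hb])
    (by intro i; fin_cases i; exacts [ha'c.continuousOn, hb'c.continuousOn])
    (fun z hz => hinj2 _ _ (hab z hz)) (fun z hz => hinj2 _ _ (hab' z hz.2))
    (by intro i; fin_cases i; exacts [ha's.symm, hb's.symm])
    (by intro i; fin_cases i; exacts [rfl, habm.symm])
    (by intro i; fin_cases i <;> simp [ha', hb', hμm, hl1 m (by linarith)])
  have hΦ₁a : ∀ z ∈ Set.Icc s m, Φ₁ (a z, z) = (a' z, z) := fun z hz => hΦ₁ 0 z hz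
  have hΦ₁b : ∀ z ∈ Set.Icc s m, Φ₁ (b z, z) = (b' z, z) := fun z hz => hΦ₁ 1 z hz
  set c₁ : ℝ → ℂ := fun z => (Φ₁ (c z, z)).1 with hc₁
  have hΦ₁c : ∀ z, Φ₁ (c z, z) = (c₁ z, z) := fun z => Prod.ext rfl (hlev₁ _)
  have hc₁c : ContinuousOn c₁ (Set.Icc s q) :=
    continuous_fst.comp_continuousOn (Φ₁.continuous.comp_continuousOn (hc.prodMk continuousOn_id))
  have hqm' : ∀ z ∈ Set.Icc s q, z ∈ Set.Icc s m := fun z hz => ⟨hz.1, hz.2.trans hqm.le⟩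
  have hc₁a : ∀ z ∈ Set.Icc s q, c₁ z ≠ a' z := by
    intro z hz h
    have h1 := hΦ₁c z
    rw [h, ← hΦ₁a z (hqm' z hz)] at h1
    exact hca z hz (Prod.mk.inj (Φ₁.injective h1)).1
  have hc₁b : ∀ z ∈ Set.Ico s q, c₁ z ≠ b' z := by
    intro z hz h
    have h1 := hΦ₁c z
    rw [h, ← hΦ₁b z (hqm' z (Set.Ico_subset_Icc_self hz))] at h1
    exact hcb z hz (Prod.mk.inj (Φ₁.injective h1)).1
  have hc₁q : c₁ q = b' q := by
    have h1 := hΦ₁c q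
    rw [hcq, hΦ₁b q ⟨hsq.le, hqm.le⟩] at h1
    exact (Prod.mk.inj h1).1.symm
  have hc₁s : c₁ s = c s := by simp only [hc₁, hid₁ (c s, s) le_rfl]
  -- the third strand is made straight near the point where it meets the second
  set η : ℝ := μ q * ‖δ‖ with hη
  have hηpos : 0 < η := mul_pos (hμpos q hqm) (norm_pos_iff.2 hδ0)
  -- Above `s₂` the tube used below has radius less than `3 / 2 * η`, while the strand `a'` stays at
  -- distance at least `2 * η` from its axis `b'`.
  obtain ⟨s₂, hs₁₂, hs₂q, hsmall⟩ : ∃ s₂, s₁ ≤ s₂ ∧ s₂ < q ∧ ∀ z ∈ Set.Icc s₂ q,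
      ‖c₁ z - b' z‖ < η / 2 ∧ q - z < η / 2 := by
    have hcont : ContinuousWithinAt (fun z => ‖c₁ z - b' z‖ + (q - z)) (Set.Icc s q) q :=
      (((hc₁c q ⟨hsq.le, le_rfl⟩).sub hb'c.continuousWithinAt).norm).add
        (continuousWithinAt_const.sub continuousWithinAt_id)
    have hev := hcont.eventually_lt_const (show ‖c₁ q - b' q‖ + (q - q) < η / 2 by
      rw [hc₁q]; simpa using hηpos)
    rw [eventually_nhdsWithin_iff, Metric.eventually_nhds_iff] at hev
    obtain ⟨ε, hε, h⟩ := hev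
    refine ⟨max s₁ (q - ε / 2), le_max_left _ _, max_lt hs₁q (by linarith), fun z hz => ?_⟩
    have hz1 := (le_max_left _ _).trans hz.1
    have hz2 := (le_max_right _ _).trans hz.1
    have h1 := @h z (by rw [Real.dist_eq, abs_sub_comm, abs_of_nonneg (by linarith [hz.2])]
                        linarith) ⟨by linarith, hz.2⟩
    have h2 : 0 ≤ q - z := by linarith [hz.2]
    have h3 := norm_nonneg (c₁ z - b' z)
    exact ⟨by linarith, by linarith⟩
  have hss₂ : s < s₂ := hss₁.trans_le hs₁₂
  set v : ℂ := c₁ s₂ - b' s₂ with hv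
  have hv0 : v ≠ 0 := sub_ne_zero.2 (hc₁b s₂ ⟨hss₂.le, hs₂q⟩)
  -- `d` replaces the end of the third strand: its offset from `b'` shrinks linearly from its value
  -- at `s₂` to zero at `q`.
  set d : ℝ → ℂ := fun z => b' z + ((q - z) / (q - s₂)) • v with hd
  have hdc : Continuous d := by simp only [hd]; fun_prop
  have hds : d s₂ = c₁ s₂ := by
    simp only [hd, hv]; rw [div_self (by linarith), one_smul]; ring
  have hdq : d q = c₁ q := by simp [hd, hc₁q]
  have hdb : ∀ z, z < q → d z ≠ b' z := by
    intro z hz h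
    simp only [hd, add_eq_left] at h
    rcases smul_eq_zero.1 h with h | h
    · have : 0 < (q - z) / (q - s₂) := div_pos (by linarith) (by linarith)
      linarith
    · exact hv0 h
  have hdn : ∀ z ∈ Set.Icc s₂ q, ‖d z - b' z‖ < η / 2 := by
    intro z hz
    have h0 : 0 ≤ (q - z) / (q - s₂) := div_nonneg (by linarith [hz.2]) (by linarith)
    have h1 : (q - z) / (q - s₂) ≤ 1 := by
      rw [div_le_one (by linarith)]; linarith [hz.1]
    simp only [hd, add_sub_cancel_left]
    rw [norm_smul, Real.norm_eq_abs, abs_of_nonneg h0]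
    exact (mul_le_of_le_one_left (norm_nonneg _) h1).trans_lt (hsmall s₂ ⟨le_rfl, hs₂q.le⟩).1
  have hsub₂ : Set.Icc s₂ q ⊆ Set.Icc s q := Set.Icc_subset_Icc_left hss₂.le
  -- The tube has `b'` as its axis, and `b'` is included among the strands so that it stays fixed.
  obtain ⟨Φ₂, ⟨hlev₂, htube₂⟩, hI₂, hΦ₂⟩ := exists_tubeMap (n := 2)
    (c := fun i z => ![b' z, c₁ z] i) (d := fun i z => ![b' z, d z] i) (o := b')
    (r := fun z => ‖c₁ z - b' z‖ + ‖d z - b' z‖ + (q - z)) hs₂q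
    (by intro i; fin_cases i; exacts [hb'c.continuousOn, hc₁c.mono hsub₂])
    (by intro i; fin_cases i; exacts [hb'c.continuousOn, hdc.continuousOn])
    hb'c.continuousOn
    ((((hc₁c.mono hsub₂).sub hb'c.continuousOn).norm.add
      (hdc.continuousOn.sub hb'c.continuousOn).norm).add (by fun_prop))
    (fun z hz => by
      have : 0 < q - z := by linarith [hz.2]
      positivity)
    (by simp [hdq, hc₁q])
    (by
      intro i z hz
      have h1 := norm_nonneg (c₁ z - b' z)
      have h2 := norm_nonneg (d z - b' z)
      fin_cases i
      · simp; linarith [hz.2]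
      · simp; linarith [hz.2])
    (by
      intro i z hz
      have h1 := norm_nonneg (c₁ z - b' z)
      have h2 := norm_nonneg (d z - b' z)
      fin_cases i
      · simp; linarith [hz.2]
      · simp; linarith [hz.2])
    (fun z hz => hinj2 _ _ (hc₁b z ⟨hss₂.le.trans hz.1, hz.2⟩).symm)
    (fun z hz => hinj2 _ _ (hdb z hz.2).symm)
    (by intro i; fin_cases i; exacts [rfl, hds.symm])
    (by intro i; fin_cases i; exacts [rfl, hdq.symm])
  have hΦ₂b : ∀ z, Φ₂ (b' z, z) = (b' z, z) := by
    intro z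
    by_cases hz : z ∈ Set.Icc s₂ q
    · exact hΦ₂ 0 z hz
    · exact htube₂ _ fun h => hz (Set.Ioo_subset_Icc_self h.1)
  have hΦ₂a : ∀ z, Φ₂ (a' z, z) = (a' z, z) := by
    intro z
    refine htube₂ _ fun h => ?_
    have hz := Set.Ioo_subset_Icc_self h.1
    have h1 := h.2
    have h2 := hsmall z hz
    have h3 := hdn z hz
    have h4 : a' z - b' z = (2 * μ z) • δ := by
      simp only [ha', hb']; rw [mul_smul, two_smul]; ring
    simp only at h1 hz
    have h5 : μ q ≤ μ z := by
      simp only [hμ]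
      have : 0 < m - s := by linarith
      gcongr
      exact hz.2
    rw [h4, norm_smul, Real.norm_eq_abs, abs_of_pos (by linarith [hμpos q hqm])] at h1
    have h6 : μ q * ‖δ‖ ≤ μ z * ‖δ‖ := by gcongr
    rw [← hη] at h6
    linarith [h2.1, h2.2]
  set c₂ : ℝ → ℂ := fun z => (Φ₂ (c₁ z, z)).1 with hc₂
  have hΦ₂c : ∀ z, Φ₂ (c₁ z, z) = (c₂ z, z) := fun z => Prod.ext rfl (hlev₂ _)
  have hc₂c : ContinuousOn c₂ (Set.Icc s q) :=
    continuous_fst.comp_continuousOn (Φ₂.continuous.comp_continuousOn (hc₁c.prodMk continuousOn_id))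
  have hc₂d : ∀ z ∈ Set.Icc s₂ q, c₂ z = d z := fun z hz => by
    have : Φ₂ (c₁ z, z) = (d z, z) := hΦ₂ 1 z hz
    simp only [hc₂, this]
  -- the branch is turned upwards
  set K : ℝ := 2 * (m - q) with hK
  have hKpos : 0 < K := by rw [hK]; linarith
  obtain ⟨Φ₃, hI₃, hΦ₃⟩ := exists_lift (m := m) hs₂q hKpos hηpos (b' q)
  have hms : m - s ≠ 0 := by linarith
  have hbq : ∀ z, s₁ ≤ z → b' z - b' q = (μ q - μ z) • δ := by
    intro z hz
    simp only [hb', hl1 z hz, hl1 q hs₁q.le]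
    rw [sub_smul]; ring
  -- Above `s₂` the strand `a'` is at distance `(μ z + μ q) * ‖δ‖ ≥ η` from the centre of the bump,
  -- and below `s₂` the cut-off vanishes.
  have hΦ₃a : ∀ z ≤ m, Φ₃ (a' z, z) = (a' z, z) := by
    intro z hz
    rw [hΦ₃]
    have : bump (b' q) η (a' z) * cutoff s₂ q m K z = 0 := by
      rcases le_or_gt z s₂ with h | h
      · rw [cutoff_of_le hs₂q h, mul_zero]
      · rw [bump_of_le hηpos, zero_mul]
        have h1 : a' z - b' q = (μ z + μ q) • δ := by
          simp only [ha', hb', hl1 z (by linarith), hl1 q hs₁q.le]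
          rw [add_smul]; ring
        have h2 : 0 ≤ μ z := div_nonneg (by linarith) (by linarith)
        rw [h1, norm_smul, Real.norm_eq_abs, abs_of_nonneg (by linarith [hμpos q hqm]), hη]
        gcongr
        linarith
    rw [this, mul_zero, add_zero]
  -- On this part of `b'` the bump equals `(m - z) / (m - q)`, and `K = 2 * (m - q)` makes the lift
  -- the reflection of the level `z` in `m`.
  have hΦ₃b : ∀ z ∈ Set.Icc q m, Φ₃ (b' z, z) = (b' z, 2 * m - z) := by
    intro z hz
    rw [hΦ₃, cutoff_eq_one hs₂q hKpos hz.1 hz.2, mul_one]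
    have h1 : μ z ≤ μ q := by
      simp only [hμ]
      have : 0 < m - s := by linarith
      gcongr
      exact hz.1
    have h2 : 0 ≤ μ z := div_nonneg (by linarith [hz.2]) (by linarith)
    have h3 : bump (b' q) η (b' z) = (m - z) / (m - q) := by
      unfold bump
      rw [hbq z (by linarith [hz.1]), norm_smul, Real.norm_eq_abs, abs_of_nonneg (by linarith), hη,
        mul_div_mul_right _ _ (norm_ne_zero_iff.2 hδ0)]
      have h4 : 1 - (μ q - μ z) / μ q = (m - z) / (m - q) := by
        have : m - q ≠ 0 := by linarith
        simp only [hμ]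
        field_simp
        ring
      rw [h4, max_eq_right (div_nonneg (by linarith [hz.2]) (by linarith))]
    rw [h3, hK]
    have : m - q ≠ 0 := by linarith
    congr 1
    field_simp
    ring
  have hbκ : ∀ z ∈ Set.Icc s₂ q, b' z - b' q = (q - z) • (-(m - s)⁻¹ • δ) := by
    intro z hz
    rw [hbq z (by linarith [hz.1]), smul_smul]
    congr 1
    simp only [hμ]
    field_simp
    ring
  have hcκ : ∀ z ∈ Set.Icc s₂ q, c₂ z - b' q = (q - z) • (-(m - s)⁻¹ • δ + (q - s₂)⁻¹ • v) := by
    intro z hz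
    rw [hc₂d z hz, smul_add, ← hbκ z hz]
    simp only [hd]
    rw [smul_smul, div_eq_mul_inv]
    ring
  set Φ : ℂ × ℝ ≃ₜ ℂ × ℝ := (Φ₁.trans Φ₂).trans Φ₃ with hΦ
  have hΦa : ∀ z ∈ Set.Icc s m, Φ (a z, z) = (a' z, z) := fun z hz => by
    simp only [hΦ, Homeomorph.trans_apply]; rw [hΦ₁a z hz, hΦ₂a, hΦ₃a z hz.2]
  have hΦb : ∀ z ∈ Set.Icc s m, Φ (b z, z) = Φ₃ (b' z, z) := fun z hz => by
    simp only [hΦ, Homeomorph.trans_apply]; rw [hΦ₁b z hz, hΦ₂b]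
  have hΦc : ∀ z, Φ (c z, z) = Φ₃ (c₂ z, z) := fun z => by
    simp only [hΦ, Homeomorph.trans_apply]; rw [hΦ₁c, hΦ₂c]
  have hid : ∀ x, x.2 ≤ s → Φ x = x := by
    intro x hx
    simp only [hΦ, Homeomorph.trans_apply]
    rw [hid₁ x hx, htube₂ x fun h => absurd h.1.1 (not_lt.2 (hx.trans hss₂.le))]
    have := hΦ₃ x.1 x.2
    rw [cutoff_of_le hs₂q (hx.trans hss₂.le), mul_zero, mul_zero, add_zero] at this
    exact this
  refine ⟨Φ, (hI₁.trans hI₂).trans hI₃, hid, ?_⟩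
  -- The new strands all run from the level `s` to the branching point at level `q`, which is lifted
  -- to `2 * m - q`. The first consists of `a` and, past the maximum, the part of `b` above `q`; the
  -- others are the lower part of `b`, and `c`.
  set A : Fin 3 → Set (ℂ × ℝ) := ![strandGraph a s m ∪ strandGraph b q m, strandGraph b s q,
    strandGraph c s q] with hA
  have hU : Φ '' (strandGraph a s m ∪ strandGraph b s m ∪ strandGraph c s q) = ⋃ i, Φ '' A i := by
    rw [← Set.image_iUnion]
    congr 1
    rw [iUnion_fin_three]
    change _ = strandGraph a s m ∪ strandGraph b q m ∪ strandGraph b s q ∪ strandGraph c s q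
    rw [← strandGraph_union (c := b) hsq.le hqm.le, Set.union_comm (strandGraph b s q),
      ← Set.union_assoc]
  rw [hU]
  have hqs : q ∈ Set.Icc s q := ⟨hsq.le, le_rfl⟩
  have hqI : q ∈ Set.Icc q m := ⟨le_rfl, hqm.le⟩
  have htop : Φ (b q, q) = (b' q, 2 * m - q) := by
    rw [hΦb q (hqm' q hqs), hΦ₃b q hqI]
  have hend : q + K * (bump (b' q) η (b' q) * cutoff s₂ q m K q) = 2 * m - q := by
    have h1 := hΦ₃b q hqI
    rw [hΦ₃] at h1
    exact (Prod.mk.inj h1).2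
  have hstart : ∀ w, s + K * (bump (b' q) η w * cutoff s₂ q m K s) = s := fun w => by
    rw [cutoff_of_le hs₂q hss₂.le]; ring
  -- This treats the lower part of `b` and `c` alike: both approach the axis of the bump along
  -- straight segments above `s₂`, so the lift keeps their levels increasing.
  have hstrand : ∀ (e w : ℝ → ℂ) (κ : ℂ), ContinuousOn w (Set.Icc s q) →
      (∀ z ∈ Set.Icc s₂ q, w z - b' q = (q - z) • κ) →
      (∀ z ∈ Set.Icc s q, Φ (e z, z) = Φ₃ (w z, z)) →
      IsStrand (Φ '' strandGraph e s q) s (2 * m - q) := by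
    intro e w κ hw hκ he
    have h1 := isStrand_of_strictMonoOn hsq.le hw
      (F := fun z => z + K * (bump (b' q) η (w z) * cutoff s₂ q m K z))
      (by unfold bump cutoff; fun_prop) (strictMonoOn_lift hs₂q hqm.le hKpos hηpos hκ)
    have hwq : w q = b' q := by
      have := hκ q ⟨hs₂q.le, le_rfl⟩
      rw [sub_self, zero_smul, sub_eq_zero] at this
      exact this
    simp only [hstart, hwq, hend] at h1
    convert h1 using 1
    unfold strandGraph
    rw [Set.image_image]
    exact Set.image_congr fun z hz => by rw [he z hz, hΦ₃]
  refine isTopCone_of_strands (b := 2 * m - q) (w := b' q) (by linarith) ?_ ?_ ?_ ?_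
  · intro i
    fin_cases i
    · have h1 := isStrand_strandGraph (c := fun ζ => if ζ ≤ m then a' ζ else b' (2 * m - ζ))
        (a := s) (b := 2 * m - q) (by linarith) (Continuous.continuousOn (by
          refine Continuous.if_le ha'c (by fun_prop) continuous_id continuous_const ?_
          rintro x rfl
          simp [ha', hb', hμm, two_mul]))
      change IsStrand (Φ '' (strandGraph a s m ∪ strandGraph b q m)) _ _
      convert h1 using 1
      rw [← strandGraph_union hsm.le (by linarith : m ≤ 2 * m - q), Set.image_union]
      congr 1
      · refine image_strandGraph fun z hz => ?_
        rw [hΦa z hz]; simp only [if_pos hz.2]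
      · unfold strandGraph
        rw [Set.image_image]
        ext x
        constructor
        · rintro ⟨z, hz, rfl⟩
          refine ⟨2 * m - z, ⟨by linarith [hz.2], by linarith [hz.1]⟩, ?_⟩
          simp only
          rw [hΦb z ⟨hsq.le.trans hz.1, hz.2⟩, hΦ₃b z hz]
          split_ifs with h
          · have : z = m := by linarith [hz.2]
            subst this
            simp [ha', hb', hμm, two_mul]
          · simp
        · rintro ⟨z, hz, rfl⟩
          refine ⟨2 * m - z, ⟨by linarith [hz.2], by linarith [hz.1]⟩, ?_⟩
          simp only
          rw [hΦb _ ⟨by linarith [hz.2], by linarith [hz.1]⟩,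
            hΦ₃b _ ⟨by linarith [hz.2], by linarith [hz.1]⟩]
          split_ifs with h
          · have : z = m := by linarith [hz.1]
            subst this
            simp [ha', hb', hμm, two_mul]
          · simp
    · exact hstrand b b' _ hb'c.continuousOn hbκ fun z hz => hΦb z (hqm' z hz)
    · exact hstrand c c₂ _ hc₂c hcκ fun z _ => hΦc z
  · have hmem : ∀ u : ℂ, Φ (u, s) = (u, s) := fun u => hid _ le_rfl
    intro i
    have h1 : ∀ u : ℂ, (u, s) ∈ A i → (u, s) ∈ Φ '' A i := fun u hu => ⟨(u, s), hu, hmem u⟩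
    refine h1 _ ?_
    fin_cases i
    · exact Or.inl ⟨s, ⟨le_rfl, hsm.le⟩, rfl⟩
    · exact ⟨s, ⟨le_rfl, hsq.le⟩, rfl⟩
    · exact ⟨s, ⟨le_rfl, hsq.le⟩, rfl⟩
  · intro i
    rw [← htop]
    refine Set.mem_image_of_mem _ ?_
    fin_cases i
    · exact Or.inr ⟨q, hqI, rfl⟩
    · exact ⟨q, hqs, rfl⟩
    · exact ⟨q, hqs, by simp only [hcq]⟩
  · have h01 : ∀ x ∈ A 0, x ∈ A 1 → x = (b q, q) := by
      rintro x (⟨z, hz, rfl⟩ | ⟨z, hz, rfl⟩) ⟨z', hz', h⟩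
      · obtain ⟨h1, h2⟩ := Prod.mk.inj h
        subst h2
        exact absurd h1.symm (hab z' ⟨hz'.1, hz'.2.trans_lt hqm⟩)
      · obtain ⟨h1, h2⟩ := Prod.mk.inj h
        subst h2
        have : z' = q := le_antisymm hz'.2 hz.1
        rw [this]
    have h02 : ∀ x ∈ A 0, x ∈ A 2 → x = (b q, q) := by
      rintro x (⟨z, hz, rfl⟩ | ⟨z, hz, rfl⟩) ⟨z', hz', h⟩
      · obtain ⟨h1, h2⟩ := Prod.mk.inj h
        subst h2
        exact absurd h1 (hca z' hz')
      · obtain ⟨h1, h2⟩ := Prod.mk.inj h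
        subst h2
        have : z' = q := le_antisymm hz'.2 hz.1
        rw [this]
    have h12 : ∀ x ∈ A 1, x ∈ A 2 → x = (b q, q) := by
      rintro x ⟨z, hz, rfl⟩ ⟨z', hz', h⟩
      obtain ⟨h1, h2⟩ := Prod.mk.inj h
      subst h2
      rcases eq_or_lt_of_le hz.2 with h3 | h3
      · rw [h3]
      · exact absurd h1 (hcb z' ⟨hz.1, h3⟩)
    have hAA : ∀ i j, i ≠ j → ∀ x ∈ A i, x ∈ A j → x = (b q, q) := by
      intro i j hij x hi hj
      fin_cases i <;> fin_cases j <;> first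
        | exact absurd rfl hij
        | exact h01 x hi hj
        | exact h02 x hi hj
        | exact h12 x hi hj
        | exact h01 x hj hi
        | exact h02 x hj hi
        | exact h12 x hj hi
    rintro i j hij _ ⟨x, hx, rfl⟩ hx'
    rw [mem_image_iff_of_homeomorph] at hx'
    rw [hAA i j hij x hx hx', htop]

/-! ### Two cones form a standard theta graph -/

/-- Two distinct points have the same value of `re + ε * im` for at most one `ε`. An `ε` outside the
finitely many bad values is chosen, and the values are sorted. -/
theorem exists_sorted_direction {p : Fin 3 → ℂ} (hp : Function.Injective p) :
    ∃ (ε : ℝ) (e : Equiv.Perm (Fin 3)),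
      StrictMono fun i => (p (e i)).re + ε * (p (e i)).im := by
  have hfin : (⋃ x : Fin 3 × Fin 3, {ε : ℝ | x.1 ≠ x.2 ∧
      (p x.1).re + ε * (p x.1).im = (p x.2).re + ε * (p x.2).im}).Finite := by
    refine Set.finite_iUnion fun x => Set.Subsingleton.finite ?_
    rintro ε ⟨hne, h⟩ ε' ⟨-, h'⟩
    by_contra hε
    have h1 : (ε - ε') * ((p x.1).im - (p x.2).im) = 0 := by linarith
    have him : (p x.1).im = (p x.2).im :=
      sub_eq_zero.1 ((mul_eq_zero.1 h1).resolve_left (sub_ne_zero.2 hε))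
    rw [him] at h
    exact hne (hp (Complex.ext (add_right_cancel h) him))
  obtain ⟨ε, hε⟩ := hfin.exists_notMem
  have hinj : Function.Injective fun i => (p i).re + ε * (p i).im := by
    intro i j hij
    by_contra hne
    exact hε (Set.mem_iUnion.2 ⟨(i, j), hne, hij⟩)
  refine ⟨ε, Tuple.sort fun i => (p i).re + ε * (p i).im, ?_⟩
  exact (Tuple.monotone_sort fun i => (p i).re + ε * (p i).im).strictMono_of_injective
    (hinj.comp (Equiv.injective _))

/-- The reflection that reverses the levels of `ℂ × ℝ`. -/
def reflection : ℂ × ℝ ≃ₜ ℂ × ℝ := (Homeomorph.refl ℂ).prodCongr (Homeomorph.neg ℝ)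

@[simp] theorem reflection_apply (x : ℂ × ℝ) : reflection x = (x.1, -x.2) := rfl

@[simp] theorem reflection_symm_apply (x : ℂ × ℝ) : reflection.symm x = (x.1, -x.2) := rfl

theorem image_reflection_reflection (B : Set (ℂ × ℝ)) : reflection '' (reflection '' B) = B := by
  rw [Set.image_image]; simp

theorem image_reflection_strandGraph (c : ℝ → ℂ) (a b : ℝ) :
    reflection '' strandGraph (fun z => c (-z)) (-b) (-a) = strandGraph c a b := by
  unfold strandGraph
  rw [Set.image_image]
  ext x
  constructor
  · rintro ⟨z, hz, rfl⟩
    exact ⟨-z, ⟨by linarith [hz.2], by linarith [hz.1]⟩, rfl⟩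
  · rintro ⟨z, hz, rfl⟩
    exact ⟨-z, ⟨by linarith [hz.2], by linarith [hz.1]⟩, by simp⟩

/-- A circle with a diameter in a vertical plane. -/
def verticalTheta : Set (ℂ × ℝ) :=
  {x | x.1.im = 0 ∧ (x.1.re ^ 2 + x.2 ^ 2 = 1 ∨ (x.1.re = 0 ∧ |x.2| ≤ 1))}

/-- A linear map of `ℂ × ℝ` that preserves the horizontal planes. -/
def levelLinear (u h : ℂ) (l : ℝ) (hu : u ≠ 0) (hl : l ≠ 0) : (ℂ × ℝ) ≃L[ℝ] (ℂ × ℝ) :=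
  LinearEquiv.toContinuousLinearEquiv
    { toFun := fun x => (u * x.1 + x.2 • h, l * x.2)
      invFun := fun x => (u⁻¹ * (x.1 - (l⁻¹ * x.2) • h), l⁻¹ * x.2)
      map_add' := fun x y => by
        ext1
        · simp only [Prod.fst_add, Prod.snd_add, add_smul]; ring
        · simp only [Prod.snd_add]; ring
      map_smul' := fun r x => by
        ext1
        · simp only [Prod.smul_fst, Prod.smul_snd, smul_eq_mul, RingHom.id_apply, mul_smul,
            smul_add, mul_smul_comm]
        · simp only [Prod.smul_snd, smul_eq_mul, RingHom.id_apply]; ring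
      left_inv := fun x => by
        ext1
        · simp only [inv_mul_cancel_left₀ hl, add_sub_cancel_right, inv_mul_cancel_left₀ hu]
        · simp only [inv_mul_cancel_left₀ hl]
      right_inv := fun x => by
        ext1
        · simp only [mul_inv_cancel_left₀ hu, sub_add_cancel]
        · simp only [mul_inv_cancel_left₀ hl] }

@[simp] theorem levelLinear_apply (u h : ℂ) (l : ℝ) (hu : u ≠ 0) (hl : l ≠ 0) (x : ℂ × ℝ) :
    levelLinear u h l hu hl x = (u * x.1 + x.2 • h, l * x.2) := rfl

/-- The coefficients of the three strands of the standard theta graph. -/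
def strandCoeff (i : Fin 3) : ℝ := (i : ℝ) - 1

theorem strandCoeff_strictMono : StrictMono strandCoeff := by
  intro i j h
  unfold strandCoeff
  have : ((i : ℕ) : ℝ) < (j : ℕ) := by exact_mod_cast h
  linarith

/-- The strands of an affine image of the standard theta graph. -/
def standardStrand (v h u : ℂ) (m l : ℝ) (i : Fin 3) (z : ℝ) : ℂ :=
  v + ((z - m) / l) • h + (strandCoeff i * (l * √(1 - ((z - m) / l) ^ 2))) • u

/-- The coefficients `-1, 0, 1` give the two halves `∓√(1 - y ^ 2)` of the circle and the vertical
diameter. -/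
theorem iUnion_standardStrand (v h u : ℂ) (m : ℝ) {l : ℝ} (hl : 0 < l) (hu : u ≠ 0) :
    ⋃ i, strandGraph (standardStrand v h u m l i) (m - l) (m + l)
      = (fun x => (v, m) + levelLinear (l * u) h l
          (mul_ne_zero (Complex.ofReal_ne_zero.2 hl.ne') hu) hl.ne' x) '' verticalTheta := by
  have hkey : ∀ (k y : ℝ), ((v, m) : ℂ × ℝ) + levelLinear (l * u) h l
      (mul_ne_zero (Complex.ofReal_ne_zero.2 hl.ne') hu) hl.ne' (((k * √(1 - y ^ 2) : ℝ) : ℂ), y)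
      = (v + y • h + (k * (l * √(1 - y ^ 2))) • u, m + l * y) := by
    intro k y
    rw [levelLinear_apply]
    ext1
    · simp only [Prod.mk_add_mk, Complex.real_smul]; push_cast; ring
    · rfl
  ext x
  rw [Set.mem_iUnion]
  constructor
  · rintro ⟨i, z, hz, rfl⟩
    have hy : |(z - m) / l| ≤ 1 := by
      rw [abs_div, abs_of_pos hl, div_le_one hl, abs_le]
      constructor <;> linarith [hz.1, hz.2]
    have hy2 : ((z - m) / l) ^ 2 ≤ 1 := by rwa [sq_le_one_iff_abs_le_one]
    refine ⟨(((strandCoeff i * √(1 - ((z - m) / l) ^ 2) : ℝ) : ℂ), (z - m) / l),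
      ⟨Complex.ofReal_im _, ?_⟩, ?_⟩
    · simp only [Complex.ofReal_re]
      have hs := Real.sq_sqrt (sub_nonneg.2 hy2)
      fin_cases i
      · left; simp [strandCoeff, hs]
      · right; simp only [strandCoeff]; simpa using hy
      · left
        have : strandCoeff 2 = 1 := by simp [strandCoeff]; norm_num
        change (strandCoeff 2 * √(1 - ((z - m) / l) ^ 2)) ^ 2 + _ = 1
        rw [this, one_mul, hs]; ring
    · simp only
      rw [hkey]
      simp only [standardStrand, Prod.mk.injEq, true_and]
      field_simp
      ring
  · rintro ⟨⟨w, y⟩, ⟨him, hw⟩, rfl⟩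
    simp only at him hw
    obtain ⟨i, hi, hy⟩ : ∃ i, w = ((strandCoeff i * √(1 - y ^ 2) : ℝ) : ℂ) ∧ |y| ≤ 1 := by
      have hwre : w = (w.re : ℂ) := Complex.ext rfl (by simp [him])
      rcases hw with hw | ⟨hw, hy⟩
      · have hy : |y| ≤ 1 := by
          rw [← sq_le_one_iff_abs_le_one]; nlinarith [sq_nonneg w.re]
        have h1 : √(1 - y ^ 2) = |w.re| := by
          rw [← Real.sqrt_sq_eq_abs]; congr 1; linarith
        rcases le_total 0 w.re with h | h
        · refine ⟨2, ?_, hy⟩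
          have : strandCoeff 2 = 1 := by simp [strandCoeff]; norm_num
          rw [this, one_mul, h1, abs_of_nonneg h]; exact hwre
        · refine ⟨0, ?_, hy⟩
          have : strandCoeff 0 = -1 := by simp [strandCoeff]
          rw [this, h1, abs_of_nonpos h, neg_one_mul, neg_neg]; exact hwre
      · refine ⟨1, ?_, hy⟩
        rw [hwre, hw]; simp [strandCoeff]
    rw [abs_le] at hy
    refine ⟨i, m + l * y, ⟨by nlinarith, by nlinarith⟩, ?_⟩
    simp only
    rw [hi, hkey]
    have : (m + l * y - m) / l = y := by field_simp; ring
    simp only [standardStrand, this]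

/-- The interpolation between the points `p i` and the standard strands. -/
def blend (p : Fin 3 → ℂ) (d : Fin 3 → ℝ → ℂ) (t : ℝ → ℝ) (i : Fin 3) (z : ℝ) : ℂ :=
  (1 - t z) • p i + t z • d i z

/-- The functional `re + ε * im` takes the value `1 + ε ^ 2 > 0` on `⟨1, ε⟩`, so it orders the
standard strands in the same way as the points `p i`. Convex combinations keep this strict order. -/
theorem injective_blend {p : Fin 3 → ℂ} {ε : ℝ} {v h : ℂ} {m l : ℝ} (hl : 0 < l)
    (hp : StrictMono fun i => (p i).re + ε * (p i).im) {t : ℝ → ℝ} {z : ℝ} (h0 : 0 ≤ t z)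
    (h1 : t z ≤ 1) (hz : z ∈ Set.Ioo (m - l) (m + l)) :
    Function.Injective fun i => blend p (standardStrand v h ⟨1, ε⟩ m l) t i z := by
  have hy : |(z - m) / l| < 1 := by
    rw [abs_div, abs_of_pos hl, div_lt_one hl, abs_lt]
    constructor <;> linarith [hz.1, hz.2]
  have hy2 : ((z - m) / l) ^ 2 < 1 := by rwa [sq_lt_one_iff_abs_lt_one]
  have hs : 0 < l * √(1 - ((z - m) / l) ^ 2) := mul_pos hl (Real.sqrt_pos.2 (by linarith))
  have key : StrictMono fun i => (blend p (standardStrand v h ⟨1, ε⟩ m l) t i z).re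
      + ε * (blend p (standardStrand v h ⟨1, ε⟩ m l) t i z).im := by
    intro i j hij
    have e1 := hp hij
    have e2 := strandCoeff_strictMono hij
    simp only [blend, standardStrand, Complex.add_re, Complex.add_im, Complex.smul_re,
      Complex.smul_im, smul_eq_mul] at e1 ⊢
    set S := l * √(1 - ((z - m) / l) ^ 2)
    have e3 : 0 < (1 + ε ^ 2) * S * (strandCoeff j - strandCoeff i) := by
      have : 0 < strandCoeff j - strandCoeff i := by linarith
      positivity
    rcases eq_or_lt_of_le h0 with h | h
    · rw [← h]; linarith
    · have e4 : 0 ≤ (1 - t z) * ((p j).re + ε * (p j).im - ((p i).re + ε * (p i).im)) :=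
        mul_nonneg (by linarith) (by linarith)
      have e5 := mul_pos h e3
      linarith
  intro i j hij
  refine key.injective ?_
  simp only at hij ⊢
  rw [hij]

/-- Three strands above a level and three strands below it which fit together form a theta graph
which is isotopic to an affine image of the standard one. -/
theorem exists_isotopicToId_cones {s : ℝ} {p : Fin 3 → ℂ} {T B : Set (ℂ × ℝ)}
    (hT : IsTopCone s p T) (hB : IsTopCone (-s) p (reflection '' B)) :
    ∃ Φ : ℂ × ℝ ≃ₜ ℂ × ℝ, IsotopicToId Φ ∧ ∃ (v : ℂ × ℝ) (L : (ℂ × ℝ) ≃L[ℝ] (ℂ × ℝ)),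
      Φ '' (T ∪ B) = (fun x => v + L x) '' verticalTheta := by
  have hp : Function.Injective p := by
    obtain ⟨b, hb, c, -, h2, h3, -⟩ := hT
    have := h3 s ⟨le_rfl, hb⟩
    simpa only [h2] using this
  obtain ⟨ε, e, he⟩ := exists_sorted_direction hp
  have hT := hT.reindex e
  have hB := hB.reindex e
  have hBle : ∀ x ∈ B, x.2 ≤ s := fun x hx => by
    have := hB.le_snd (Set.mem_image_of_mem _ hx)
    simp only [reflection_apply] at this
    linarith
  change StrictMono fun i => ((p ∘ e) i).re + ε * ((p ∘ e) i).im at he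
  generalize p ∘ e = p at hT hB he
  obtain ⟨z₁, hz₁, c, hc, hcs, hci, hcz, hTc⟩ := hT
  obtain ⟨b₀, hb₀, c₀, hc₀, hc₀s, hc₀i, hc₀z, hBc⟩ := hB
  have hz₁ : s < z₁ := hz₁
  have hb₀ : -s < b₀ := hb₀
  -- `m` is the middle level and `l` half of the height of the whole graph.
  obtain ⟨m, l, hml, hml', hl⟩ : ∃ m l : ℝ, m + l = z₁ ∧ m - l = -b₀ ∧ 0 < l :=
    ⟨(z₁ - b₀) / 2, (z₁ + b₀) / 2, by ring, by ring, by linarith⟩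
  set u : ℂ := ⟨1, ε⟩ with hu
  have hu0 : u ≠ 0 := fun h => by simpa [hu] using congrArg Complex.re h
  set w₁ := c 0 z₁ with hw₁
  set w₀ := c₀ 0 b₀ with hw₀
  set D := standardStrand ((w₀ + w₁) / 2) ((w₁ - w₀) / 2) u m l with hD
  set δ : ℝ := min (z₁ - s) (s + b₀) / 2 with hδ
  have hδpos : 0 < δ := by
    have : 0 < min (z₁ - s) (s + b₀) := lt_min (by linarith) (by linarith)
    rw [hδ]; linarith
  have hδ1 : 2 * δ ≤ z₁ - s := by rw [hδ]; linarith [min_le_left (z₁ - s) (s + b₀)]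
  have hδ2 : 2 * δ ≤ s + b₀ := by rw [hδ]; linarith [min_le_right (z₁ - s) (s + b₀)]
  -- With this `t` the blended strands `E` pass through `p` at the level `s` and equal the standard
  -- strands `D` at distance at least `δ` from that level.
  set t : ℝ → ℝ := fun z => min 1 (|z - s| / δ) with ht
  have ht0 : ∀ z, 0 ≤ t z := fun z => le_min zero_le_one (by positivity)
  have ht1 : ∀ z, t z ≤ 1 := fun z => min_le_left _ _
  have hts : t s = 0 := by simp [ht]
  have htf : ∀ z, δ ≤ |z - s| → t z = 1 := fun z hz => by
    simp only [ht]; rw [min_eq_left]; rwa [one_le_div hδpos]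
  have htc : Continuous t := by simp only [ht]; fun_prop
  have hDc : ∀ i, Continuous (D i) := fun i => by simp only [hD]; unfold standardStrand; fun_prop
  set E := blend p D t with hE
  have hEc : ∀ i, Continuous (E i) := fun i => by
    have := hDc i
    simp only [hE]; unfold blend; fun_prop
  have hEs : ∀ i, E i s = p i := fun i => by simp [hE, blend, hts]
  have hED : ∀ i z, δ ≤ |z - s| → E i z = D i z := fun i z hz => by simp [hE, blend, htf z hz]
  have hDtop : ∀ i, D i z₁ = w₁ := fun i => by
    have : (z₁ - m) / l = 1 := by rw [← hml]; field_simp; ring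
    simp [hD, standardStrand, this]; ring
  have hDbot : ∀ i, D i (-b₀) = w₀ := fun i => by
    have : (-b₀ - m) / l = -1 := by rw [← hml']; field_simp; ring
    simp [hD, standardStrand, this]; ring
  have hEtop : ∀ i, E i z₁ = w₁ := fun i => by
    rw [hED i z₁ (by rw [abs_of_pos (by linarith)]; linarith), hDtop]
  have hEbot : ∀ i, E i (-b₀) = w₀ := fun i => by
    rw [hED i _ (by rw [abs_of_neg (by linarith)]; linarith), hDbot]
  have hEi : ∀ z ∈ Set.Ioo (-b₀) z₁, Function.Injective fun i => E i z := fun z hz =>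
    injective_blend hl he (ht0 z) (ht1 z) (by rwa [hml, hml'])
  have hDi : ∀ z ∈ Set.Ioo (-b₀) z₁, Function.Injective fun i => D i z := fun z hz => by
    have := injective_blend (v := (w₀ + w₁) / 2) (h := (w₁ - w₀) / 2) (t := fun _ => 1) hl he
      zero_le_one le_rfl (by rwa [hml, hml'])
    simpa [blend] using this
  -- The upper and lower cones are first moved onto `E` separately, each time fixing the other side
  -- of the level `s`. A third map moves `E` to `D`; it starts at `s - δ`, where both agree.
  obtain ⟨Φ₁, hI₁, -, hid₁, hΦ₁⟩ := exists_homeomorph_strands (c := c) (d := E) (w := w₁) hz₁ hc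
    (fun i => (hEc i).continuousOn) hci (fun z hz => hEi z ⟨by linarith [hz.1], hz.2⟩)
    (fun i => by rw [hcs, hEs]) (fun i => hcz i 0) hEtop
  obtain ⟨Ψ, hIΨ, -, hidΨ, hΨ⟩ := exists_homeomorph_strands (c := c₀)
    (d := fun i z => E i (-z)) (w := w₀) hb₀ hc₀
    (fun i => ((hEc i).comp continuous_neg).continuousOn) hc₀i
    (fun z hz => hEi (-z) ⟨by linarith [hz.2], by linarith [hz.1]⟩)
    (fun i => by simp only [neg_neg]; rw [hc₀s, hEs]) (fun i => hc₀z i 0) hEbot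
  obtain ⟨Φ₃, hI₃, -, hid₃, hΦ₃⟩ := exists_homeomorph_strands (c := E) (d := D) (w := w₁)
    (show s - δ < z₁ by linarith) (fun i => (hEc i).continuousOn) (fun i => (hDc i).continuousOn)
    (fun z hz => hEi z ⟨by linarith [hz.1], hz.2⟩) (fun z hz => hDi z ⟨by linarith [hz.1], hz.2⟩)
    (fun i => hED i _ (by simp [abs_of_pos hδpos])) hEtop hDtop
  set Φ₂ := (reflection.symm.trans Ψ).trans reflection with hΦ₂
  have hid₂ : ∀ x, s ≤ x.2 → Φ₂ x = x := fun x hx => by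
    simp only [hΦ₂, Homeomorph.trans_apply, reflection_symm_apply]
    rw [hidΨ (x.1, -x.2) (by simpa using hx)]
    simp
  refine ⟨(Φ₁.trans Φ₂).trans Φ₃, (hI₁.trans (hIΨ.conj reflection)).trans hI₃,
    ((w₀ + w₁) / 2, m), levelLinear (l * u) ((w₁ - w₀) / 2) l
      (mul_ne_zero (Complex.ofReal_ne_zero.2 hl.ne') hu0) hl.ne', ?_⟩
  rw [← iUnion_standardStrand _ _ _ _ hl hu0, hml, hml']
  have h1T : Φ₁ '' T = ⋃ i, strandGraph (E i) s z₁ := by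
    rw [hTc, Set.image_iUnion]
    exact Set.iUnion_congr fun i => image_strandGraph (hΦ₁ i)
  have h1B : Φ₁ '' B = B := image_eq_self_of_forall fun x hx => hid₁ x (hBle x hx)
  have h2T : Φ₂ '' ⋃ i, strandGraph (E i) s z₁ = ⋃ i, strandGraph (E i) s z₁ := by
    refine image_eq_self_of_forall fun x hx => hid₂ x ?_
    obtain ⟨i, z, hz, rfl⟩ := Set.mem_iUnion.1 hx
    exact hz.1
  have h2B : Φ₂ '' B = ⋃ i, strandGraph (E i) (-b₀) s := by
    have : Φ₂ '' B = reflection '' (Ψ '' (reflection '' B)) := by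
      rw [Set.image_image, Set.image_image]; rfl
    rw [this, hBc, Set.image_iUnion, Set.image_iUnion]
    refine Set.iUnion_congr fun i => ?_
    rw [image_strandGraph (hΨ i), ← image_reflection_strandGraph (E i) (-b₀) s, neg_neg]
  have h3 : ∀ i, Φ₃ '' strandGraph (E i) (-b₀) z₁ = strandGraph (D i) (-b₀) z₁ := fun i => by
    refine image_strandGraph fun z hz => ?_
    rcases le_total z (s - δ) with h | h
    · rw [hid₃ _ h, hED i z]
      rw [abs_of_nonpos (by linarith)]; linarith
    · exact hΦ₃ i z ⟨h, hz.2⟩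
  have hall : ((Φ₁.trans Φ₂).trans Φ₃) '' (T ∪ B) = Φ₃ '' (Φ₂ '' (Φ₁ '' (T ∪ B))) := by
    rw [Set.image_image, Set.image_image]; rfl
  rw [hall, Set.image_union, Set.image_union, h1T, h1B, h2T, h2B, ← Set.iUnion_union_distrib,
    Set.image_iUnion]
  refine Set.iUnion_congr fun i => ?_
  rw [Set.union_comm, strandGraph_union (by linarith) hz₁.le, h3]

/-! ### Theta graphs with one maximum and one minimum -/

theorem IsStrand.of_strictMonoOn {γ : I → ℂ × ℝ} (hγ : Continuous γ) {u v : I} (huv : u ≤ v)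
    (hm : StrictMonoOn (fun t => (γ t).2) (Set.Icc u v)) :
    IsStrand (γ '' Set.Icc u v) (γ u).2 (γ v).2 := by
  refine ⟨isCompact_Icc.image hγ, ?_, ?_⟩
  · rintro _ ⟨x, hx, rfl⟩ _ ⟨y, hy, rfl⟩ h
    rw [hm.injOn hx hy h]
  · rw [Set.image_image]
    refine Set.Subset.antisymm ?_
      (intermediate_value_Icc huv (continuous_snd.comp hγ).continuousOn)
    rintro _ ⟨z, hz, rfl⟩
    exact ⟨hm.monotoneOn (Set.left_mem_Icc.2 huv) hz hz.1,
      hm.monotoneOn hz (Set.right_mem_Icc.2 huv) hz.2⟩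

theorem IsStrand.of_strictAntiOn {γ : I → ℂ × ℝ} (hγ : Continuous γ) {u v : I} (huv : u ≤ v)
    (hm : StrictAntiOn (fun t => (γ t).2) (Set.Icc u v)) :
    IsStrand (γ '' Set.Icc u v) (γ v).2 (γ u).2 := by
  refine ⟨isCompact_Icc.image hγ, ?_, ?_⟩
  · rintro _ ⟨x, hx, rfl⟩ _ ⟨y, hy, rfl⟩ h
    rw [hm.injOn hx hy h]
  · rw [Set.image_image]
    refine Set.Subset.antisymm ?_
      (intermediate_value_Icc' huv (continuous_snd.comp hγ).continuousOn)
    rintro _ ⟨z, hz, rfl⟩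
    exact ⟨hm.antitoneOn hz (Set.right_mem_Icc.2 huv) hz.2,
      hm.antitoneOn (Set.left_mem_Icc.2 huv) hz hz.1⟩

theorem IsStrand.mem_Icc {A : Set (ℂ × ℝ)} {a b : ℝ} (h : IsStrand A a b) {x : ℂ × ℝ}
    (hx : x ∈ A) : x.2 ∈ Set.Icc a b := h.image_snd ▸ Set.mem_image_of_mem _ hx

theorem IsStrand.union {A B : Set (ℂ × ℝ)} {a b c : ℝ} (hA : IsStrand A a b)
    (hB : IsStrand B b c) (hab : a ≤ b) (hbc : b ≤ c) {x : ℂ × ℝ} (hxA : x ∈ A) (hxB : x ∈ B)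
    (hx : x.2 = b) : IsStrand (A ∪ B) a c := by
  refine ⟨hA.isCompact.union hB.isCompact, ?_, ?_⟩
  · have key : ∀ y ∈ A, ∀ z ∈ B, y.2 = z.2 → y = z := fun y hy z hz h => by
      have h1 := (hA.mem_Icc hy).2
      have h2 := (hB.mem_Icc hz).1
      rw [hA.injOn hy hxA (by linarith), hB.injOn hz hxB (by linarith)]
    rintro y (hy | hy) z (hz | hz) h
    · exact hA.injOn hy hz h
    · exact key y hy z hz h
    · exact (key z hz y hy h.symm).symm
    · exact hB.injOn hy hz h
  · rw [Set.image_union, hA.image_snd, hB.image_snd, Set.Icc_union_Icc_eq_Icc hab hbc]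

/-- Three curves from a common point down to the level `s`, each of which first increases and then
decreases, and at most one of which has an increasing part. -/
structure IsBranchedTop (γ : Fin 3 → I → ℂ × ℝ) (α τ : Fin 3 → I) (s : ℝ) : Prop where
  continuous : ∀ i, Continuous (γ i)
  eq_of_eq : ∀ i j a b, a ≤ τ i → b ≤ τ j → γ i a = γ j b → (i = j ∧ a = b) ∨ (a = 0 ∧ b = 0)
  zero_eq : ∀ i j, γ i 0 = γ j 0
  lt : ∀ i, α i < τ i
  strictMonoOn : ∀ i, StrictMonoOn (fun t => (γ i t).2) (Set.Icc 0 (α i))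
  strictAntiOn : ∀ i, StrictAntiOn (fun t => (γ i t).2) (Set.Icc (α i) (τ i))
  snd_eq : ∀ i, (γ i (τ i)).2 = s
  lt_snd : ∀ i, s < (γ i 0).2
  eq_zero : ∀ i j, i ≠ j → α i = 0 ∨ α j = 0

/-- The part of the three curves above the level `s`. -/
def branches (γ : Fin 3 → I → ℂ × ℝ) (τ : Fin 3 → I) : Set (ℂ × ℝ) :=
  ⋃ i, γ i '' Set.Icc 0 (τ i)

namespace IsBranchedTop

variable {γ : Fin 3 → I → ℂ × ℝ} {α τ : Fin 3 → I} {s : ℝ}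

theorem reindex (h : IsBranchedTop γ α τ s) (e : Equiv.Perm (Fin 3)) :
    IsBranchedTop (γ ∘ e) (α ∘ e) (τ ∘ e) s where
  continuous _ := h.continuous _
  eq_of_eq _ _ a b ha hb hab :=
    (h.eq_of_eq _ _ a b ha hb hab).imp_left fun h => ⟨e.injective h.1, h.2⟩
  zero_eq _ _ := h.zero_eq _ _
  lt _ := h.lt _
  strictMonoOn _ := h.strictMonoOn _
  strictAntiOn _ := h.strictAntiOn _
  snd_eq _ := h.snd_eq _
  lt_snd _ := h.lt_snd _
  eq_zero _ _ hij := h.eq_zero _ _ fun h => hij (e.injective h)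

theorem isStrand_down (h : IsBranchedTop γ α τ s) (i : Fin 3) :
    IsStrand (γ i '' Set.Icc (α i) (τ i)) s (γ i (α i)).2 :=
  h.snd_eq i ▸ IsStrand.of_strictAntiOn (h.continuous i) (h.lt i).le (h.strictAntiOn i)

theorem isStrand_up (h : IsBranchedTop γ α τ s) (i : Fin 3) :
    IsStrand (γ i '' Set.Icc 0 (α i)) (γ i 0).2 (γ i (α i)).2 :=
  IsStrand.of_strictMonoOn (h.continuous i) unitInterval.nonneg' (h.strictMonoOn i)

theorem le_snd (h : IsBranchedTop γ α τ s) {x : ℂ × ℝ} (hx : x ∈ branches γ τ) : s ≤ x.2 := by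
  obtain ⟨i, t, ht, rfl⟩ := Set.mem_iUnion.1 hx
  rcases le_total t (α i) with h1 | h1
  · exact (h.lt_snd i).le.trans ((h.strictMonoOn i).monotoneOn
      (Set.left_mem_Icc.2 unitInterval.nonneg') ⟨ht.1, h1⟩ ht.1)
  · exact ((h.isStrand_down i).mem_Icc (Set.mem_image_of_mem _ ⟨h1, ht.2⟩)).1

/-- Here edge 0 is the one that rises from the vertex. In `exists_turn_branch`, `a` is its
descending part, `b` is edge 1 continued through the vertex by the rising part of edge 0, and `c` is
edge 2. -/
theorem exists_isTopCone_of_ne_zero (h : IsBranchedTop γ α τ s) (h0 : α 0 ≠ 0) :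
    ∃ Φ : ℂ × ℝ ≃ₜ ℂ × ℝ, IsotopicToId Φ ∧ (∀ x, x.2 ≤ s → Φ x = x) ∧
      IsTopCone s (fun i => (γ i (τ i)).1) (Φ '' branches γ τ) := by
  have h1 : α 1 = 0 := (h.eq_zero 0 1 (by decide)).resolve_left h0
  have h2 : α 2 = 0 := (h.eq_zero 0 2 (by decide)).resolve_left h0
  have hpos : 0 < α 0 := unitInterval.pos_iff_ne_zero.2 h0
  have hz := h.zero_eq
  have hsq := h.lt_snd 0
  have hqm : (γ 0 0).2 < (γ 0 (α 0)).2 := h.strictMonoOn 0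
    (Set.left_mem_Icc.2 hpos.le) (Set.right_mem_Icc.2 hpos.le) hpos
  have hA := h.isStrand_down 0
  have hB1 := h.isStrand_down 1
  have hC := h.isStrand_down 2
  rw [h1, hz 1 0] at hB1
  rw [h2, hz 2 0] at hC
  have hB := hB1.union (h.isStrand_up 0) hsq.le hqm.le
    ⟨0, Set.left_mem_Icc.2 unitInterval.nonneg', hz 1 0⟩
    ⟨0, Set.left_mem_Icc.2 unitInterval.nonneg', rfl⟩ rfl
  obtain ⟨a, hac, hAe⟩ := hA.exists_strandGraph
  obtain ⟨b, hbc, hBe⟩ := hB.exists_strandGraph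
  obtain ⟨c, hcc, hCe⟩ := hC.exists_strandGraph
  have huniq : ∀ {c : ℝ → ℂ} {l m : ℝ} {x : ℂ × ℝ}, x ∈ strandGraph c l m → c x.2 = x.1 := by
    rintro c l m _ ⟨z, -, rfl⟩
    rfl
  have hmem : ∀ (c : ℝ → ℂ) {l m z : ℝ}, z ∈ Set.Icc l m → (c z, z) ∈ strandGraph c l m :=
    fun c {l m z} hz => ⟨z, hz, rfl⟩
  have hne : ∀ x ∈ γ 2 '' Set.Icc 0 (τ 2), ∀ y ∈ γ 0 '' Set.Icc (α 0) (τ 0), x ≠ y := by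
    rintro _ ⟨x, hx, rfl⟩ _ ⟨y, hy, rfl⟩ hxy
    rcases h.eq_of_eq 2 0 x y hx.2 hy.2 hxy with h' | h'
    · exact absurd h'.1 (by decide)
    · exact (hpos.trans_le hy.1).ne' h'.2
  have hm1 : γ 0 (α 0) ∈ strandGraph a s (γ 0 (α 0)).2 :=
    hAe ▸ Set.mem_image_of_mem _ (Set.left_mem_Icc.2 (h.lt 0).le)
  have hm2 : γ 0 (α 0) ∈ strandGraph b s (γ 0 (α 0)).2 :=
    hBe ▸ Or.inr (Set.mem_image_of_mem _ (Set.right_mem_Icc.2 hpos.le))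
  have hq1 : γ 0 0 ∈ strandGraph b s (γ 0 (α 0)).2 :=
    hBe ▸ Or.inr (Set.mem_image_of_mem _ (Set.left_mem_Icc.2 hpos.le))
  have hq2 : γ 0 0 ∈ strandGraph c s (γ 0 0).2 :=
    hCe ▸ ⟨0, Set.left_mem_Icc.2 unitInterval.nonneg', hz 2 0⟩
  have hab : ∀ z ∈ Set.Ico s (γ 0 (α 0)).2, a z ≠ b z := by
    intro z hz' hab
    have m1 := hmem a (Set.Ico_subset_Icc_self hz')
    have m2 := hmem b (Set.Ico_subset_Icc_self hz')
    rw [← hab, ← hBe] at m2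
    rw [← hAe] at m1
    obtain ⟨x, hx, hx'⟩ := m1
    rcases m2 with ⟨y, hy, hy'⟩ | ⟨y, hy, hy'⟩
    · rcases h.eq_of_eq 1 0 y x hy.2 hx.2 (hy'.trans hx'.symm) with h' | h'
      · exact absurd h'.1 (by decide)
      · exact (hpos.trans_le hx.1).ne' h'.2
    · rcases h.eq_of_eq 0 0 y x (hy.2.trans (h.lt 0).le) hx.2 (hy'.trans hx'.symm) with h' | h'
      · have : x = α 0 := le_antisymm (h'.2 ▸ hy.2) hx.1
        rw [this] at hx'
        exact hz'.2.ne (congrArg Prod.snd hx').symm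
      · exact (hpos.trans_le hx.1).ne' h'.2
  have hca : ∀ z ∈ Set.Icc s (γ 0 0).2, c z ≠ a z := by
    intro z hz' hca
    have m1 := hmem c hz'
    have m2 := hmem a ⟨hz'.1, hz'.2.trans hqm.le⟩
    rw [← hca, ← hAe] at m2
    rw [← hCe] at m1
    exact hne _ m1 _ m2 rfl
  have hcb : ∀ z ∈ Set.Ico s (γ 0 0).2, c z ≠ b z := by
    intro z hz' hcb
    have m1 := hmem c (Set.Ico_subset_Icc_self hz')
    have m2 := hmem b ⟨hz'.1, (hz'.2.trans hqm).le⟩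
    rw [← hcb, ← hBe] at m2
    rw [← hCe] at m1
    obtain ⟨x, hx, hx'⟩ := m1
    have key : x ≠ 0 := by
      rintro rfl
      rw [hz 2 0] at hx'
      exact hz'.2.ne (congrArg Prod.snd hx').symm
    rcases m2 with ⟨y, hy, hy'⟩ | ⟨y, hy, hy'⟩
    · rcases h.eq_of_eq 2 1 x y hx.2 hy.2 (hx'.trans hy'.symm) with h' | h'
      · exact absurd h'.1 (by decide)
      · exact key h'.1
    · rcases h.eq_of_eq 2 0 x y hx.2 (hy.2.trans (h.lt 0).le) (hx'.trans hy'.symm) with h' | h'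
      · exact absurd h'.1 (by decide)
      · exact key h'.1
  obtain ⟨Φ, hΦ, hfix, hcone⟩ := exists_turn_branch hsq hqm hac hbc hcc hab
    ((huniq hm1).trans (huniq hm2).symm) hca hcb ((huniq hq2).trans (huniq hq1).symm)
  refine ⟨Φ, hΦ, hfix, ?_⟩
  have e1 : (![a s, b s, c s] : Fin 3 → ℂ) = fun i => (γ i (τ i)).1 := by
    have g1 : γ 0 (τ 0) ∈ strandGraph a s (γ 0 (α 0)).2 :=
      hAe ▸ Set.mem_image_of_mem _ (Set.right_mem_Icc.2 (h.lt 0).le)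
    have g2 : γ 1 (τ 1) ∈ strandGraph b s (γ 0 (α 0)).2 :=
      hBe ▸ Or.inl (Set.mem_image_of_mem _ (Set.right_mem_Icc.2 unitInterval.nonneg'))
    have g3 : γ 2 (τ 2) ∈ strandGraph c s (γ 0 0).2 :=
      hCe ▸ Set.mem_image_of_mem _ (Set.right_mem_Icc.2 unitInterval.nonneg')
    have k1 := huniq g1
    have k2 := huniq g2
    have k3 := huniq g3
    rw [h.snd_eq] at k1 k2 k3
    ext i
    fin_cases i
    · exact k1
    · exact k2
    · exact k3
  have e2 : strandGraph a s (γ 0 (α 0)).2 ∪ strandGraph b s (γ 0 (α 0)).2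
      ∪ strandGraph c s (γ 0 0).2 = branches γ τ := by
    rw [← hAe, ← hBe, ← hCe, branches, iUnion_fin_three,
      ← Set.Icc_union_Icc_eq_Icc (unitInterval.nonneg' : 0 ≤ α 0) (h.lt 0).le, Set.image_union]
    ext x
    simp only [Set.mem_union]
    tauto
  rwa [e1, e2] at hcone

/-- If no edge rises at the vertex, the three edges are already strands; otherwise the rising one is
renumbered as edge 0. -/
theorem exists_isTopCone (h : IsBranchedTop γ α τ s) :
    ∃ Φ : ℂ × ℝ ≃ₜ ℂ × ℝ, IsotopicToId Φ ∧ (∀ x, x.2 ≤ s → Φ x = x) ∧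
      IsTopCone s (fun i => (γ i (τ i)).1) (Φ '' branches γ τ) := by
  by_cases h0 : ∃ i, α i ≠ 0
  · obtain ⟨i, hi⟩ := h0
    obtain ⟨Φ, h1, h2, h3⟩ := (h.reindex (Equiv.swap 0 i)).exists_isTopCone_of_ne_zero
      (by simpa using hi)
    refine ⟨Φ, h1, h2, ?_⟩
    have h4 := h3.reindex (Equiv.swap 0 i)
    have e1 : branches (γ ∘ Equiv.swap 0 i) (τ ∘ Equiv.swap 0 i) = branches γ τ :=
      (Equiv.swap 0 i).surjective.iUnion_comp fun i => γ i '' Set.Icc 0 (τ i)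
    rw [e1] at h4
    convert h4 using 1
    ext j
    simp
  · push Not at h0
    refine ⟨Homeomorph.refl _, ⟨fun _ => Homeomorph.refl _, continuous_snd, rfl, rfl⟩,
      fun x _ => rfl, ?_⟩
    rw [show ⇑(Homeomorph.refl (ℂ × ℝ)) = id from rfl, Set.image_id]
    have hS : ∀ i, IsStrand (γ i '' Set.Icc 0 (τ i)) s (γ 0 0).2 := fun i => by
      have := h.isStrand_down i
      rwa [h0 i, h.zero_eq i 0] at this
    refine isTopCone_of_strands (w := (γ 0 0).1) (h.lt_snd 0) hS (fun i => ?_) (fun i => ?_) ?_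
    · exact ⟨τ i, Set.right_mem_Icc.2 unitInterval.nonneg', Prod.ext rfl (h.snd_eq i)⟩
    · exact ⟨0, Set.left_mem_Icc.2 unitInterval.nonneg', h.zero_eq i 0⟩
    · rintro i j hij _ ⟨x, hx, rfl⟩ ⟨y, hy, hxy⟩
      rcases h.eq_of_eq j i y x hy.2 hx.2 hxy with h' | h'
      · exact absurd h'.1.symm hij
      · rw [h'.2, h.zero_eq i 0]

end IsBranchedTop

/-- A theta graph in space whose height function has the shape forced by the absence of four
crossings can be moved to an affine image of the standard one. -/
theorem exists_isotopicToId_image_range {g : Theta → ℂ × ℝ} (hg : Continuous g)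
    (hinj : Function.Injective g) (hpq : (g (edgePt 0 1)).2 < (g (edgePt 0 0)).2)
    {α β : Fin 3 → I} (hαβ : ∀ i, α i < β i)
    (h1 : ∀ i, StrictMonoOn (fun t => (g (edgePt i t)).2) (Set.Iic (α i)))
    (h2 : ∀ i, StrictAntiOn (fun t => (g (edgePt i t)).2) (Set.Icc (α i) (β i)))
    (h3 : ∀ i, StrictMonoOn (fun t => (g (edgePt i t)).2) (Set.Ici (β i)))
    (h4 : ∀ i j, i ≠ j → α i = 0 ∨ α j = 0) (h5 : ∀ i j, i ≠ j → β i = 1 ∨ β j = 1) :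
    ∃ Φ : ℂ × ℝ ≃ₜ ℂ × ℝ, IsotopicToId Φ ∧ ∃ (v : ℂ × ℝ) (L : (ℂ × ℝ) ≃L[ℝ] (ℂ × ℝ)),
      Φ '' Set.range g = (fun x => v + L x) '' verticalTheta := by
  -- The level halfway between the vertices meets each edge in its descending part, which separates
  -- the problem into an upper and a lower one.
  set s := ((g (edgePt 0 1)).2 + (g (edgePt 0 0)).2) / 2 with hs
  have hc : ∀ i, Continuous fun t => g (edgePt i t) := fun i => hg.comp (continuous_edgePt i)
  have hs0 : ∀ i, s < (g (edgePt i 0)).2 := fun i => by rw [edgePt_zero i 0]; linarith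
  have hs1 : ∀ i, (g (edgePt i 1)).2 < s := fun i => by rw [edgePt_one i 0]; linarith
  have hex : ∀ i, ∃ t ∈ Set.Icc (α i) (β i), (g (edgePt i t)).2 = s := fun i => by
    have k1 : (g (edgePt i 0)).2 ≤ (g (edgePt i (α i))).2 := (h1 i).monotoneOn
      (Set.mem_Iic.2 unitInterval.nonneg') (Set.mem_Iic.2 le_rfl) unitInterval.nonneg'
    have k2 : (g (edgePt i (β i))).2 ≤ (g (edgePt i 1)).2 := (h3 i).monotoneOn
      (Set.mem_Ici.2 le_rfl) (Set.mem_Ici.2 unitInterval.le_one') unitInterval.le_one'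
    exact intermediate_value_Icc' (hαβ i).le (continuous_snd.comp (hc i)).continuousOn
      ⟨k2.trans (hs1 i).le, (hs0 i).le.trans k1⟩
  choose τ hτ hτs using hex
  have hτ1 : ∀ i, α i < τ i := fun i => lt_of_le_of_ne (hτ i).1 fun h => by
    have k1 : (g (edgePt i 0)).2 ≤ (g (edgePt i (α i))).2 := (h1 i).monotoneOn
      (Set.mem_Iic.2 unitInterval.nonneg') (Set.mem_Iic.2 le_rfl) unitInterval.nonneg'
    rw [h, hτs] at k1
    linarith [hs0 i]
  have hτ2 : ∀ i, τ i < β i := fun i => lt_of_le_of_ne (hτ i).2 fun h => by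
    have k2 : (g (edgePt i (β i))).2 ≤ (g (edgePt i 1)).2 := (h3 i).monotoneOn
      (Set.mem_Ici.2 le_rfl) (Set.mem_Ici.2 unitInterval.le_one') unitInterval.le_one'
    rw [← h, hτs] at k2
    linarith [hs1 i]
  have hlt1 : ∀ i, τ i < 1 := fun i => (hτ2 i).trans_le unitInterval.le_one'
  have hgt0 : ∀ i, 0 < τ i := fun i => unitInterval.nonneg'.trans_lt (hτ1 i)
  have htop : IsBranchedTop (fun i t => g (edgePt i t)) α τ s :=
    { continuous := hc
      eq_of_eq := fun i j a b ha hb hab => by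
        rcases edgePt_eq_iff.1 (hinj hab) with h | h | h
        · exact Or.inl h
        · exact Or.inr h
        · exact absurd h.1 (ha.trans_lt (hlt1 i)).ne
      zero_eq := fun i j => by simp only [edgePt_zero i j]
      lt := hτ1
      strictMonoOn := fun i => (h1 i).mono Set.Icc_subset_Iic_self
      strictAntiOn := fun i => (h2 i).mono (Set.Icc_subset_Icc_right (hτ2 i).le)
      snd_eq := hτs
      lt_snd := hs0
      eq_zero := h4 }
  -- The lower part becomes an upper one after reflecting the levels and reversing the edges.
  have hbot : IsBranchedTop (fun i t => reflection (g (edgePt i (unitInterval.symm t))))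
      (fun i => unitInterval.symm (β i)) (fun i => unitInterval.symm (τ i)) (-s) :=
    { continuous := fun i => reflection.continuous.comp ((hc i).comp unitInterval.continuous_symm)
      eq_of_eq := fun i j a b ha hb hab => by
        rcases edgePt_eq_iff.1 (hinj (reflection.injective hab)) with h | h | h
        · exact Or.inl ⟨h.1, unitInterval.symm_inj.1 h.2⟩
        · rw [unitInterval.le_symm_comm, h.1] at ha
          exact absurd ha (hgt0 i).not_ge
        · exact Or.inr (by simpa using h)
      zero_eq := fun i j => by simp only [unitInterval.symm_zero, edgePt_one i j]
      lt := fun i => unitInterval.symm_lt_symm.2 (hτ2 i)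
      strictMonoOn := fun i x hx y hy hxy => by
        have := h3 i (a := unitInterval.symm y) (b := unitInterval.symm x)
          (unitInterval.le_symm_comm.1 hy.2) (unitInterval.le_symm_comm.1 hx.2)
          (unitInterval.symm_lt_symm.2 hxy)
        simpa using this
      strictAntiOn := fun i x hx y hy hxy => by
        have hmem : ∀ z ∈ Set.Icc (unitInterval.symm (β i)) (unitInterval.symm (τ i)),
            unitInterval.symm z ∈ Set.Icc (α i) (β i) := fun z hz =>
          ⟨(hτ1 i).le.trans (unitInterval.le_symm_comm.1 hz.2), unitInterval.symm_le_comm.1 hz.1⟩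
        have := h2 i (hmem y hy) (hmem x hx) (unitInterval.symm_lt_symm.2 hxy)
        simpa using this
      snd_eq := fun i => by simp [hτs]
      lt_snd := fun i => by simpa using hs1 i
      eq_zero := fun i j hij => by simpa using h5 i j hij }
  obtain ⟨Φ, hΦ, hΦfix, hT⟩ := htop.exists_isTopCone
  obtain ⟨Ψ, hΨ, hΨfix, hB⟩ := hbot.exists_isTopCone
  set T := branches (fun i t => g (edgePt i t)) τ with hTdef
  set B := branches (fun i t => reflection (g (edgePt i (unitInterval.symm t))))
    (fun i => unitInterval.symm (τ i)) with hBdef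
  set Ψ' := (reflection.symm.trans Ψ).trans reflection with hΨ'
  have hrange : Set.range g = T ∪ reflection '' B := by
    ext x
    constructor
    · rintro ⟨y, rfl⟩
      obtain ⟨⟨i, t⟩, rfl⟩ := Quotient.exists_rep y
      rcases le_total t (τ i) with h | h
      · exact Or.inl (Set.mem_iUnion.2 ⟨i, t, ⟨unitInterval.nonneg', h⟩, rfl⟩)
      · refine Or.inr ⟨reflection (g (edgePt i t)), Set.mem_iUnion.2 ⟨i, unitInterval.symm t,
          ⟨unitInterval.nonneg', unitInterval.symm_le_symm.2 h⟩, by simp⟩, by simp [edgePt]⟩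
    · rintro (hx | ⟨y, hy, rfl⟩)
      · obtain ⟨i, t, -, rfl⟩ := Set.mem_iUnion.1 hx
        exact Set.mem_range_self _
      · obtain ⟨i, t, -, rfl⟩ := Set.mem_iUnion.1 hy
        simp
  have hfix : ∀ x, s ≤ x.2 → Ψ' x = x := fun x hx => by
    have : Ψ (reflection x) = reflection x := hΨfix _ (by simpa using hx)
    simp only [hΨ', Homeomorph.trans_apply]
    have e : reflection.symm x = reflection x := rfl
    rw [e, this]
    simp
  have e1 : Ψ' '' (Φ '' T) = Φ '' T := image_eq_self_of_forall fun x hx => hfix x (hT.le_snd hx)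
  have e2 : Φ '' (reflection '' B) = reflection '' B := by
    refine image_eq_self_of_forall fun x hx => hΦfix x ?_
    obtain ⟨y, hy, rfl⟩ := hx
    have := hbot.le_snd hy
    simp only [reflection_apply]
    linarith
  have e3 : Ψ' '' (reflection '' B) = reflection '' (Ψ '' B) := by
    simp only [hΨ', Set.image_image]
    refine Set.image_congr fun x _ => ?_
    simp
  have hB' : IsTopCone (-s) (fun i => (g (edgePt i (τ i))).1)
      (reflection '' (Ψ' '' (reflection '' B))) := by
    rw [e3, image_reflection_reflection]
    simpa using hB
  obtain ⟨Θ, hΘ, v, L, hL⟩ := exists_isotopicToId_cones hT hB'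
  refine ⟨(Φ.trans Ψ').trans Θ, (hΦ.trans (hΨ.conj reflection)).trans hΘ, v, L, ?_⟩
  rw [← hL, hrange]
  have e4 : ∀ A : Set (ℂ × ℝ), ((Φ.trans Ψ').trans Θ) '' A = Θ '' (Ψ' '' (Φ '' A)) := fun A => by
    simp only [Set.image_image]
    rfl
  rw [e4, Set.image_union, e2, Set.image_union, e1]

/-! ### Theta graphs of net total curvature less than `4π` -/

/-- Although `above` is not symmetric, chain points avoid the level, so negation exchanges its
values `0` and `1`. -/
theorem FourCrossing.neg {h : Theta → ℝ} {c : ℝ} (H : FourCrossing (fun x => -h x) c) :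
    FourCrossing h (-c) := by
  obtain ⟨τ, h1, h2, h3, h4, h5⟩ := H
  have hne : ∀ i j, h (edgePt i (τ i j)) ≠ -c := fun i j hij => h4 i j (by simp [hij])
  refine ⟨τ, h1, h2, h3, hne, h5.trans_eq ?_⟩
  have key : ∀ i j, above c (-h (edgePt i (τ i j))) = 1 - above (-c) (h (edgePt i (τ i j))) := by
    intro i j
    rcases (hne i j).lt_or_gt with hlt | hlt
    · rw [above_of_lt (by linarith), above_of_le hlt.le, sub_zero]
    · rw [above_of_le (by linarith), above_of_lt hlt, sub_self]
  refine Finset.sum_congr rfl fun i _ => Finset.sum_congr rfl fun j _ => ?_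
  rw [key, key, sub_sub_sub_cancel_left, abs_sub_comm]

/-- Cyclic coordinates on space: the first coordinate is the height. -/
def spaceEquiv : E3 ≃L[ℝ] ℂ × ℝ :=
  LinearEquiv.toContinuousLinearEquiv
    { toFun := fun x => (⟨x 1, x 2⟩, x 0)
      invFun := fun x => !₂[x.2, x.1.re, x.1.im]
      map_add' := fun x y => Prod.ext (Complex.ext rfl rfl) rfl
      map_smul' := fun c x => Prod.ext (Complex.ext (by simp) (by simp)) (by simp)
      left_inv := fun x => by
        ext i
        fin_cases i <;> rfl
      right_inv := fun x => rfl }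

theorem spaceEquiv_apply (x : E3) : spaceEquiv x = (⟨x 1, x 2⟩, x 0) := rfl

theorem image_spaceEquiv_standardTheta : spaceEquiv '' standardTheta = verticalTheta := by
  have key : ∀ x : E3, x ∈ standardTheta ↔ spaceEquiv x ∈ verticalTheta := fun x => by
    rw [mem_standardTheta, spaceEquiv_apply, verticalTheta]
    simp only [Set.mem_ofPred_eq]
    constructor
    · rintro (⟨h1, h2⟩ | ⟨h1, h2, h3⟩)
      · exact ⟨h2, Or.inl (by linarith)⟩
      · exact ⟨h3, Or.inr ⟨h2, h1⟩⟩
    · rintro ⟨h1, h2 | ⟨h2, h3⟩⟩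
      · exact Or.inl ⟨by linarith, h1⟩
      · exact Or.inr ⟨h3, h2, h1⟩
  ext y
  constructor
  · rintro ⟨x, hx, rfl⟩
    exact (key x).1 hx
  · intro hy
    exact ⟨spaceEquiv.symm y, (key _).2 (by simpa using hy), by simp⟩

theorem exists_equiv_snd_eq_inner {e : E3} (he : ‖e‖ = 1) :
    ∃ M : E3 ≃L[ℝ] ℂ × ℝ, ∀ x, (M x).2 = inner ℝ x e := by
  have ho : Orthonormal ℝ (({0} : Set (Fin 3)).domRestrict fun _ => e) := by
    constructor
    · intro i
      exact he
    · intro i j hij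
      exact absurd (Subsingleton.elim i j) hij
  obtain ⟨b, hb⟩ := ho.exists_orthonormalBasis_extension_of_card_eq (by simp)
  refine ⟨b.repr.toContinuousLinearEquiv.trans spaceEquiv, fun x => ?_⟩
  have h0 : b 0 = e := hb 0 rfl
  rw [real_inner_comm, ← h0]
  exact b.repr_apply_apply x 0

/-- Directions in which the vertices, and the points of a dense subset of every edge, have different
heights. -/
def IsGeneric (f : Theta → E3) (D : Set I) (e : E3) : Prop :=
  inner ℝ (f (edgePt 0 0)) e ≠ inner ℝ (f (edgePt 0 1)) e ∧
    ∀ i, ∀ a ∈ D, ∀ b ∈ D, a ≠ b →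
      inner ℝ (f (edgePt i a)) e ≠ inner ℝ (f (edgePt i b)) e ∨ edgePt i a = edgePt i b

theorem ae_isGeneric {f : Theta → E3} (hf : Function.Injective f) {D : Set I}
    (hD : D.Countable) :
    ∀ᵐ e : Metric.sphere (0 : E3) 1 ∂((volume : Measure E3).toSphere), IsGeneric f D e := by
  refine (ae_inner_ne fun h => ?_).and (ae_all_iff.2 fun i => (ae_ball_iff hD).2 fun a _ =>
    (ae_ball_iff hD).2 fun b _ => ?_)
  · rcases edgePt_eq_iff.1 (hf h) with h' | h' | h'
    · exact zero_ne_one h'.2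
    · exact one_ne_zero h'.2
    · exact zero_ne_one h'.1
  · by_cases hab : f (edgePt i a) = f (edgePt i b)
    · exact Eventually.of_forall fun e _ => Or.inr (hf hab)
    · exact (ae_inner_ne hab).mono fun e he _ => Or.inl he

theorem exists_isotopicToId_of_direction {f : Theta → E3} (hf : Continuous f)
    (hinj : Function.Injective f) {D : Set I} (hD : Dense D) {e : E3} (he : ‖e‖ = 1)
    (hgen : IsGeneric f D e) (H : ∀ c, ¬ FourCrossing (fun x => inner ℝ (f x) e) c)
    (hlt : inner ℝ (f (edgePt 0 1)) e < inner ℝ (f (edgePt 0 0)) e) :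
    ∃ Φ : E3 ≃ₜ E3, IsotopicToId Φ ∧ Φ '' Set.range f = standardTheta := by
  obtain ⟨M, hM⟩ := exists_equiv_snd_eq_inner he
  have hcont : Continuous fun x => inner ℝ (f x) e := hf.inner continuous_const
  obtain ⟨α, β, h1, h2, h3, h4, h5, h6⟩ := (noFourCrossing_of_forall H).exists_pieces hcont hlt
    -- Two points of the dense set between `a` and `b` have different heights, so the height is not
    -- constant on any interval.
    (fun i a b hab => by
      obtain ⟨r, hr, har, hrb⟩ := hD.exists_between hab
      obtain ⟨s, hs, hrs, hsb⟩ := hD.exists_between hrb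
      refine ⟨r, s, har.le, hrb.le, (har.trans hrs).le, hsb.le, ?_⟩
      refine (hgen.2 i r hr s hs hrs.ne).resolve_right fun h => ?_
      rcases edgePt_eq_iff.1 h with h' | h' | h'
      · exact hrs.ne h'.2
      · exact (unitInterval.nonneg'.trans_lt har).ne' h'.1
      · exact (hsb.trans_le unitInterval.le_one').ne h'.2)
  have hMf : ∀ x, (M (f x)).2 = inner ℝ (f x) e := fun x => hM _
  obtain ⟨Φ, hΦ, v, A, hA⟩ := exists_isotopicToId_image_range (g := fun x => M (f x))
    (M.continuous.comp hf) (M.injective.comp hinj) (by simpa only [hMf] using hlt) h1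
    (by simpa only [hMf] using h2) (by simpa only [hMf] using h3) (by simpa only [hMf] using h4)
    h5 h6
  obtain ⟨Ψ, hΨ, hst⟩ := exists_isotopicToId_image_standardTheta
    ((spaceEquiv.trans A).trans M.symm)
  set N := M.symm.toHomeomorph with hN
  refine ⟨(((N.symm.trans Φ).trans N).trans (Homeomorph.addRight (-(M.symm v)))).trans Ψ,
    ((hΦ.conj N).trans (isotopicToId_addRight _)).trans hΨ, ?_⟩
  rw [← hst]
  have e1 : Φ '' Set.range (fun x => M (f x))
      = (fun x => v + A x) '' (spaceEquiv '' standardTheta) := by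
    rw [image_spaceEquiv_standardTheta, hA]
  rw [← Set.range_comp] at e1 ⊢
  have e2 : ((((N.symm.trans Φ).trans N).trans (Homeomorph.addRight (-(M.symm v)))).trans Ψ) ∘ f
      = fun x => Ψ (M.symm (Φ (M (f x))) - M.symm v) := by
    ext1 x
    simp [hN, sub_eq_add_neg]
  rw [e2]
  have e3 : Set.range (fun x => Ψ (M.symm (Φ (M (f x))) - M.symm v))
      = (fun y => Ψ (M.symm y - M.symm v)) '' Set.range (Φ ∘ fun x => M (f x)) := by
    rw [← Set.range_comp]
    rfl
  rw [e3, e1]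
  simp only [Set.image_image]
  refine Set.image_congr fun x _ => ?_
  simp

theorem ambientIsotopic_of_lt_four_pi {f : Theta → E3} (hf : Continuous f)
    (hinj : Function.Injective f) (h : netTotalCurvature f < ENNReal.ofReal (4 * Real.pi)) :
    AmbientIsotopic (Set.range f) standardTheta := by
  obtain ⟨D, hDc, hD⟩ := TopologicalSpace.exists_countable_dense I
  obtain ⟨e, hgen, H⟩ := exists_direction_of_lt_four_pi hf h (ae_isGeneric hinj hDc)
  have he : ‖(e : E3)‖ = 1 := norm_eq_of_mem_sphere e
  suffices hs : ∃ Φ : E3 ≃ₜ E3, IsotopicToId Φ ∧ Φ '' Set.range f = standardTheta by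
    obtain ⟨Φ, ⟨K, h1, h2, h3⟩, hΦ⟩ := hs
    exact ⟨K, h1, h2, by rw [h3, hΦ]⟩
  -- Replacing `e` by `-e` makes the first vertex the higher one.
  rcases hgen.1.lt_or_gt with hlt | hlt
  · refine exists_isotopicToId_of_direction hf hinj hD (e := -e) (by simp) ?_ ?_ ?_
    · simpa [IsGeneric] using hgen
    · intro c hc
      refine H (-c) (FourCrossing.neg ?_)
      simpa using hc
    · simpa using hlt
  · exact exists_isotopicToId_of_direction hf hinj hD he hgen H hlt

/-! ### Polygonal sums of functions with few level crossings -/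

theorem sum_range_ite_sub (w : ℕ → ℝ) {m N : ℕ} (h : m ≤ N) :
    ∑ k ∈ Finset.range N, (if m ≤ k then w k - w (k + 1) else 0) = w m - w N := by
  induction N, h using Nat.le_induction with
  | base =>
    rw [sub_self]
    refine Finset.sum_eq_zero fun k hk => ?_
    rw [if_neg (by simpa using hk)]
  | succ N hN ih => rw [Finset.sum_range_succ, ih, if_pos hN]; ring

theorem sum_mem_Icc_of_subsingleton_support {a : Fin 3 → ℝ} {l u : ℝ} (hl : l ≤ 0) (hu : 0 ≤ u)
    (ha : ∀ i, a i ∈ Set.Icc l u) (h : ∀ i j, i ≠ j → a i = 0 ∨ a j = 0) :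
    ∑ i, a i ∈ Set.Icc l u := by
  rw [Fin.sum_univ_three]
  have h1 := ha 0
  have h2 := ha 1
  have h3 := ha 2
  rcases h 0 1 (by decide) with e1 | e1 <;> rcases h 0 2 (by decide) with e2 | e2 <;>
    rcases h 1 2 (by decide) with e3 | e3 <;> simp_all

theorem heightSign_of_lt {a b : ℝ} (h : a < b) : heightSign a b = -1 := if_pos h

theorem heightSign_of_gt {a b : ℝ} (h : b < a) : heightSign a b = 1 := if_neg h.not_gt

/-- The indicator of the positive numbers. -/
def posInd (d : ℝ) : ℝ := if 0 < d then 1 else 0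

theorem posInd_mem (d : ℝ) : posInd d ∈ Set.Icc (0 : ℝ) 1 := by
  unfold posInd; split_ifs <;> simp

theorem max_zero_eq (d : ℝ) : max 0 d = posInd d * d := by
  unfold posInd
  split_ifs with h
  · rw [max_eq_right h.le, one_mul]
  · rw [max_eq_left (not_lt.1 h), zero_mul]

/-- A positive part is the number itself times a weight `0` or `1`. The weights agree on the three
edges at a common vertex, so the count becomes a sum over edges. -/
theorem exists_weights (n : Fin 3 → ℕ) (x : Fin 3 → ℕ → ℝ) :
    ∃ (p q : ℝ) (ω : Fin 3 → ℕ → ℝ), (∀ i k, ω i k ∈ Set.Icc (0 : ℝ) 1) ∧ (∀ i, ω i 0 = p) ∧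
      (∀ i, ω i (n i + 1) = q) ∧
      polySum n x = ∑ i, ∑ k ∈ Finset.range (n i + 1),
        (ω i k * heightSign (x i k) (x i (k + 1))
          + ω i (k + 1) * heightSign (x i (k + 1)) (x i k)) := by
  set p := posInd (∑ i, heightSign (x i 0) (x i 1)) with hp
  set q := posInd (∑ i, heightSign (x i (n i + 1)) (x i (n i))) with hq
  set ω : Fin 3 → ℕ → ℝ := fun i k => if k = 0 then p else if k = n i + 1 then q else
    posInd (heightSign (x i k) (x i (k - 1)) + heightSign (x i k) (x i (k + 1))) with hω
  have h0 : ∀ i, ω i 0 = p := fun i => by simp [hω]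
  have h1 : ∀ i, ω i (n i + 1) = q := fun i => by simp [hω]
  refine ⟨p, q, ω, fun i k => ?_, h0, h1, ?_⟩
  · simp only [hω]
    split_ifs <;> exact posInd_mem _
  · have h2 : ∀ i, ∑ k ∈ Finset.range (n i),
        max 0 (heightSign (x i (k + 1)) (x i k) + heightSign (x i (k + 1)) (x i (k + 2)))
        = ∑ k ∈ Finset.range (n i), ω i (k + 1) *
          (heightSign (x i (k + 1)) (x i k) + heightSign (x i (k + 1)) (x i (k + 2))) := by
      intro i
      refine Finset.sum_congr rfl fun k hk => ?_
      have hk' : k ≠ n i := (Finset.mem_range.1 hk).ne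
      rw [max_zero_eq]
      simp [hω, hk']
    unfold polySum
    rw [max_zero_eq, max_zero_eq, ← hp, ← hq, Finset.mul_sum, Finset.mul_sum,
      ← Finset.sum_add_distrib, ← Finset.sum_add_distrib]
    refine Finset.sum_congr rfl fun i _ => ?_
    rw [h2, ← sum_weighted_signs (fun k => heightSign (x i k) (x i (k + 1)))
      (fun k => heightSign (x i (k + 1)) (x i k)) (ω i) (n i), h0, h1]

/-- The contribution of an edge along which the heights go up, down and up. -/
theorem sum_edge_of_pieces {ε : ℝ} {n α β : ℕ} {x w : ℕ → ℝ} (hαβ : α < β) (hβ : β ≤ n + 1)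
    (h1 : ∀ k, k < α → heightSign (x k) (x (k + 1)) = -ε ∧ heightSign (x (k + 1)) (x k) = ε)
    (h2 : ∀ k, α ≤ k → k < β →
      heightSign (x k) (x (k + 1)) = ε ∧ heightSign (x (k + 1)) (x k) = -ε)
    (h3 : ∀ k, β ≤ k → k < n + 1 →
      heightSign (x k) (x (k + 1)) = -ε ∧ heightSign (x (k + 1)) (x k) = ε) :
    ∑ k ∈ Finset.range (n + 1), (w k * heightSign (x k) (x (k + 1))
        + w (k + 1) * heightSign (x (k + 1)) (x k))
      = ε * (-w 0 + 2 * w α - 2 * w β + w (n + 1)) := by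
  have key : ∀ k ∈ Finset.range (n + 1), w k * heightSign (x k) (x (k + 1))
        + w (k + 1) * heightSign (x (k + 1)) (x k)
      = ε * (-(if 0 ≤ k then w k - w (k + 1) else 0)
        + 2 * (if α ≤ k then w k - w (k + 1) else 0)
        - 2 * (if β ≤ k then w k - w (k + 1) else 0)) := by
    intro k hk
    rw [Finset.mem_range] at hk
    rcases lt_or_ge k α with h | h
    · rw [(h1 k h).1, (h1 k h).2, if_pos (Nat.zero_le k), if_neg (by omega), if_neg (by omega)]
      ring
    rcases lt_or_ge k β with h' | h'
    · rw [(h2 k h h').1, (h2 k h h').2, if_pos (Nat.zero_le k), if_pos h, if_neg (by omega)]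
      ring
    · rw [(h3 k h' hk).1, (h3 k h' hk).2, if_pos (Nat.zero_le k), if_pos h, if_pos h']
      ring
  rw [Finset.sum_congr rfl key, ← Finset.mul_sum, Finset.sum_sub_distrib, Finset.sum_add_distrib,
    Finset.sum_neg_distrib, ← Finset.mul_sum, ← Finset.mul_sum,
    sum_range_ite_sub w (Nat.zero_le _), sum_range_ite_sub w (hαβ.le.trans hβ),
    sum_range_ite_sub w hβ]
  ring

/-- By `sum_edge_of_pieces` the count is `ε * (3 * p - 3 * q + 2 * A + 2 * B)`, where `A` sums `ω i
(α i) - p` and `B` sums `q - ω i (β i)`. At most one term of each sum is nonzero, so `A` lies in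
`[-p, 1 - p]` and `B` in `[q - 1, q]`; for either sign the bound is `2 + |p - q| ≤ 3`. -/
theorem polySum_le_three_of_pieces {ε : ℝ} (hε : ε = 1 ∨ ε = -1) {n α β : Fin 3 → ℕ}
    {x : Fin 3 → ℕ → ℝ} (hαβ : ∀ i, α i < β i) (hβ : ∀ i, β i ≤ n i + 1)
    (h1 : ∀ i k, k < α i →
      heightSign (x i k) (x i (k + 1)) = -ε ∧ heightSign (x i (k + 1)) (x i k) = ε)
    (h2 : ∀ i k, α i ≤ k → k < β i →
      heightSign (x i k) (x i (k + 1)) = ε ∧ heightSign (x i (k + 1)) (x i k) = -ε)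
    (h3 : ∀ i k, β i ≤ k → k < n i + 1 →
      heightSign (x i k) (x i (k + 1)) = -ε ∧ heightSign (x i (k + 1)) (x i k) = ε)
    (hα0 : ∀ i j, i ≠ j → α i = 0 ∨ α j = 0)
    (hβn : ∀ i j, i ≠ j → β i = n i + 1 ∨ β j = n j + 1) : polySum n x ≤ 3 := by
  obtain ⟨p, q, ω, hω, hp, hq, hsum⟩ := exists_weights n x
  rw [hsum, Finset.sum_congr rfl fun i _ =>
    sum_edge_of_pieces (w := ω i) (hαβ i) (hβ i) (h1 i) (h2 i) (h3 i)]
  have hp1 : p ∈ Set.Icc (0 : ℝ) 1 := hp 0 ▸ hω 0 0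
  have hq1 : q ∈ Set.Icc (0 : ℝ) 1 := hq 0 ▸ hω 0 (n 0 + 1)
  have ha := sum_mem_Icc_of_subsingleton_support (a := fun i => ω i (α i) - p) (l := -p)
    (u := 1 - p) (by linarith [hp1.1]) (by linarith [hp1.2])
    (fun i => ⟨by linarith [(hω i (α i)).1], by linarith [(hω i (α i)).2]⟩)
    (fun i j hij => (hα0 i j hij).imp (fun h => by simp only [h, hp, sub_self])
      (fun h => by simp only [h, hp, sub_self]))
  have hb := sum_mem_Icc_of_subsingleton_support (a := fun i => q - ω i (β i)) (l := q - 1)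
    (u := q) (by linarith [hq1.2]) hq1.1
    (fun i => ⟨by linarith [(hω i (β i)).2], by linarith [(hω i (β i)).1]⟩)
    (fun i j hij => (hβn i j hij).imp (fun h => by simp only [h, hq, sub_self])
      (fun h => by simp only [h, hq, sub_self]))
  simp only [Fin.sum_univ_three, Set.mem_Icc, hp, hq] at ha hb ⊢
  rcases hε with rfl | rfl <;> linarith [hp1.1, hp1.2, hq1.1, hq1.2]

/-- The pieces are found on the finite set of nodes. The sign `ε` covers directions in which the
second vertex is the higher one, where `h` is the negated height. -/
theorem NoFourCrossing.polySum_le_three {h : Theta → ℝ} (H : NoFourCrossing h)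
    (hpq : h (edgePt 0 1) < h (edgePt 0 0)) (S : Fin 3 → Subdivision)
    (hinj : ∀ i, Function.Injective fun k => h (edgePt i ((S i).node k))) {ε : ℝ}
    (hε : ε = 1 ∨ ε = -1) {x : Fin 3 → ℕ → ℝ}
    (hx : ∀ i k, x i k = ε * h (edgePt i ((S i).nodeNat k))) :
    polySum (fun i => (S i).n) x ≤ 3 := by
  set g : ∀ i, Fin ((S i).n + 2) → ℝ := fun i k => h (edgePt i ((S i).node k)) with hg
  have hmax : ∀ i, ∃ α, ∀ t, g i t ≤ g i α := fun i => Finite.exists_max (g i)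
  have hmin : ∀ i, ∃ β, ∀ t, g i β ≤ g i t := fun i => Finite.exists_min (g i)
  choose α hα using hmax
  choose β hβ using hmin
  have g0 : ∀ i, g i 0 = h (edgePt 0 0) := fun i => by
    simp only [hg]; rw [(S i).node_zero, edgePt_zero i 0]
  have g1 : ∀ i, g i (Fin.last _) = h (edgePt 0 1) := fun i => by
    simp only [hg]; rw [(S i).node_last, edgePt_one i 0]
  have hp := fun i => monotone_pieces (g := g i) (z := 0) (o := Fin.last _) Fin.zero_le Fin.le_last
    (by rwa [g0, g1]) (hα i) (hβ i) fun a b c d hab hbc hcd =>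
      H.not_down_up_down hpq i _ _ _ _ ((S i).strictMono hab) ((S i).strictMono hbc)
        ((S i).strictMono hcd)
  have hnode : ∀ i (k : Fin ((S i).n + 2)), (S i).nodeNat k = (S i).node k := fun i k => by
    unfold Subdivision.nodeNat
    congr 1
    ext
    simp only [inf_eq_left]
    omega
  have hxg : ∀ i (k : Fin ((S i).n + 2)), x i k = ε * g i k := fun i k => by rw [hx, hnode]
  have hup : ∀ i (k l : Fin ((S i).n + 2)), k ≠ l → g i k ≤ g i l →
      heightSign (x i k) (x i l) = -ε ∧ heightSign (x i l) (x i k) = ε := by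
    intro i k l hkl hle
    have hlt : g i k < g i l := lt_of_le_of_ne hle fun h => hkl (hinj i h)
    rw [hxg, hxg]
    rcases hε with rfl | rfl
    · exact ⟨heightSign_of_lt (by linarith), heightSign_of_gt (by linarith)⟩
    · exact ⟨(heightSign_of_gt (by linarith)).trans (by norm_num),
        heightSign_of_lt (by linarith)⟩
  have hne : ∀ m (k : ℕ) (h1 : k < m + 2) (h2 : k + 1 < m + 2),
      (⟨k, h1⟩ : Fin (m + 2)) ≠ ⟨k + 1, h2⟩ := fun m k h1 h2 h => by
    have := congrArg Fin.val h
    simp at this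
  refine polySum_le_three_of_pieces hε (α := fun i => α i) (β := fun i => β i)
    (fun i => (hp i).1) (fun i => by have := (β i).2; omega) (fun i k hk => ?_)
    (fun i k hk hk' => ?_) (fun i k hk hk' => ?_) (fun i j hij => ?_) (fun i j hij => ?_)
  · have := (α i).2
    exact hup i ⟨k, by omega⟩ ⟨k + 1, by omega⟩ (hne _ _ _ _) ((hp i).2.1
      (show k ≤ (α i : ℕ) from hk.le) (show k + 1 ≤ (α i : ℕ) from hk) (show k ≤ k + 1 by omega))
  · have := (β i).2
    exact (hup i ⟨k + 1, by omega⟩ ⟨k, by omega⟩ (hne _ _ _ _).symm ((hp i).2.2.1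
      ⟨show (α i : ℕ) ≤ k from hk, show k ≤ (β i : ℕ) from hk'.le⟩
      ⟨show (α i : ℕ) ≤ k + 1 by omega, show k + 1 ≤ (β i : ℕ) from hk'⟩
      (show k ≤ k + 1 by omega))).symm
  · exact hup i ⟨k, by omega⟩ ⟨k + 1, by omega⟩ (hne _ _ _ _) ((hp i).2.2.2
      (show (β i : ℕ) ≤ k from hk) (show (β i : ℕ) ≤ k + 1 by omega) (show k ≤ k + 1 by omega))
  · by_contra! hcon
    have key : ∀ i, (α i : ℕ) ≠ 0 → h (edgePt 0 0) < h (edgePt i ((S i).node (α i))) := by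
      intro i hi
      rw [← g0 i]
      refine lt_of_le_of_ne (hα i 0) fun h => hi ?_
      rw [← hinj i h]
      rfl
    exact H.not_both_above hij le_rfl hpq.le (key i hcon.1) (key j hcon.2)
  · by_contra! hcon
    have key : ∀ i, (β i : ℕ) ≠ (S i).n + 1 →
        h (edgePt i ((S i).node (β i))) < h (edgePt 0 1) := by
      intro i hi
      rw [← g1 i]
      refine lt_of_le_of_ne (hβ i _) fun h => hi ?_
      rw [hinj i h]
      rfl
    have h1 := key i hcon.1
    have h2 := key j hcon.2
    exact H.not_both_below hij ((max_lt h1 h2).trans hpq) (max_lt h1 h2) (le_max_left _ _)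
      (le_max_right _ _)

/-- Few level crossings in almost all directions force the smallest net total curvature. -/
theorem netTotalCurvature_le_of_ae {f : Theta → E3} (hf : Function.Injective f)
    (H : ∀ᵐ e : Metric.sphere (0 : E3) 1 ∂((volume : Measure E3).toSphere),
      ∀ c, ¬ FourCrossing (fun x => inner ℝ (f x) (e : E3)) c) :
    netTotalCurvature f ≤ ENNReal.ofReal (3 * Real.pi) := by
  refine netTotalCurvature_le_three_pi fun S => ?_
  have hnode : ∀ᵐ e : Metric.sphere (0 : E3) 1 ∂((volume : Measure E3).toSphere),
      ∀ i, ∀ k l : Fin ((S i).n + 2), k ≠ l →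
        inner ℝ (f (edgePt i ((S i).node k))) (e : E3)
          ≠ inner ℝ (f (edgePt i ((S i).node l))) (e : E3) := by
    refine ae_all_iff.2 fun i => ae_all_iff.2 fun k => ae_all_iff.2 fun l => ?_
    by_cases hkl : k = l
    · exact Eventually.of_forall fun e h => absurd hkl h
    by_cases hpt : edgePt i ((S i).node k) = edgePt i ((S i).node l)
    · exfalso
      rcases edgePt_eq_iff.1 hpt with h | h | h
      · exact hkl ((S i).strictMono.injective h.2)
      · exact hkl ((S i).strictMono.injective (h.1.trans h.2.symm))
      · exact hkl ((S i).strictMono.injective (h.1.trans h.2.symm))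
    · exact (ae_inner_ne (hf.ne hpt)).mono fun e he _ => he
  filter_upwards [H, hnode, ae_inner_ne (hf.ne vertices_ne)] with e he hn hpq
  rcases hpq.lt_or_gt with hlt | hlt
  · refine (noFourCrossing_of_forall (h := fun x => -inner ℝ (f x) (e : E3))
      fun c hc => he _ (FourCrossing.neg hc)).polySum_le_three (by linarith) S ?_ (Or.inr rfl)
      (x := heights f S e) (fun i k => ?_)
    · intro i k l hkl
      by_contra hne
      exact hn i k l hne (neg_injective hkl)
    · simp [heights]
  · refine (noFourCrossing_of_forall he).polySum_le_three hlt S ?_ (Or.inl rfl)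
      (x := heights f S e) (fun i k => ?_)
    · intro i k l hkl
      by_contra hne
      exact hn i k l hne hkl
    · simp [heights]

/-! ### Planar convex curves in coordinates -/

/-- The affine span is the whole plane, so its inclusion is an open map and the two frontiers agree.
-/
theorem intrinsicFrontier_eq_frontier {K : Set ℂ} (hK : (interior K).Nonempty) :
    intrinsicFrontier ℝ K = frontier K := by
  have htop : affineSpan ℝ K = ⊤ := affineSpan_eq_top_of_nonempty_interior
    (hK.mono (interior_mono (subset_convexHull ℝ K)))
  refine intrinsicFrontier_subset_frontier.antisymm ?_
  have ho : IsOpenMap ((↑) : affineSpan ℝ K → ℂ) := by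
    refine IsOpen.isOpenMap_subtype_val ?_
    rw [htop]
    exact isOpen_univ
  intro x hx
  have hmem : x ∈ affineSpan ℝ K := htop ▸ AffineSubspace.mem_top ℝ ℂ x
  refine ⟨⟨x, hmem⟩, ?_, rfl⟩
  rw [← ho.preimage_frontier_eq_frontier_preimage continuous_subtype_val]
  exact hx

theorem IsPlanarConvexCurve.exists_coordinates {C : Set E3} (hC : IsPlanarConvexCurve C) :
    ∃ (φ : ℂ →ᵃⁱ[ℝ] E3) (K : Set ℂ), Convex ℝ K ∧ IsCompact K ∧ (interior K).Nonempty ∧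
      C = φ '' frontier K := by
  obtain ⟨K, hconv, hcomp, hrank, rfl⟩ := hC
  have hne : K.Nonempty := by
    by_contra h
    rw [Set.not_nonempty_iff_eq_empty] at h
    rw [h, vectorSpan_empty] at hrank
    simp at hrank
  obtain ⟨o, ho⟩ := hne
  set W := vectorSpan ℝ K with hW
  let u : ℂ ≃ₗᵢ[ℝ] W :=
    Complex.isometryOfOrthonormal ((stdOrthonormalBasis ℝ W).reindex (finCongr hrank))
  let φ : ℂ →ᵃⁱ[ℝ] E3 :=
    (AffineIsometryEquiv.vaddConst ℝ o).toAffineIsometry.comp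
      (W.subtypeₗᵢ.comp u.toLinearIsometry).toAffineIsometry
  have hφ : ∀ x, φ x = (u x : E3) + o := fun x => rfl
  have himg : φ '' (φ ⁻¹' K) = K := by
    rw [Set.image_preimage_eq_inter_range]
    refine Set.inter_eq_left.2 fun y hy => ?_
    have : y - o ∈ W := vsub_mem_vectorSpan ℝ hy ho
    exact ⟨u.symm ⟨y - o, this⟩, by rw [hφ]; simp⟩
  have hcv : Convex ℝ (φ ⁻¹' K) := hconv.affine_preimage φ.toAffineMap
  have hcl : IsClosed (φ ⁻¹' K) := hcomp.isClosed.preimage φ.continuous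
  have hcpt : IsCompact (φ ⁻¹' K) := φ.isometry.isClosedEmbedding.isCompact_preimage hcomp
  have hint : (interior (φ ⁻¹' K)).Nonempty := by
    rw [hcv.interior_nonempty_iff_affineSpan_eq_top]
    have h1 : (vectorSpan ℝ (φ ⁻¹' K)).map φ.linear = W := by
      have := φ.toAffineMap.map_vectorSpan (s := φ ⁻¹' K)
      rwa [φ.coe_toAffineMap, himg] at this
    have h2 : Module.finrank ℝ (vectorSpan ℝ (φ ⁻¹' K)) = 2 := by
      rw [← hrank, ← h1]
      exact (LinearEquiv.finrank_eq (Submodule.equivMapOfInjective φ.linear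
        φ.linearIsometry.injective _))
    have h3 : vectorSpan ℝ (φ ⁻¹' K) = ⊤ :=
      Submodule.eq_top_of_finrank_eq (by rw [h2, Complex.finrank_real_complex])
    refine (AffineSubspace.affineSpan_eq_top_iff_vectorSpan_eq_top_of_nonempty ℝ ℂ ℂ ?_).2 h3
    rw [← himg] at ho
    exact ho.imp fun x hx => hx.1
  refine ⟨φ, φ ⁻¹' K, hcv, hcpt, hint, ?_⟩
  rw [← intrinsicFrontier_eq_frontier hint, ← AffineIsometry.intrinsicFrontier_image, himg]

theorem isPlanarConvexCurve_image_frontier (φ : ℂ →ᵃⁱ[ℝ] E3) {K : Set ℂ} (hconv : Convex ℝ K)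
    (hcomp : IsCompact K) (hint : (interior K).Nonempty) :
    IsPlanarConvexCurve (φ '' frontier K) := by
  refine ⟨φ '' K, hconv.affine_image φ.toAffineMap, hcomp.image φ.continuous, ?_, ?_⟩
  · have h1 : (vectorSpan ℝ K).map φ.linear = vectorSpan ℝ (φ '' K) :=
      φ.toAffineMap.map_vectorSpan (s := K)
    rw [← h1, ← LinearEquiv.finrank_eq (Submodule.equivMapOfInjective φ.linear
        φ.linearIsometry.injective _)]
    have h2 := hconv.interior_nonempty_iff_affineSpan_eq_top.1 hint
    rw [← direction_affineSpan, h2, AffineSubspace.direction_top, finrank_top,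
      Complex.finrank_real_complex]
  · rw [← intrinsicFrontier_eq_frontier hint, AffineIsometry.intrinsicFrontier_image]

/-! ### Lines and convex curves -/

/-- Hahn–Banach separates the frontier point from the open interior, whose closure contains `K`. -/
theorem exists_supporting_functional {K : Set ℂ} (hconv : Convex ℝ K)
    (hint : (interior K).Nonempty) {y : ℂ} (hy : y ∈ frontier K) :
    ∃ g : ℂ →L[ℝ] ℝ, g ≠ 0 ∧ ∀ x ∈ K, g x ≤ g y := by
  obtain ⟨g, hg⟩ := geometric_hahn_banach_open_point hconv.interior isOpen_interior hy.2
  refine ⟨g, ?_, fun x hx => ?_⟩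
  · rintro rfl
    obtain ⟨x, hx⟩ := hint
    simpa using hg x hx
  · have hcl : closure (interior K) ⊆ {x | g x ≤ g y} :=
      closure_minimal (fun x hx => (hg x hx).le) (isClosed_le g.continuous continuous_const)
    rw [hconv.closure_interior_eq_closure_of_nonempty_interior hint] at hcl
    exact hcl (subset_closure hx)

theorem functional_apply (g : ℂ →L[ℝ] ℝ) (x : ℂ) : g x = x.re * g 1 + x.im * g Complex.I := by
  conv_lhs => rw [show x = x.re • (1 : ℂ) + x.im • Complex.I by
    rw [Complex.real_smul, Complex.real_smul, mul_one, Complex.re_add_im]]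
  rw [map_add, map_smul, map_smul, smul_eq_mul, smul_eq_mul]

/-- A supporting line at the middle one of three collinear points has to contain the other two. It
is then the line `g = c`, but `K` has points strictly on both sides of it. -/
theorem not_three_on_line {K : Set ℂ} (hconv : Convex ℝ K) (hint : (interior K).Nonempty)
    (g : ℂ →L[ℝ] ℝ) {c : ℝ} {u v x y z : ℂ} (hu : u ∈ K) (hv : v ∈ K) (hgu : c < g u)
    (hgv : g v < c) (hx : x ∈ K) (hy : y ∈ frontier K) (hz : z ∈ K) (hgx : g x = c)
    (hgy : g y = c) (hgz : g z = c)
    (hxy : -x.re * g Complex.I + x.im * g 1 < -y.re * g Complex.I + y.im * g 1)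
    (hyz : -y.re * g Complex.I + y.im * g 1 < -z.re * g Complex.I + z.im * g 1) : False := by
  obtain ⟨k, hk0, hk⟩ := exists_supporting_functional hconv hint hy
  have kx := hk x hx
  have kz := hk z hz
  have ku := hk u hu
  have kv := hk v hv
  rw [functional_apply g] at hgu hgv hgx hgy hgz
  have hk1 : k 1 ≠ 0 ∨ k Complex.I ≠ 0 := by
    by_contra! h
    refine hk0 (ContinuousLinearMap.ext fun w => ?_)
    rw [functional_apply, h.1, h.2]
    simp
  rw [functional_apply k, functional_apply k y] at kx kz ku kv
  generalize g 1 = a at *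
  generalize g Complex.I = b at *
  generalize k 1 = p at *
  generalize k Complex.I = q at *
  have hab : 0 < a ^ 2 + b ^ 2 := by
    by_contra! h
    have ha : a = 0 := by nlinarith [sq_nonneg a, sq_nonneg b]
    have hb : b = 0 := by nlinarith [sq_nonneg a, sq_nonneg b]
    rw [ha, hb] at hxy
    simp at hxy
  set t : ℂ → ℝ := fun w => -w.re * b + w.im * a with ht
  -- `lam` and `mu` are, up to the factor `a ^ 2 + b ^ 2`, the coordinates of `k` in the orthogonal
  -- frame of `g` and `t`. The points on both sides of `y` on the line force `mu = 0`, and then `u`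
  -- and `v` force `lam = 0`.
  set lam := p * a + q * b with hlam
  set mu := -p * b + q * a with hmu
  have key : ∀ w : ℂ, (a ^ 2 + b ^ 2) * (w.re * p + w.im * q)
      = lam * (w.re * a + w.im * b) + mu * t w := fun w => by
    simp only [ht, hlam, hmu]; ring
  have kx' := mul_le_mul_of_nonneg_left kx hab.le
  have kz' := mul_le_mul_of_nonneg_left kz hab.le
  have ku' := mul_le_mul_of_nonneg_left ku hab.le
  have kv' := mul_le_mul_of_nonneg_left kv hab.le
  rw [key, key] at kx' kz' ku' kv'
  have hxy' : t x < t y := hxy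
  have hyz' : t y < t z := hyz
  rw [hgx, hgy] at kx'
  rw [hgz, hgy] at kz'
  have hmu0 : mu = 0 := by
    have h1 : 0 ≤ mu * (t y - t x) := by linarith
    have h2 : mu * (t z - t y) ≤ 0 := by linarith
    exact le_antisymm (nonpos_of_mul_nonpos_left h2 (sub_pos.2 hyz'))
      (nonneg_of_mul_nonneg_left h1 (sub_pos.2 hxy'))
  rw [hmu0, hgy] at ku' kv'
  have hlam0 : lam = 0 := by
    have h1 : lam * (u.re * a + u.im * b - c) ≤ 0 := by linarith
    have h2 : 0 ≤ lam * (c - (v.re * a + v.im * b)) := by linarith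
    exact le_antisymm (nonpos_of_mul_nonpos_left h1 (sub_pos.2 hgu))
      (nonneg_of_mul_nonneg_left h2 (sub_pos.2 hgv))
  have hp : (a ^ 2 + b ^ 2) * p = 0 := by
    have : (a ^ 2 + b ^ 2) * p = lam * a - mu * b := by simp only [hlam, hmu]; ring
    rw [this, hlam0, hmu0]; ring
  have hq : (a ^ 2 + b ^ 2) * q = 0 := by
    have : (a ^ 2 + b ^ 2) * q = lam * b + mu * a := by simp only [hlam, hmu]; ring
    rw [this, hlam0, hmu0]; ring
  rcases hk1 with h | h
  · exact (mul_ne_zero hab.ne' h) hp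
  · exact (mul_ne_zero hab.ne' h) hq

theorem encard_frontier_inter_level_le {K : Set ℂ} (hconv : Convex ℝ K) (hcl : IsClosed K)
    (hint : (interior K).Nonempty) (g : ℂ →L[ℝ] ℝ) {c : ℝ} {u v : ℂ} (hu : u ∈ K) (hv : v ∈ K)
    (hgu : c < g u) (hgv : g v < c) : {x | x ∈ frontier K ∧ g x = c}.encard ≤ 2 := by
  by_contra! hcon
  obtain ⟨T, hT, hT3⟩ := Set.exists_subset_encard_eq
    (show (3 : ℕ∞) ≤ _ from Order.add_one_le_of_lt hcon)
  obtain ⟨x, y, z, hxy, hxz, hyz, rfl⟩ := Set.encard_eq_three.1 hT3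
  have hx := hT (show x ∈ ({x, y, z} : Set ℂ) by simp)
  have hy := hT (show y ∈ ({x, y, z} : Set ℂ) by simp)
  have hz := hT (show z ∈ ({x, y, z} : Set ℂ) by simp)
  set t : ℂ → ℝ := fun w => -w.re * g Complex.I + w.im * g 1 with ht
  have main : ∀ x y z : ℂ, (x ∈ frontier K ∧ g x = c) → (y ∈ frontier K ∧ g y = c) →
      (z ∈ frontier K ∧ g z = c) → t x < t y → t y < t z → False :=
    fun x y z hx hy hz h1 h2 => not_three_on_line hconv hint g hu hv hgu hgv
      (hcl.frontier_subset hx.1) hy.1 (hcl.frontier_subset hz.1) hx.2 hy.2 hz.2 h1 h2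
  have hinj : ∀ x y : ℂ, (x ∈ frontier K ∧ g x = c) → (y ∈ frontier K ∧ g y = c) → t x = t y →
      x = y := by
    intro x y hx hy hxy
    have h1 : g x = g y := hx.2.trans hy.2.symm
    have h2 : g v < g u := hgv.trans hgu
    rw [functional_apply g, functional_apply g y] at h1
    rw [functional_apply g, functional_apply g u] at h2
    simp only [ht] at hxy
    generalize g 1 = a at *
    generalize g Complex.I = b at *
    have hab : 0 < a ^ 2 + b ^ 2 := by
      by_contra! h
      have ha : a = 0 := by nlinarith [sq_nonneg a, sq_nonneg b]
      have hb : b = 0 := by nlinarith [sq_nonneg a, sq_nonneg b]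
      rw [ha, hb] at h2
      simp at h2
    have e1 : (a ^ 2 + b ^ 2) * (x.re - y.re) = 0 := by linear_combination a * h1 - b * hxy
    have e2 : (a ^ 2 + b ^ 2) * (x.im - y.im) = 0 := by linear_combination b * h1 + a * hxy
    exact Complex.ext (by have := (mul_eq_zero.1 e1).resolve_left hab.ne'; linarith)
      (by have := (mul_eq_zero.1 e2).resolve_left hab.ne'; linarith)
  rcases lt_trichotomy (t x) (t y) with h1 | h1 | h1
  · rcases lt_trichotomy (t y) (t z) with h2 | h2 | h2
    · exact main x y z hx hy hz h1 h2
    · exact hyz (hinj y z hy hz h2)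
    · rcases lt_trichotomy (t x) (t z) with h3 | h3 | h3
      · exact main x z y hx hz hy h3 h2
      · exact hxz (hinj x z hx hz h3)
      · exact main z x y hz hx hy h3 h1
  · exact hxy (hinj x y hx hy h1)
  · rcases lt_trichotomy (t y) (t z) with h2 | h2 | h2
    · rcases lt_trichotomy (t x) (t z) with h3 | h3 | h3
      · exact main y x z hy hx hz h1 h3
      · exact hxz (hinj x z hx hz h3)
      · exact main y z x hy hz hx h2 h3
    · exact hyz (hinj y z hy hz h2)
    · exact main z y x hz hy hx h2 h1

theorem encard_segment_inter_level_le {p q e : E3}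
    (h : (inner ℝ p e : ℝ) ≠ inner ℝ q e) (c : ℝ) :
    {x | x ∈ segment ℝ p q ∧ inner ℝ x e = c}.encard ≤ 1 := by
  rw [Set.encard_le_one_iff]
  rintro x y ⟨hx, hxc⟩ ⟨hy, hyc⟩
  rw [segment_eq_image'] at hx hy
  obtain ⟨s, -, rfl⟩ := hx
  obtain ⟨t, -, rfl⟩ := hy
  rw [← hyc] at hxc
  simp only [inner_add_left, real_inner_smul_left, inner_sub_left] at hxc
  have h1 : (s - t) * (inner ℝ q e - inner ℝ p e) = 0 := by linear_combination hxc
  rw [mul_eq_zero] at h1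
  rcases h1 with h1 | h1
  · rw [sub_eq_zero.1 h1]
  · exact absurd (sub_eq_zero.1 h1).symm h

/-! ### Crossings and points of a level -/

theorem FourCrossing.eventually {h : Theta → ℝ} {c : ℝ} (H : FourCrossing h c) :
    ∀ᶠ c' in 𝓝 c, FourCrossing h c' := by
  obtain ⟨τ, hm, h0, h5, hc, h4⟩ := H
  have key : ∀ a : ℝ, a ≠ c → ∀ᶠ c' in 𝓝 c, a ≠ c' ∧ above c' a = above c a := by
    intro a ha
    rcases ha.lt_or_gt with hlt | hlt
    · filter_upwards [lt_mem_nhds hlt] with c' hc'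
      exact ⟨ne_of_lt hc', by rw [above_of_le (le_of_lt hc'), above_of_le hlt.le]⟩
    · filter_upwards [gt_mem_nhds hlt] with c' hc'
      exact ⟨ne_of_gt hc', by rw [above_of_lt hc', above_of_lt hlt]⟩
  have hev : ∀ᶠ c' in 𝓝 c, ∀ i : Fin 3, ∀ j ∈ Finset.range 6,
      h (edgePt i (τ i j)) ≠ c' ∧ above c' (h (edgePt i (τ i j)))
        = above c (h (edgePt i (τ i j))) :=
    eventually_all.2 fun i => (eventually_all_finset _).2 fun j _ => key _ (hc i j)
  filter_upwards [hev] with c' hc'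
  refine ⟨τ, hm, h0, h5, fun i j => ?_, h4.trans (le_of_eq ?_)⟩
  · rcases le_or_gt j 5 with hj | hj
    · exact (hc' i j (by simp; omega)).1
    · have : τ i j = τ i 5 := le_antisymm (by rw [h5]; exact unitInterval.le_one') (hm i hj.le)
      rw [this]
      exact (hc' i 5 (by simp)).1
  · refine Finset.sum_congr rfl fun i _ => Finset.sum_congr rfl fun j hj => ?_
    rw [Finset.mem_range] at hj
    rw [(hc' i j (by simp; omega)).2, (hc' i (j + 1) (by simp; omega)).2]

theorem exists_level_of_above_ne {g : I → ℝ} (hg : Continuous g) {c : ℝ} {a b : I} (hab : a ≤ b)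
    (ha : g a ≠ c) (hb : g b ≠ c) (hne : above c (g a) ≠ above c (g b)) :
    ∃ t ∈ Set.Ioo a b, g t = c := by
  rcases ha.lt_or_gt with h1 | h1 <;> rcases hb.lt_or_gt with h2 | h2
  · exact absurd (by rw [above_of_le h1.le, above_of_le h2.le]) hne
  · exact intermediate_value_Ioo hab hg.continuousOn ⟨h1, h2⟩
  · exact intermediate_value_Ioo' hab hg.continuousOn ⟨h2, h1⟩
  · exact absurd (by rw [above_of_lt h1, above_of_lt h2]) hne

/-- Each change of side yields a point of the level by the intermediate value theorem. The open
parameter intervals are disjoint and avoid the vertices, so these points are distinct. -/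
theorem FourCrossing.four_le_encard {h : Theta → ℝ} (hh : Continuous h) {c : ℝ}
    (H : FourCrossing h c) : 4 ≤ {x | h x = c}.encard := by
  obtain ⟨τ, hm, h0, h5, hc, h4⟩ := H
  set J : Finset (Fin 3 × ℕ) := (Finset.univ ×ˢ Finset.range 5).filter fun x =>
    above c (h (edgePt x.1 (τ x.1 x.2))) ≠ above c (h (edgePt x.1 (τ x.1 (x.2 + 1)))) with hJ
  have hcard : 4 ≤ J.card := by
    have e1 : ∑ i : Fin 3, ∑ j ∈ Finset.range 5,
        |above c (h (edgePt i (τ i j))) - above c (h (edgePt i (τ i (j + 1))))|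
        = (J.card : ℝ) := by
      rw [← Finset.sum_product', hJ, Finset.card_filter]
      push_cast
      refine Finset.sum_congr rfl fun x _ => ?_
      rcases above_eq_zero_or_one c (h (edgePt x.1 (τ x.1 x.2))) with k1 | k1 <;>
      rcases above_eq_zero_or_one c (h (edgePt x.1 (τ x.1 (x.2 + 1)))) with k2 | k2 <;>
      simp [k1, k2]
    rw [e1] at h4
    exact_mod_cast h4
  have hex : ∀ x : J, ∃ t ∈ Set.Ioo (τ x.1.1 x.1.2) (τ x.1.1 (x.1.2 + 1)),
      h (edgePt x.1.1 t) = c := fun x =>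
    exists_level_of_above_ne (g := fun t => h (edgePt x.1.1 t)) (hh.comp (continuous_edgePt _))
      (hm _ (Nat.le_succ _)) (hc _ _) (hc _ _) (Finset.mem_filter.1 x.2).2
  choose t ht htc using hex
  have hinj : Function.Injective fun x : J => edgePt x.1.1 (t x) := by
    intro x y hxy
    rcases edgePt_eq_iff.1 hxy with ⟨k1, k2⟩ | ⟨k1, -⟩ | ⟨k1, -⟩
    · refine Subtype.ext (Prod.ext k1 ?_)
      have hx := ht x
      have hy := ht y
      rw [← k2, ← k1] at hy
      rcases lt_trichotomy x.1.2 y.1.2 with hlt | heq | hlt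
      · exact absurd (hm x.1.1 (Nat.succ_le_of_lt hlt)) (hy.1.trans hx.2).not_ge
      · exact heq
      · exact absurd (hm x.1.1 (Nat.succ_le_of_lt hlt)) (hx.1.trans hy.2).not_ge
    · exact absurd k1 (unitInterval.nonneg'.trans_lt (ht x).1).ne'
    · exact absurd k1 ((ht x).2.trans_le unitInterval.le_one').ne
  calc (4 : ℕ∞) ≤ J.card := by exact_mod_cast hcard
    _ = (Set.range fun x : J => edgePt x.1.1 (t x)).encard := by
      rw [← Set.image_univ, hinj.encard_image, Set.encard_univ]
      simp
    _ ≤ _ := Set.encard_le_encard (by rintro _ ⟨x, rfl⟩; exact htc x)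

/-! ### Convex curves with a chord -/

/-- A generic plane meets the convex curve in at most two points and the chord in at most one, while
a four-crossing needs four. -/
theorem not_fourCrossing_of_isConvexCurveWithChord {f : Theta → E3} (hf : Continuous f)
    (hinj : Function.Injective f) (φ : ℂ →ᵃⁱ[ℝ] E3) {K : Set ℂ} (hconv : Convex ℝ K)
    (hcomp : IsCompact K) (hint : (interior K).Nonempty) {p q : E3} (hΓ : Set.range f = φ '' frontier K ∪ segment ℝ p q) {e : E3}
    (he : (inner ℝ p e : ℝ) ≠ inner ℝ q e) (c : ℝ) :
    ¬ FourCrossing (fun x => inner ℝ (f x) e) c := by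
  intro H
  set g : ℂ →L[ℝ] ℝ := (innerSL ℝ e).comp φ.linearIsometry.toContinuousLinearMap with hg
  have hgφ : ∀ x, inner ℝ (φ x) e = g x + inner ℝ (φ 0) e := fun x => by
    have h1 : φ x = φ.linearIsometry x + φ 0 := by
      have := φ.map_vadd 0 x
      simpa using this
    rw [h1, inner_add_left, hg]
    simp [real_inner_comm]
  obtain ⟨x₁, hx₁, hmax⟩ := hcomp.exists_isMaxOn (hint.mono interior_subset) g.continuous.continuousOn
  obtain ⟨x₀, hx₀, hmin⟩ := hcomp.exists_isMinOn (hint.mono interior_subset) g.continuous.continuousOn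
  -- At the extreme heights of `K` the level may contain a whole segment of the curve. A
  -- four-crossing persists at nearby levels, so these two values can be avoided.
  have hdense : Dense ({g x₁ + inner ℝ (φ 0) e, g x₀ + inner ℝ (φ 0) e}ᶜ : Set ℝ) :=
    Set.Countable.dense_compl ℝ (Set.toFinite _).countable
  obtain ⟨d, hd, hdc⟩ := ((mem_closure_iff_frequently.1 (hdense c)).and_eventually
    H.eventually).exists
  set d' := d - inner ℝ (φ 0) e with hd'
  have hlevel : {x | x ∈ frontier K ∧ g x = d'}.encard ≤ 2 := by
    simp only [Set.mem_compl_iff, Set.mem_insert_iff, Set.mem_singleton_iff, not_or] at hd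
    have hne1 : d' ≠ g x₁ := fun h => hd.1 (by linarith)
    have hne0 : d' ≠ g x₀ := fun h => hd.2 (by linarith)
    by_cases hcase : g x₀ < d' ∧ d' < g x₁
    · exact encard_frontier_inter_level_le hconv hcomp.isClosed hint g hx₁ hx₀ hcase.2 hcase.1
    · have : {x | x ∈ frontier K ∧ g x = d'} = ∅ := by
        refine Set.eq_empty_of_forall_notMem fun x hx => hcase ?_
        have hxK := hcomp.isClosed.frontier_subset hx.1
        have h1 : g x ≤ g x₁ := hmax hxK
        have h2 : g x₀ ≤ g x := hmin hxK
        rw [hx.2] at h1 h2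
        exact ⟨lt_of_le_of_ne h2 hne0.symm, lt_of_le_of_ne h1 hne1⟩
      rw [this]
      simp
  have h4 := hdc.four_le_encard (hf.inner continuous_const)
  have hsub : f '' {x | inner ℝ (f x) e = d} ⊆
      φ '' {x | x ∈ frontier K ∧ g x = d'} ∪ {x | x ∈ segment ℝ p q ∧ inner ℝ x e = d} := by
    rintro _ ⟨x, hx, rfl⟩
    have hmem : f x ∈ φ '' frontier K ∪ segment ℝ p q := hΓ ▸ Set.mem_range_self x
    rcases hmem with ⟨y, hy, hyx⟩ | hseg
    · refine Or.inl ⟨y, ⟨hy, ?_⟩, hyx⟩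
      have hx : inner ℝ (f x) e = d := hx
      rw [← hyx, hgφ] at hx
      linarith
    · exact Or.inr ⟨hseg, hx⟩
  have hle := Set.encard_le_encard hsub
  rw [hinj.encard_image] at hle
  have h3 := hle.trans ((Set.encard_union_le _ _).trans (add_le_add
    ((Set.encard_image_le φ _).trans hlevel) (encard_segment_inter_level_le he d)))
  exact absurd (h4.trans h3) (by norm_num)

theorem netTotalCurvature_le_of_isConvexCurveWithChord {f : Theta → E3} (hf : Continuous f)
    (hinj : Function.Injective f) (h : IsConvexCurveWithChord (Set.range f)) :
    netTotalCurvature f ≤ ENNReal.ofReal (3 * Real.pi) := by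
  obtain ⟨C, p, q, hC, -, -, hpq, -, hΓ⟩ := h
  obtain ⟨φ, K, hconv, hcomp, hint, rfl⟩ := hC.exists_coordinates
  refine netTotalCurvature_le_of_ae hinj ?_
  filter_upwards [ae_inner_ne hpq] with e he c
  exact not_fourCrossing_of_isConvexCurveWithChord hf hinj φ hconv hcomp hint hΓ he c

/-! ### Cycles in the theta graph -/

/-- The cycle which runs along the `i`-th edge and back along the `j`-th edge, parametrized by
the interval `[0, 2]`. -/
def cycle (i j : Fin 3) (t : ℝ) : Theta :=
  if t ≤ 1 then edgePt i (Set.projIcc 0 1 zero_le_one t)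
  else edgePt j (Set.projIcc 0 1 zero_le_one (2 - t))

theorem cycle_of_le {i j : Fin 3} {t : ℝ} (h : t ≤ 1) :
    cycle i j t = edgePt i (Set.projIcc 0 1 zero_le_one t) := if_pos h

theorem cycle_of_ge {i j : Fin 3} {t : ℝ} (h : 1 ≤ t) :
    cycle i j t = edgePt j (Set.projIcc 0 1 zero_le_one (2 - t)) := by
  rcases h.eq_or_lt with rfl | h
  · rw [cycle_of_le le_rfl, show (2 : ℝ) - 1 = 1 by norm_num, Set.projIcc_right]
    exact edgePt_one i j
  · exact if_neg h.not_ge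

theorem continuous_cycle (i j : Fin 3) : Continuous (cycle i j) := by
  refine Continuous.if_le ((continuous_edgePt i).comp (by fun_prop))
    ((continuous_edgePt j).comp (by fun_prop)) continuous_id continuous_const ?_
  rintro t rfl
  rw [← cycle_of_ge (i := i) le_rfl, ← cycle_of_le (j := j) le_rfl]

theorem cycle_zero_eq_cycle_two (i j : Fin 3) : cycle i j 0 = cycle i j 2 := by
  rw [cycle_of_le zero_le_one, cycle_of_ge one_le_two, sub_self, Set.projIcc_left]
  exact edgePt_zero i j

theorem cycle_coe (i j : Fin 3) (t : I) : cycle i j t = edgePt i t := by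
  rw [cycle_of_le t.2.2, Set.projIcc_val]

theorem cycle_two_sub_coe (i j : Fin 3) (t : I) : cycle i j (2 - t) = edgePt j t := by
  rw [cycle_of_ge (by linarith [t.2.2]), sub_sub_cancel, Set.projIcc_val]

theorem image_cycle (i j : Fin 3) :
    cycle i j '' Set.Icc 0 2 = Set.range (edgePt i) ∪ Set.range (edgePt j) := by
  ext x
  constructor
  · rintro ⟨t, -, rfl⟩
    rcases le_total t 1 with h | h
    · exact Or.inl ⟨_, (cycle_of_le h).symm⟩
    · exact Or.inr ⟨_, (cycle_of_ge h).symm⟩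
  · rintro (⟨t, rfl⟩ | ⟨t, rfl⟩)
    · exact ⟨t, ⟨t.2.1, t.2.2.trans one_le_two⟩, cycle_coe i j t⟩
    · exact ⟨2 - t, ⟨by linarith [t.2.2], by linarith [t.2.1]⟩, cycle_two_sub_coe i j t⟩

theorem projIcc_of_one_le {t : ℝ} (h : 1 ≤ t) : Set.projIcc 0 1 zero_le_one t = 1 :=
  Set.projIcc_of_right_le _ h

/-- Four points alternating around the cycle give four crossings on its two edges. -/
theorem NoFourCrossing.cycle_alternating {h : Theta → ℝ} (H : NoFourCrossing h) {i j : Fin 3}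
    (hij : i ≠ j) {l a b c d : ℝ} (hab : a ≤ b) (hbc : b ≤ c) (hcd : c ≤ d)
    (h1 : above l (h (cycle i j a)) ≠ above l (h (cycle i j b)))
    (h2 : above l (h (cycle i j b)) ≠ above l (h (cycle i j c)))
    (h3 : above l (h (cycle i j c)) ≠ above l (h (cycle i j d))) : False := by
  have hm : Monotone (Set.projIcc (0 : ℝ) 1 zero_le_one) := Set.monotone_projIcc _
  -- Clamping splits the chain: on each edge the parameters belonging to the other edge become the
  -- common end `1`.
  have key := H.two_edges hij l (hm hab) (hm hbc) (hm hcd) (hm (sub_le_sub_left hcd 2))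
    (hm (sub_le_sub_left hbc 2)) (hm (sub_le_sub_left hab 2))
  have hlo : ∀ t, t ≤ 1 → h (edgePt i (Set.projIcc 0 1 zero_le_one t)) = h (cycle i j t) ∧
      h (edgePt j (Set.projIcc 0 1 zero_le_one (2 - t))) = h (edgePt 0 1) := fun t ht => by
    rw [cycle_of_le ht, projIcc_of_one_le (by linarith : 1 ≤ 2 - t), edgePt_one j 0]
    exact ⟨rfl, rfl⟩
  have hhi : ∀ t, 1 ≤ t → h (edgePt i (Set.projIcc 0 1 zero_le_one t)) = h (edgePt 0 1) ∧
      h (edgePt j (Set.projIcc 0 1 zero_le_one (2 - t))) = h (cycle i j t) := fun t ht => by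
    rw [cycle_of_ge ht, projIcc_of_one_le ht, edgePt_one i 0]
    exact ⟨rfl, rfl⟩
  unfold edgeVar at key
  rw [edgePt_zero i 0, edgePt_zero j 0, edgePt_one i 0, edgePt_one j 0] at key
  have main : ∀ x1 x2 x3 x4 : ℝ, (x1 = 0 ∨ x1 = 1) → (x2 = 0 ∨ x2 = 1) → (x3 = 0 ∨ x3 = 1) →
      (x4 = 0 ∨ x4 = 1) → x1 ≠ x2 → x2 ≠ x3 → x3 ≠ x4 →
      4 ≤ |x1 - x2| + |x2 - x3| + |x3 - x4| + |x4 - x1| := by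
    rintro x1 x2 x3 x4 (rfl | rfl) (rfl | rfl) (rfl | rfl) (rfl | rfl) h1 h2 h3 <;> simp_all
    all_goals norm_num
  have hfour := main _ _ _ _ (above_eq_zero_or_one l (h (cycle i j a)))
    (above_eq_zero_or_one l (h (cycle i j b))) (above_eq_zero_or_one l (h (cycle i j c)))
    (above_eq_zero_or_one l (h (cycle i j d))) h1 h2 h3
  have tri : ∀ x y z : ℝ, |x - z| ≤ |x - y| + |y - z| := abs_sub_le
  have comm : ∀ x y : ℝ, |x - y| = |y - x| := abs_sub_comm
  generalize above l (h (edgePt 0 0)) = P at *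
  -- The cases are distinguished by how many of the four points lie on edge `i`.
  rcases le_total d 1 with hd | hd
  · rw [(hlo a (by linarith)).1, (hlo b (by linarith)).1, (hlo c (by linarith)).1, (hlo d hd).1,
      (hlo a (by linarith)).2, (hlo b (by linarith)).2, (hlo c (by linarith)).2,
      (hlo d hd).2] at key
    generalize above l (h (edgePt 0 1)) = Q at *
    generalize above l (h (cycle i j a)) = A at *
    generalize above l (h (cycle i j b)) = B at *
    generalize above l (h (cycle i j c)) = C at *
    generalize above l (h (cycle i j d)) = D at *
    linarith [tri D Q A, tri Q P A, abs_nonneg (P - Q), comm Q P, abs_nonneg (Q - Q)]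
  rcases le_total c 1 with hc | hc
  · rw [(hlo a (by linarith)).1, (hlo b (by linarith)).1, (hlo c (by linarith)).1, (hhi d hd).1,
      (hlo a (by linarith)).2, (hlo b (by linarith)).2, (hlo c (by linarith)).2,
      (hhi d hd).2] at key
    generalize above l (h (edgePt 0 1)) = Q at *
    generalize above l (h (cycle i j a)) = A at *
    generalize above l (h (cycle i j b)) = B at *
    generalize above l (h (cycle i j c)) = C at *
    generalize above l (h (cycle i j d)) = D at *
    linarith [tri C Q D, tri D P A, abs_nonneg (P - Q), comm Q D, comm D P, abs_nonneg (Q - Q)]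
  rcases le_total b 1 with hb | hb
  · rw [(hlo a (by linarith)).1, (hlo b (by linarith)).1, (hhi c hc).1, (hhi d hd).1,
      (hlo a (by linarith)).2, (hlo b (by linarith)).2, (hhi c hc).2, (hhi d hd).2] at key
    generalize above l (h (edgePt 0 1)) = Q at *
    generalize above l (h (cycle i j a)) = A at *
    generalize above l (h (cycle i j b)) = B at *
    generalize above l (h (cycle i j c)) = C at *
    generalize above l (h (cycle i j d)) = D at *
    linarith [tri B Q C, tri D P A, abs_nonneg (P - Q), comm Q C, comm D P, comm C D,
      abs_nonneg (Q - Q)]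
  rcases le_total a 1 with ha | ha
  · rw [(hlo a ha).1, (hhi b hb).1, (hhi c hc).1, (hhi d hd).1,
      (hlo a ha).2, (hhi b hb).2, (hhi c hc).2, (hhi d hd).2] at key
    generalize above l (h (edgePt 0 1)) = Q at *
    generalize above l (h (cycle i j a)) = A at *
    generalize above l (h (cycle i j b)) = B at *
    generalize above l (h (cycle i j c)) = C at *
    generalize above l (h (cycle i j d)) = D at *
    linarith [tri A Q B, tri D P A, abs_nonneg (P - Q), comm Q B, comm D P, comm C D, comm B C,
      abs_nonneg (Q - Q)]
  · rw [(hhi a ha).1, (hhi b hb).1, (hhi c hc).1, (hhi d hd).1,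
      (hhi a ha).2, (hhi b hb).2, (hhi c hc).2, (hhi d hd).2] at key
    generalize above l (h (edgePt 0 1)) = Q at *
    generalize above l (h (cycle i j a)) = A at *
    generalize above l (h (cycle i j b)) = B at *
    generalize above l (h (cycle i j c)) = C at *
    generalize above l (h (cycle i j d)) = D at *
    linarith [tri D P A, tri P Q A, comm Q A, comm D P, comm C D, comm B C, comm A B,
      abs_nonneg (Q - Q), abs_nonneg (P - Q)]

/-- The cycle, started at the parameter `t₀`. -/
def rotatedCycle (i j : Fin 3) (t₀ s : ℝ) : Theta :=
  cycle i j (if t₀ + s ≤ 2 then t₀ + s else t₀ + s - 2)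

theorem NoFourCrossing.rotatedCycle_alternating {h : Theta → ℝ} (H : NoFourCrossing h)
    {i j : Fin 3} (hij : i ≠ j) {t₀ l a b c : ℝ} (ha : 0 ≤ a) (hab : a ≤ b) (hbc : b ≤ c)
    (hc : c ≤ 2)
    (h1 : above l (h (cycle i j t₀)) ≠ above l (h (rotatedCycle i j t₀ a)))
    (h2 : above l (h (rotatedCycle i j t₀ a)) ≠ above l (h (rotatedCycle i j t₀ b)))
    (h3 : above l (h (rotatedCycle i j t₀ b)) ≠ above l (h (rotatedCycle i j t₀ c))) :
    False := by
  -- With only two values, three changes force the fourth, so the pattern is cyclic and can be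
  -- restarted at the parameter `0`.
  have h4 : above l (h (rotatedCycle i j t₀ c)) ≠ above l (h (cycle i j t₀)) := by
    rcases above_eq_zero_or_one l (h (cycle i j t₀)) with e1 | e1 <;>
    rcases above_eq_zero_or_one l (h (rotatedCycle i j t₀ a)) with e2 | e2 <;>
    rcases above_eq_zero_or_one l (h (rotatedCycle i j t₀ b)) with e3 | e3 <;>
    rcases above_eq_zero_or_one l (h (rotatedCycle i j t₀ c)) with e4 | e4 <;>
    simp_all
  unfold rotatedCycle at h1 h2 h3 h4
  by_cases hc2 : t₀ + c ≤ 2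
  · rw [if_pos (by linarith)] at h1
    rw [if_pos (by linarith), if_pos (by linarith)] at h2
    rw [if_pos (by linarith), if_pos (by linarith)] at h3
    exact H.cycle_alternating hij (by linarith) (by linarith) (by linarith) h1 h2 h3
  rw [if_neg hc2] at h3 h4
  by_cases hb2 : t₀ + b ≤ 2
  · rw [if_pos (by linarith)] at h1
    rw [if_pos (by linarith), if_pos hb2] at h2
    exact H.cycle_alternating hij (by linarith) (by linarith) (by linarith) h4 h1 h2
  rw [if_neg hb2] at h2 h3
  by_cases ha2 : t₀ + a ≤ 2
  · rw [if_pos ha2] at h1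
    exact H.cycle_alternating hij (by linarith) (by linarith) (by linarith) h3 h4 h1
  · rw [if_neg ha2] at h2
    exact H.cycle_alternating hij (by linarith) (by linarith) (by linarith) h2 h3 h4

theorem image_cycle_subset_rotatedCycle (i j : Fin 3) {t₀ : ℝ} (h0 : 0 ≤ t₀) (h2 : t₀ ≤ 2) :
    cycle i j '' Set.Icc 0 2 ⊆ rotatedCycle i j t₀ '' Set.Icc 0 2 := by
  rintro _ ⟨t, ht, rfl⟩
  unfold rotatedCycle
  rcases le_or_gt t₀ t with h | h
  · refine ⟨t - t₀, ⟨by linarith, by linarith [ht.2]⟩, ?_⟩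
    simp only
    rw [if_pos (by linarith [ht.2]), add_sub_cancel]
  · rcases ht.1.eq_or_lt with rfl | hpos
    · refine ⟨2 - t₀, ⟨by linarith, by linarith⟩, ?_⟩
      simp only
      rw [if_pos (by linarith), add_sub_cancel, cycle_zero_eq_cycle_two]
    · refine ⟨t - t₀ + 2, ⟨by linarith, by linarith⟩, ?_⟩
      simp only
      rw [if_neg (by linarith)]
      congr 1
      ring

/-! ### Planar curves with few level crossings are convex -/

/-- The linear functional of direction `θ` on the plane. -/
def rotFunctional (θ : ℝ) : ℂ →L[ℝ] ℝ := Real.cos θ • Complex.reCLM + Real.sin θ • Complex.imCLM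

theorem rotFunctional_apply (θ : ℝ) (z : ℂ) :
    rotFunctional θ z = Real.cos θ * z.re + Real.sin θ * z.im := by
  simp [rotFunctional]

theorem rotFunctional_ne_zero (θ : ℝ) : rotFunctional θ ≠ 0 := by
  intro h
  have h1 : rotFunctional θ 1 = 0 := by rw [h]; rfl
  have h2 : rotFunctional θ Complex.I = 0 := by rw [h]; rfl
  rw [rotFunctional_apply] at h1 h2
  simp only [Complex.one_re, Complex.one_im, Complex.I_re, Complex.I_im, mul_one, mul_zero,
    add_zero, zero_add] at h1 h2
  have := Real.sin_sq_add_cos_sq θ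
  rw [h1, h2] at this
  norm_num at this

/-- Otherwise the functional would have a local maximum at `y`, and its derivative, the functional
itself, would vanish. -/
theorem exists_lt_of_mem_interior_convexHull {C : Set ℂ} {y : ℂ}
    (hy : y ∈ interior (convexHull ℝ C)) {k : ℂ →L[ℝ] ℝ} (hk : k ≠ 0) : ∃ x ∈ C, k y < k x := by
  by_contra! hcon
  have h1 : convexHull ℝ C ⊆ {x | k x ≤ k y} :=
    convexHull_min hcon (convex_halfSpace_le k.toLinearMap.isLinear (k y))
  refine hk ?_
  have hloc : IsLocalMax k y := by
    filter_upwards [mem_interior_iff_mem_nhds.1 hy] with x hx using h1 hx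
  have := hloc.fderiv_eq_zero
  rwa [k.fderiv] at this

/-- A point of a curve lies on the boundary of the convex hull, if no line through this point is
crossed more than twice. -/
theorem notMem_interior_convexHull {ι : Type*} [LinearOrder ι] {C : Set ℂ} {y : ℂ} {T : ι → ℂ}
    (hC : C ⊆ insert y (Set.range T))
    (hpat : ∀ (k : ℂ →L[ℝ] ℝ) (a b c : ι), a < b → b < c → k y < k (T a) → k (T b) ≤ k y →
      k y < k (T c) → False) : y ∉ interior (convexHull ℝ C) := by
  intro hy
  have hpos : ∀ k : ℂ →L[ℝ] ℝ, k ≠ 0 → ∃ s, k y < k (T s) := fun k hk => by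
    obtain ⟨x, hx, hlt⟩ := exists_lt_of_mem_interior_convexHull hy hk
    rcases hC hx with rfl | ⟨s, rfl⟩
    · exact absurd hlt (lt_irrefl _)
    · exact ⟨s, hlt⟩
  have hneg : ∀ k : ℂ →L[ℝ] ℝ, k ≠ 0 → ∃ s, k (T s) < k y := fun k hk => by
    obtain ⟨s, hs⟩ := hpos (-k) (neg_ne_zero.2 hk)
    exact ⟨s, by simpa using hs⟩
  have hpat' : ∀ (k : ℂ →L[ℝ] ℝ) (a b c : ι), a < b → b < c → k (T a) < k y → k y ≤ k (T b) →
      k (T c) < k y → False := fun k a b c hab hbc h1 h2 h3 =>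
    hpat (-k) a b c hab hbc (by simpa using h1) (by simpa using h2) (by simpa using h3)
  -- `U` holds the directions in which the curve is first above and later below `y`, and `V` the
  -- opposite ones. For an interior point these open sets cover the line, and adding `π` exchanges
  -- them. By connectedness some direction lies in both, which forces the excluded pattern for it or
  -- for its negative.
  set U : Set ℝ := ⋃ x : {x : ι × ι // x.1 < x.2},
    {θ | rotFunctional θ y < rotFunctional θ (T x.1.1) ∧
      rotFunctional θ (T x.1.2) < rotFunctional θ y} with hU
  set V : Set ℝ := ⋃ x : {x : ι × ι // x.1 < x.2},
    {θ | rotFunctional θ (T x.1.1) < rotFunctional θ y ∧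
      rotFunctional θ y < rotFunctional θ (T x.1.2)} with hV
  have hcont : ∀ z : ℂ, Continuous fun θ => rotFunctional θ z := fun z => by
    simp only [rotFunctional_apply]
    fun_prop
  have hUo : IsOpen U := isOpen_iUnion fun x =>
    (isOpen_lt (hcont _) (hcont _)).inter (isOpen_lt (hcont _) (hcont _))
  have hVo : IsOpen V := isOpen_iUnion fun x =>
    (isOpen_lt (hcont _) (hcont _)).inter (isOpen_lt (hcont _) (hcont _))
  have hcover : (Set.univ : Set ℝ) ⊆ U ∪ V := fun θ _ => by
    obtain ⟨s, hs⟩ := hpos _ (rotFunctional_ne_zero θ)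
    obtain ⟨t, ht⟩ := hneg _ (rotFunctional_ne_zero θ)
    rcases lt_trichotomy s t with h | rfl | h
    · exact Or.inl (Set.mem_iUnion.2 ⟨⟨(s, t), h⟩, hs, ht⟩)
    · exact absurd (hs.trans ht) (lt_irrefl _)
    · exact Or.inr (Set.mem_iUnion.2 ⟨⟨(t, s), h⟩, ht, hs⟩)
  have hrot : ∀ θ z, rotFunctional (θ + Real.pi) z = -rotFunctional θ z := fun θ z => by
    rw [rotFunctional_apply, rotFunctional_apply, Real.cos_add_pi, Real.sin_add_pi]
    ring
  have hUV : ∀ θ, θ ∈ U → θ + Real.pi ∈ V := fun θ hθ => by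
    obtain ⟨x, h1, h2⟩ := Set.mem_iUnion.1 hθ
    refine Set.mem_iUnion.2 ⟨x, ?_, ?_⟩
    · rw [hrot, hrot]; exact neg_lt_neg h1
    · rw [hrot, hrot]; exact neg_lt_neg h2
  have hVU : ∀ θ, θ ∈ V → θ + Real.pi ∈ U := fun θ hθ => by
    obtain ⟨x, h1, h2⟩ := Set.mem_iUnion.1 hθ
    refine Set.mem_iUnion.2 ⟨x, ?_, ?_⟩
    · rw [hrot, hrot]; exact neg_lt_neg h1
    · rw [hrot, hrot]; exact neg_lt_neg h2
  have hne : (Set.univ ∩ U).Nonempty ∧ (Set.univ ∩ V).Nonempty := by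
    rcases hcover (Set.mem_univ 0) with h | h
    · exact ⟨⟨0, trivial, h⟩, ⟨_, trivial, hUV 0 h⟩⟩
    · exact ⟨⟨_, trivial, hVU 0 h⟩, ⟨0, trivial, h⟩⟩
  obtain ⟨θ, -, hθU, hθV⟩ := isPreconnected_univ U V hUo hVo hcover hne.1 hne.2
  obtain ⟨⟨⟨s, t⟩, hst⟩, hs, ht⟩ := Set.mem_iUnion.1 hθU
  obtain ⟨⟨⟨t', s'⟩, hts'⟩, ht', hs'⟩ := Set.mem_iUnion.1 hθV
  simp only at hst hts' hs ht ht' hs'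
  rcases lt_trichotomy s' t with h | rfl | h
  · exact hpat' _ t' s' t hts' h ht' hs'.le ht
  · exact lt_irrefl _ (hs'.trans ht)
  · exact hpat _ s t s' hst h hs ht.le hs'

/-- In a convex combination attaining the maximum of `k`, points with a smaller value have weight
zero. -/
theorem mem_convexHull_inter_of_le {C : Set ℂ} {y : ℂ} (hy : y ∈ convexHull ℝ C)
    {k : ℂ →L[ℝ] ℝ} (hk : ∀ x ∈ C, k x ≤ k y) :
    y ∈ convexHull ℝ (C ∩ {x | k x = k y}) := by
  rw [convexHull_eq] at hy
  obtain ⟨ι, s, w, z, hw0, hw1, hz, hyz⟩ := hy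
  have hky : ∑ i ∈ s, w i * (k y - k (z i)) = 0 := by
    have h1 : k y = ∑ i ∈ s, w i * k (z i) := by
      rw [← hyz, Finset.centerMass_eq_of_sum_1 _ _ hw1, map_sum]
      exact Finset.sum_congr rfl fun i _ => by rw [map_smul, smul_eq_mul]
    simp only [mul_sub]
    rw [Finset.sum_sub_distrib, ← Finset.sum_mul, hw1, one_mul, ← h1, sub_self]
  have hzero := (Finset.sum_eq_zero_iff_of_nonneg fun i hi =>
    mul_nonneg (hw0 i hi) (sub_nonneg.2 (hk _ (hz i hi)))).1 hky
  have hyz' := hyz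
  rw [← Finset.centerMass_filter_ne_zero] at hyz'
  rw [← hyz']
  refine Finset.centerMass_mem_convexHull _ (fun i hi => hw0 i (Finset.mem_filter.1 hi).1) ?_ ?_
  · rw [Finset.sum_filter_ne_zero, hw1]
    exact one_pos
  · intro i hi
    rw [Finset.mem_filter] at hi
    rw [hyz']
    exact ⟨hz i hi.1, by
      have := (mul_eq_zero.1 (hzero i hi.1)).resolve_left hi.2
      exact (sub_eq_zero.1 this).symm⟩

theorem exists_eq_of_mul_nonpos {F : ℝ → ℝ} (hF : Continuous F) {a b m : ℝ} (hab : a ≤ b)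
    (h : (F a - m) * (F b - m) ≤ 0) : ∃ t ∈ Set.Icc a b, F t = m := by
  rcases mul_nonpos_iff.1 h with ⟨h1, h2⟩ | ⟨h1, h2⟩
  · exact intermediate_value_Icc' hab hF.continuousOn ⟨by linarith, by linarith⟩
  · exact intermediate_value_Icc hab hF.continuousOn ⟨by linarith, by linarith⟩

/-- The functional which is the coordinate along the level lines of another functional. -/
def conjFunctional (k : ℂ →L[ℝ] ℝ) : ℂ →L[ℝ] ℝ :=
  (-k Complex.I) • Complex.reCLM + k 1 • Complex.imCLM

theorem eq_of_functional_eq {k : ℂ →L[ℝ] ℝ} (hk : k ≠ 0) {x y : ℂ} (h1 : k x = k y)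
    (h2 : conjFunctional k x = conjFunctional k y) : x = y := by
  have hne : k 1 ≠ 0 ∨ k Complex.I ≠ 0 := by
    by_contra! h
    refine hk (ContinuousLinearMap.ext fun w => ?_)
    rw [functional_apply, h.1, h.2]
    simp
  rw [functional_apply, functional_apply k y] at h1
  simp only [conjFunctional, add_apply, smul_apply,
    Complex.reCLM_apply, Complex.imCLM_apply, smul_eq_mul] at h2
  generalize k 1 = a at *
  generalize k Complex.I = b at *
  have hab : a ^ 2 + b ^ 2 ≠ 0 := by
    rcases hne with h | h <;> positivity
  have e1 : (a ^ 2 + b ^ 2) * (x.re - y.re) = 0 := by linear_combination a * h1 - b * h2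
  have e2 : (a ^ 2 + b ^ 2) * (x.im - y.im) = 0 := by linear_combination b * h1 + a * h2
  exact Complex.ext (sub_eq_zero.1 ((mul_eq_zero.1 e1).resolve_left hab))
    (sub_eq_zero.1 ((mul_eq_zero.1 e2).resolve_left hab))

/-- In finite dimension the convex hull of a compact set is compact. -/
theorem isCompact_convexHull_of_isCompact {E : Type*} [NormedAddCommGroup E] [NormedSpace ℝ E]
    [FiniteDimensional ℝ E] {C : Set E} (hC : IsCompact C) : IsCompact (convexHull ℝ C) := by
  set n := Module.finrank ℝ E + 1 with hn
  have himg : convexHull ℝ C = (fun x : (Fin n → ℝ) × (Fin n → E) => ∑ i, x.1 i • x.2 i) ''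
      (stdSimplex ℝ (Fin n) ×ˢ Set.univ.pi fun _ => C) := by
    ext x
    constructor
    · intro hx
      -- By Carathéodory's theorem `finrank + 1` points suffice; shorter combinations are padded
      -- with zero weights.
      obtain ⟨ι, _, z, w, hz, haff, hw0, hw1, hsum⟩ := eq_pos_convex_span_of_mem_convexHull hx
      obtain ⟨c, hc⟩ : C.Nonempty := convexHull_nonempty_iff.1 ⟨x, hx⟩
      have hcard : Fintype.card ι ≤ Fintype.card (Fin n) := by
        rw [Fintype.card_fin]
        exact haff.card_le_finrank_succ.trans
          (Nat.add_le_add_right (Submodule.finrank_le _) 1)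
      obtain ⟨e⟩ := Function.Embedding.nonempty_of_card_le hcard
      have he := e.injective
      have hout : ∀ j, j ∉ Set.range e → Function.extend e w 0 j = 0 := fun j hj =>
        Function.extend_apply' _ _ _ hj
      refine ⟨(Function.extend e w 0, Function.extend e z fun _ => c), ⟨⟨fun j => ?_, ?_⟩,
        fun j _ => ?_⟩, ?_⟩
      · by_cases hj : j ∈ Set.range e
        · obtain ⟨i, rfl⟩ := hj
          simp only [he.extend_apply]
          exact (hw0 i).le
        · simp only [hout j hj, le_refl]
      · rw [← hw1]
        exact (Fintype.sum_of_injective e he _ _ hout fun i => (he.extend_apply _ _ _).symm).symm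
      · by_cases hj : j ∈ Set.range e
        · obtain ⟨i, rfl⟩ := hj
          simp only [he.extend_apply]
          exact hz (Set.mem_range_self i)
        · simp only [Function.extend_apply' _ _ _ hj]
          exact hc
      · rw [← hsum]
        refine (Fintype.sum_of_injective e he _ _ (fun j hj => ?_) fun i => ?_).symm
        · simp only [hout j hj, zero_smul]
        · simp only [he.extend_apply]
    · rintro ⟨⟨w, z⟩, ⟨⟨hw0, hw1⟩, hz⟩, rfl⟩
      exact (convex_convexHull ℝ C).sum_mem (fun i _ => hw0 i) hw1
        fun i _ => subset_convexHull ℝ C (hz i trivial)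
  rw [himg]
  exact ((isCompact_stdSimplex ℝ (Fin n)).prod (isCompact_univ_pi fun _ => hC)).image (by fun_prop)

section PlanarCycle

variable {g : Theta → ℂ} {i j : Fin 3}

theorem image_cycle_subset_frontier
    (H : ∀ k : ℂ →L[ℝ] ℝ, NoFourCrossing fun x => k (g x)) (hij : i ≠ j) :
    (fun t => g (cycle i j t)) '' Set.Icc 0 2
      ⊆ frontier (convexHull ℝ ((fun t => g (cycle i j t)) '' Set.Icc 0 2)) := by
  intro y hy
  refine ⟨subset_closure (subset_convexHull ℝ _ hy), ?_⟩
  obtain ⟨t₀, ht₀, rfl⟩ := hy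
  refine notMem_interior_convexHull (ι := Set.Icc (0 : ℝ) 2)
    (T := fun s => g (rotatedCycle i j t₀ s)) ?_ ?_
  · rintro _ ⟨t, ht, rfl⟩
    obtain ⟨s, hs, hst⟩ := image_cycle_subset_rotatedCycle i j ht₀.1 ht₀.2 ⟨t, ht, rfl⟩
    exact Or.inr ⟨⟨s, hs⟩, congrArg g hst⟩
  · intro k a b c hab hbc h1 h2 h3
    refine (H k).rotatedCycle_alternating hij (t₀ := t₀) (l := k (g (cycle i j t₀)))
      a.2.1 hab.le hbc.le c.2.2 ?_ ?_ ?_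
    · rw [above_of_lt h1, above_of_le le_rfl]; exact zero_ne_one
    · rw [above_of_lt h1, above_of_le h2]; exact one_ne_zero
    · rw [above_of_lt h3, above_of_le h2]; exact zero_ne_one

/-- If a functional is maximal at two points of the cycle, then one of the two arcs between these
points lies in a level line. -/
theorem arc_subset_level (H : ∀ k : ℂ →L[ℝ] ℝ, NoFourCrossing fun x => k (g x)) (hij : i ≠ j)
    {k : ℂ →L[ℝ] ℝ} {m : ℝ} (hk : ∀ t ∈ Set.Icc (0 : ℝ) 2, k (g (cycle i j t)) ≤ m) {t₁ t₂ : ℝ}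
    (h0 : 0 ≤ t₁) (h12 : t₁ ≤ t₂) (h2 : t₂ ≤ 2) (e1 : k (g (cycle i j t₁)) = m)
    (e2 : k (g (cycle i j t₂)) = m) :
    (∀ t ∈ Set.Icc t₁ t₂, k (g (cycle i j t)) = m) ∨
      (∀ t ∈ Set.Icc 0 t₁ ∪ Set.Icc t₂ 2, k (g (cycle i j t)) = m) := by
  by_contra! hcon
  obtain ⟨⟨a, ha, hak⟩, b, hb, hbk⟩ := hcon
  have ha' : k (g (cycle i j a)) < m :=
    lt_of_le_of_ne (hk a ⟨h0.trans ha.1, ha.2.trans h2⟩) hak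
  have hb' : k (g (cycle i j b)) < m := by
    refine lt_of_le_of_ne (hk b ?_) hbk
    rcases hb with hb | hb
    · exact ⟨hb.1, by linarith [hb.2]⟩
    · exact ⟨by linarith [hb.1], hb.2⟩
  -- At this level, just below the maximum, a point strictly inside each arc and the two contact
  -- points alternate around the cycle.
  set l := max (k (g (cycle i j a))) (k (g (cycle i j b))) with hl
  have hlm : l < m := max_lt ha' hb'
  have A1 : above l (k (g (cycle i j t₁))) = 1 := above_of_lt (by rw [e1]; exact hlm)
  have A2 : above l (k (g (cycle i j t₂))) = 1 := above_of_lt (by rw [e2]; exact hlm)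
  have Aa : above l (k (g (cycle i j a))) = 0 := above_of_le (le_max_left _ _)
  have Ab : above l (k (g (cycle i j b))) = 0 := above_of_le (le_max_right _ _)
  rcases hb with hb | hb
  · exact (H k).cycle_alternating hij (l := l) hb.2 ha.1 ha.2 (by rw [A1, Ab]; exact zero_ne_one)
      (by rw [A1, Aa]; exact one_ne_zero) (by rw [A2, Aa]; exact zero_ne_one)
  · exact (H k).cycle_alternating hij (l := l) ha.1 ha.2 hb.1 (by rw [A1, Aa]; exact one_ne_zero)
      (by rw [A2, Aa]; exact zero_ne_one) (by rw [A2, Ab]; exact one_ne_zero)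

/-- A frontier point `y` is in the hull of the contact points of its supporting line with the curve.
If `y` is not on the curve, there are contact points on both sides of it; one of the arcs joining
them stays in the line and has to pass through `y`. -/
theorem frontier_subset_image_cycle (hg : Continuous g)
    (H : ∀ k : ℂ →L[ℝ] ℝ, NoFourCrossing fun x => k (g x)) (hij : i ≠ j)
    (hint : (interior (convexHull ℝ ((fun t => g (cycle i j t)) '' Set.Icc 0 2))).Nonempty) :
    frontier (convexHull ℝ ((fun t => g (cycle i j t)) '' Set.Icc 0 2))
      ⊆ (fun t => g (cycle i j t)) '' Set.Icc 0 2 := by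
  set C := (fun t => g (cycle i j t)) '' Set.Icc (0 : ℝ) 2 with hC
  have hcont : Continuous fun t => g (cycle i j t) := hg.comp (continuous_cycle i j)
  have hcomp : IsCompact (convexHull ℝ C) := isCompact_convexHull_of_isCompact (isCompact_Icc.image hcont)
  intro y hy
  obtain ⟨k, hk0, hk⟩ := exists_supporting_functional (convex_convexHull ℝ C) hint hy
  have hkC : ∀ x ∈ C, k x ≤ k y := fun x hx => hk x (subset_convexHull ℝ C hx)
  have hy' := mem_convexHull_inter_of_le (hcomp.isClosed.frontier_subset hy) hkC
  by_contra hyC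
  set d := conjFunctional k with hd
  have hne : ∀ x ∈ C ∩ {x | k x = k y}, d x ≠ d y := fun x hx h =>
    hyC (eq_of_functional_eq hk0 hx.2 h ▸ hx.1)
  have hlow : ∃ u ∈ C ∩ {x | k x = k y}, d u < d y := by
    by_contra! hcon
    have h1 : convexHull ℝ (C ∩ {x | k x = k y}) ⊆ {x | d y < d x} :=
      convexHull_min (fun x hx => lt_of_le_of_ne (hcon x hx) (hne x hx).symm)
        (convex_halfSpace_gt d.toLinearMap.isLinear (d y))
    exact lt_irrefl (d y) (h1 hy')
  have hhigh : ∃ u ∈ C ∩ {x | k x = k y}, d y < d u := by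
    by_contra! hcon
    have h1 : convexHull ℝ (C ∩ {x | k x = k y}) ⊆ {x | d x < d y} :=
      convexHull_min (fun x hx => lt_of_le_of_ne (hcon x hx) (hne x hx))
        (convex_halfSpace_lt d.toLinearMap.isLinear (d y))
    exact lt_irrefl (d y) (h1 hy')
  obtain ⟨_, ⟨⟨t₁, ht₁, rfl⟩, e1⟩, hlt1⟩ := hlow
  obtain ⟨_, ⟨⟨t₂, ht₂, rfl⟩, e2⟩, hlt2⟩ := hhigh
  have hF : Continuous fun t => d (g (cycle i j t)) := d.continuous.comp hcont
  have hkC' : ∀ t ∈ Set.Icc (0 : ℝ) 2, k (g (cycle i j t)) ≤ k y := fun t ht =>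
    hkC _ ⟨t, ht, rfl⟩
  have hend : ∀ t ∈ Set.Icc (0 : ℝ) 2, k (g (cycle i j t)) = k y → d (g (cycle i j t)) = d y →
      False := fun t ht h1 h2 => hyC (eq_of_functional_eq hk0 h1 h2 ▸ ⟨t, ht, rfl⟩)
  have main : ∀ t₁ ∈ Set.Icc (0 : ℝ) 2, ∀ t₂ ∈ Set.Icc (0 : ℝ) 2, t₁ ≤ t₂ →
      k (g (cycle i j t₁)) = k y → k (g (cycle i j t₂)) = k y →
      (d (g (cycle i j t₁)) - d y) * (d (g (cycle i j t₂)) - d y) < 0 → False := by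
    intro t₁ ht₁ t₂ ht₂ h12 e1 e2 hneg
    rcases arc_subset_level H hij hkC' ht₁.1 h12 ht₂.2 e1 e2 with harc | harc
    · obtain ⟨t, ht, hty⟩ := exists_eq_of_mul_nonpos hF h12 hneg.le
      exact hend t ⟨ht₁.1.trans ht.1, ht.2.trans ht₂.2⟩ (harc t ht) hty
    -- The outer arc passes through the parameters `0` and `2`, which give the same point. According
    -- to its position, `y` is met on the first or the second part of the arc.
    · rcases le_or_gt ((d (g (cycle i j 0)) - d y) * (d (g (cycle i j t₁)) - d y)) 0 with h | h
      · obtain ⟨t, ht, hty⟩ := exists_eq_of_mul_nonpos hF ht₁.1 h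
        exact hend t ⟨ht.1, ht.2.trans ht₁.2⟩ (harc t (Or.inl ht)) hty
      · have h' : (d (g (cycle i j t₂)) - d y) * (d (g (cycle i j 2)) - d y) ≤ 0 := by
          rw [← cycle_zero_eq_cycle_two]
          by_contra! hpos
          nlinarith [mul_pos h hpos, sq_nonneg (d (g (cycle i j 0)) - d y)]
        obtain ⟨t, ht, hty⟩ := exists_eq_of_mul_nonpos hF ht₂.2 h'
        exact hend t ⟨ht₂.1.trans ht.1, ht.2⟩ (harc t (Or.inr ht)) hty
  have hneg := mul_neg_of_neg_of_pos (sub_neg.2 hlt1) (sub_pos.2 hlt2)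
  rcases le_total t₁ t₂ with h | h
  · exact main t₁ ht₁ t₂ ht₂ h e1 e2 hneg
  · exact main t₂ ht₂ t₁ ht₁ h e2 e1 (by rwa [mul_comm])

theorem image_cycle_eq_frontier (hg : Continuous g)
    (H : ∀ k : ℂ →L[ℝ] ℝ, NoFourCrossing fun x => k (g x)) (hij : i ≠ j)
    (hint : (interior (convexHull ℝ ((fun t => g (cycle i j t)) '' Set.Icc 0 2))).Nonempty) :
    (fun t => g (cycle i j t)) '' Set.Icc 0 2
      = frontier (convexHull ℝ ((fun t => g (cycle i j t)) '' Set.Icc 0 2)) :=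
  (image_cycle_subset_frontier H hij).antisymm (frontier_subset_image_cycle hg H hij hint)

end PlanarCycle

/-! ### Theta graphs without four crossings -/

theorem NoFourCrossing.sub_const {h : Theta → ℝ} (H : NoFourCrossing h) (b : ℝ) :
    NoFourCrossing fun x => h x - b := by
  intro c τ h1 h2 h3
  have key : ∀ a, above c (a - b) = above (c + b) a := fun a => by
    unfold above
    simp only [lt_sub_iff_add_lt]
  simp only [key]
  exact H (c + b) τ h1 h2 h3

theorem NoFourCrossing.const_mul {h : Theta → ℝ} (H : NoFourCrossing h) {r : ℝ} (hr : 0 < r) :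
    NoFourCrossing fun x => r * h x := by
  intro c τ h1 h2 h3
  have key : ∀ a, above c (r * a) = above (c / r) a := fun a => by
    unfold above
    simp only [div_lt_iff₀' hr]
  simp only [key]
  exact H (c / r) τ h1 h2 h3

theorem noFourCrossing_inner {f : Theta → E3} (hf : Continuous f)
    (hne : f (edgePt 0 0) ≠ f (edgePt 0 1))
    (h : netTotalCurvature f ≤ ENNReal.ofReal (3 * Real.pi)) (e : E3) :
    NoFourCrossing fun x => inner ℝ (f x) e := by
  rcases eq_or_ne e 0 with rfl | he
  · intro c τ h1 h2 h3
    simp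
  have hpos : 0 < ‖e‖ := norm_pos_iff.2 he
  have hunit : ‖e‖⁻¹ • e ∈ Metric.sphere (0 : E3) 1 := by
    rw [mem_sphere_zero_iff_norm, norm_smul, norm_inv, norm_norm, inv_mul_cancel₀ hpos.ne']
  have H := (noFourCrossing_of_forall
    (not_fourCrossing_of_le_three_pi hf hne h ⟨_, hunit⟩)).const_mul hpos
  convert H using 2 with x
  rw [real_inner_smul_right, mul_inv_cancel_left₀ hpos.ne']

/-- The component of `x - p` orthogonal to `d`. -/
def orthPart (p d x : E3) : E3 := x - p - (inner ℝ (x - p) d / ‖d‖ ^ 2) • d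

theorem inner_orthPart {p d : E3} (hd : d ≠ 0) (x : E3) : inner ℝ (orthPart p d x) d = (0 : ℝ) := by
  have hpos : ‖d‖ ^ 2 ≠ 0 := by simpa using hd
  rw [orthPart, inner_sub_left, real_inner_smul_left, real_inner_self_eq_norm_sq,
    div_mul_cancel₀ _ hpos, sub_self]

theorem inner_orthPart_of_orthogonal {p d e : E3} (he : inner ℝ d e = (0 : ℝ)) (x : E3) :
    (inner ℝ (orthPart p d x) e : ℝ) = inner ℝ x e - inner ℝ p e := by
  rw [orthPart, inner_sub_left, inner_sub_left, real_inner_smul_left, he, mul_zero, sub_zero]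

theorem eq_add_of_orthPart {p d x : E3} :
    x = p + (inner ℝ (x - p) d / ‖d‖ ^ 2) • d + orthPart p d x := by
  unfold orthPart; abel

/-- Points of two different edges lie on different sides of the line through the vertices. -/
theorem orthPart_antiparallel {f : Theta → E3} {p d : E3} (hd : d ≠ 0)
    (hp : f (edgePt 0 0) = p) (hq : f (edgePt 0 1) = p + d)
    (H : ∀ e : E3, NoFourCrossing fun x => inner ℝ (f x) e) {i j : Fin 3} (hij : i ≠ j) {s t : I}
    (hs : orthPart p d (f (edgePt i s)) ≠ 0) (ht : orthPart p d (f (edgePt j t)) ≠ 0) :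
    ∃ r : ℝ, 0 < r ∧ orthPart p d (f (edgePt j t)) = -(r • orthPart p d (f (edgePt i s))) := by
  set u := orthPart p d (f (edgePt i s)) with hu
  set v := orthPart p d (f (edgePt j t)) with hv
  have hu0 : 0 < ‖u‖ := norm_pos_iff.2 hs
  have hv0 : 0 < ‖v‖ := norm_pos_iff.2 ht
  -- The bisector `e` is orthogonal to `d`, so both vertices have the same height. Unless `u` and
  -- `v` are antiparallel, both points are higher, giving four crossings; antiparallelism is then
  -- the equality case of Cauchy–Schwarz.
  set e := ‖v‖ • u + ‖u‖ • v with he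
  have hde : inner ℝ d e = (0 : ℝ) := by
    rw [he, inner_add_right, real_inner_smul_right, real_inner_smul_right, real_inner_comm,
      real_inner_comm v d, hu, hv, inner_orthPart hd, inner_orthPart hd]
    simp
  have hue : (inner ℝ u e : ℝ) = ‖u‖ * (‖u‖ * ‖v‖ + inner ℝ u v) := by
    rw [he, inner_add_right, real_inner_smul_right, real_inner_smul_right,
      real_inner_self_eq_norm_sq]
    ring
  have hve : (inner ℝ v e : ℝ) = ‖v‖ * (‖u‖ * ‖v‖ + inner ℝ u v) := by
    rw [he, inner_add_right, real_inner_smul_right, real_inner_smul_right,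
      real_inner_self_eq_norm_sq, real_inner_comm]
    ring
  have hle : ‖u‖ * ‖v‖ + inner ℝ u v ≤ 0 := by
    by_contra! hpos
    have h1 := inner_orthPart_of_orthogonal hde (p := p) (f (edgePt i s))
    have h2 := inner_orthPart_of_orthogonal hde (p := p) (f (edgePt j t))
    rw [← hu, hue] at h1
    rw [← hv, hve] at h2
    have h3 := mul_pos hu0 hpos
    have h4 := mul_pos hv0 hpos
    refine (H e).not_both_above hij (l := inner ℝ p e) (s := s) (t := t) ?_ ?_ ?_ ?_
    · rw [hp]
    · rw [hq, inner_add_left, hde, add_zero]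
    · linarith
    · linarith
  have heq : inner ℝ u (-v) = ‖u‖ * ‖-v‖ := by
    rw [norm_neg, inner_neg_right]
    have := neg_le_of_abs_le (abs_real_inner_le_norm u v)
    linarith
  rw [inner_eq_norm_mul_iff_real, norm_neg] at heq
  refine ⟨‖v‖ / ‖u‖, div_pos hv0 hu0, ?_⟩
  rw [div_eq_inv_mul, mul_smul, heq, smul_smul, inv_mul_cancel₀ hu0.ne', one_smul, neg_neg]

/-- Three nonzero vectors cannot be pairwise antiparallel. -/
theorem exists_edge_on_line {f : Theta → E3} {p d : E3} (hd : d ≠ 0)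
    (hp : f (edgePt 0 0) = p) (hq : f (edgePt 0 1) = p + d)
    (H : ∀ e : E3, NoFourCrossing fun x => inner ℝ (f x) e) :
    ∃ k, ∀ t, orthPart p d (f (edgePt k t)) = 0 := by
  by_contra! hcon
  choose t ht using hcon
  obtain ⟨a, ha, h1⟩ := orthPart_antiparallel hd hp hq H (show (0 : Fin 3) ≠ 1 by decide)
    (ht 0) (ht 1)
  obtain ⟨b, hb, h2⟩ := orthPart_antiparallel hd hp hq H (show (0 : Fin 3) ≠ 2 by decide)
    (ht 0) (ht 2)
  obtain ⟨c, hc, h3⟩ := orthPart_antiparallel hd hp hq H (show (1 : Fin 3) ≠ 2 by decide)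
    (ht 1) (ht 2)
  rw [h2, h1, smul_neg, neg_neg, smul_smul] at h3
  have h4 : (c * a + b) • orthPart p d (f (edgePt 0 (t 0))) = 0 := by
    rw [add_smul, ← h3, neg_add_cancel]
  rcases smul_eq_zero.1 h4 with h5 | h5
  · have := mul_pos hc ha
    linarith
  · exact ht 0 h5

/-- The coordinate along the line is continuous and injective, hence strictly increasing from `0` to
`1`. -/
theorem range_edge_eq_segment {f : Theta → E3} (hf : Continuous f) (hinj : Function.Injective f)
    {p d : E3} (hd : d ≠ 0) (hp : f (edgePt 0 0) = p) (hq : f (edgePt 0 1) = p + d) {k : Fin 3}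
    (hk : ∀ t, orthPart p d (f (edgePt k t)) = 0) :
    Set.range (fun t => f (edgePt k t)) = segment ℝ p (p + d) := by
  have hpos : ‖d‖ ^ 2 ≠ 0 := by simpa using hd
  set r : I → ℝ := fun t => inner ℝ (f (edgePt k t) - p) d / ‖d‖ ^ 2 with hr
  have hfr : ∀ t, f (edgePt k t) = p + r t • d := fun t => by
    have := eq_add_of_orthPart (p := p) (d := d) (x := f (edgePt k t))
    rwa [hk t, add_zero] at this
  have hrc : Continuous r := by
    have := hf.comp (continuous_edgePt k)
    have h2 : Continuous fun t => f (edgePt k t) := this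
    exact ((h2.sub continuous_const).inner continuous_const).div_const _
  have hri : Function.Injective r := fun s t hst => by
    have : f (edgePt k s) = f (edgePt k t) := by rw [hfr, hfr t, hst]
    rcases edgePt_eq_iff.1 (hinj this) with h | h | h
    · exact h.2
    · exact h.1.trans h.2.symm
    · exact h.1.trans h.2.symm
  have hr0 : r 0 = 0 := by simp only [hr]; rw [edgePt_zero k 0, hp]; simp
  have hr1 : r 1 = 1 := by
    simp only [hr]
    rw [edgePt_one k 0, hq, add_sub_cancel_left, real_inner_self_eq_norm_sq, div_self hpos]
  have hmono : StrictMono r := by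
    rcases hrc.strictMono_of_inj hri with h | h
    · exact h
    · have := h (zero_lt_one : (0 : I) < 1)
      rw [hr0, hr1] at this
      exact absurd this (by norm_num)
  rw [segment_eq_image']
  ext x
  constructor
  · rintro ⟨t, rfl⟩
    refine ⟨r t, ⟨?_, ?_⟩, ?_⟩
    · rw [← hr0]; exact hmono.monotone unitInterval.nonneg'
    · rw [← hr1]; exact hmono.monotone unitInterval.le_one'
    · simp only [hfr t, add_sub_cancel_left]
  · rintro ⟨s, hs, rfl⟩
    rw [← hr0, ← hr1] at hs
    obtain ⟨t, -, rfl⟩ := intermediate_value_Icc (zero_le_one : (0 : I) ≤ 1) hrc.continuousOn hs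
    exact ⟨t, by simp only [hfr t, add_sub_cancel_left]⟩

/-- Two edges on the line would both fill the segment between the vertices, against injectivity. -/
theorem exists_orthPart_ne_zero {f : Theta → E3} (hf : Continuous f) (hinj : Function.Injective f)
    {p d : E3} (hd : d ≠ 0) (hp : f (edgePt 0 0) = p) (hq : f (edgePt 0 1) = p + d) {i k : Fin 3}
    (hik : i ≠ k) (hk : ∀ t, orthPart p d (f (edgePt k t)) = 0) :
    ∃ t, orthPart p d (f (edgePt i t)) ≠ 0 := by
  by_contra! hi
  obtain ⟨m, h0, h1⟩ := exists_between (zero_lt_one : (0 : I) < 1)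
  have hm : f (edgePt i m) ∈ Set.range fun t => f (edgePt k t) := by
    rw [range_edge_eq_segment hf hinj hd hp hq hk, ← range_edge_eq_segment hf hinj hd hp hq hi]
    exact Set.mem_range_self m
  obtain ⟨t, ht⟩ := hm
  rcases edgePt_eq_iff.1 (hinj ht) with h | h | h
  · exact hik h.1.symm
  · exact h0.ne' h.2
  · exact h1.ne h.2

/-- The plane through `p` spanned by two orthonormal vectors. -/
theorem exists_affineIsometry_of_orthonormal (p : E3) {a b : E3} (ha : ‖a‖ = 1) (hb : ‖b‖ = 1)
    (hab : inner ℝ a b = (0 : ℝ)) :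
    ∃ φ : ℂ →ᵃⁱ[ℝ] E3, ∀ z : ℂ, φ z = z.re • a + z.im • b + p := by
  let u : ℂ →ₗᵢ[ℝ] E3 :=
    { toFun := fun z => z.re • a + z.im • b
      map_add' := fun z w => by
        rw [Complex.add_re, Complex.add_im, add_smul, add_smul]
        abel
      map_smul' := fun r z => by
        simp [smul_smul]
      norm_map' := fun z => by
        change ‖z.re • a + z.im • b‖ = ‖z‖
        have h1 : ‖z.re • a + z.im • b‖ ^ 2 = ‖z‖ ^ 2 := by
          rw [norm_add_sq_real, norm_smul, norm_smul, ha, hb, real_inner_smul_left,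
            real_inner_smul_right, hab, Complex.sq_norm, Complex.normSq_apply]
          simp only [Real.norm_eq_abs, mul_one, mul_zero, sq_abs]
          ring
        exact (sq_eq_sq₀ (norm_nonneg _) (norm_nonneg _)).1 h1 }
  exact ⟨(AffineIsometryEquiv.vaddConst ℝ p).toAffineIsometry.comp u.toAffineIsometry,
    fun z => rfl⟩

theorem exists_other_edges (k : Fin 3) :
    ∃ i j : Fin 3, i ≠ j ∧ i ≠ k ∧ j ≠ k ∧ ∀ m, m = i ∨ m = j ∨ m = k := by
  fin_cases k
  · exact ⟨1, 2, by decide⟩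
  · exact ⟨0, 2, by decide⟩
  · exact ⟨0, 1, by decide⟩

/-- If one edge is straight, then all points have parallel components orthogonal to it. -/
theorem exists_orthPart_eq_smul {f : Theta → E3} (hf : Continuous f) (hinj : Function.Injective f)
    {p d : E3} (hd : d ≠ 0) (hp : f (edgePt 0 0) = p) (hq : f (edgePt 0 1) = p + d)
    (H : ∀ e : E3, NoFourCrossing fun x => inner ℝ (f x) e) {i j k : Fin 3} (hij : i ≠ j)
    (hjk : j ≠ k) (hall : ∀ m, m = i ∨ m = j ∨ m = k)
    (hk : ∀ t, orthPart p d (f (edgePt k t)) = 0) {s : I}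
    (hs : orthPart p d (f (edgePt i s)) ≠ 0) (x : Theta) :
    ∃ r : ℝ, orthPart p d (f x) = r • orthPart p d (f (edgePt i s)) := by
  obtain ⟨⟨m, t⟩, rfl⟩ := Quotient.exists_rep x
  change ∃ r : ℝ, orthPart p d (f (edgePt m t)) = _
  by_cases h0 : orthPart p d (f (edgePt m t)) = 0
  · exact ⟨0, by rw [h0, zero_smul]⟩
  rcases hall m with rfl | rfl | rfl
  -- Two points of the same edge are compared through a point of the edge `j`, antiparallel to both.
  · obtain ⟨t', ht'⟩ := exists_orthPart_ne_zero hf hinj hd hp hq hjk hk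
    obtain ⟨a, -, ha⟩ := orthPart_antiparallel hd hp hq H hij hs ht'
    obtain ⟨b, -, hb⟩ := orthPart_antiparallel hd hp hq H hij.symm ht' h0
    exact ⟨b * a, by rw [hb, ha, smul_neg, neg_neg, smul_smul]⟩
  · obtain ⟨a, -, ha⟩ := orthPart_antiparallel hd hp hq H hij hs h0
    exact ⟨-a, by rw [ha, neg_smul]⟩
  · exact absurd (hk t) h0

theorem interior_convexHull_nonempty_of_three {C : Set ℂ} {x y z : ℂ} (hx : x ∈ C) (hy : y ∈ C)
    (hz : z ∈ C) (h1 : (y - x).im = 0) (h2 : (y - x).re ≠ 0) (h3 : (z - x).im ≠ 0) :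
    (interior (convexHull ℝ C)).Nonempty := by
  rw [interior_convexHull_nonempty_iff_affineSpan_eq_top,
    AffineSubspace.affineSpan_eq_top_iff_vectorSpan_eq_top_of_nonempty ℝ ℂ ℂ ⟨x, hx⟩, eq_top_iff]
  intro w _
  have hyx : y - x ∈ vectorSpan ℝ C := vsub_mem_vectorSpan ℝ hy hx
  have hzx : z - x ∈ vectorSpan ℝ C := vsub_mem_vectorSpan ℝ hz hx
  generalize y - x = a at *
  generalize z - x = b at *
  have hw : w = ((w.re - w.im / b.im * b.re) / a.re) • a + (w.im / b.im) • b := by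
    refine Complex.ext ?_ ?_
    · rw [Complex.add_re, Complex.real_smul, Complex.real_smul, Complex.re_ofReal_mul,
        Complex.re_ofReal_mul]
      field_simp
      ring
    · rw [Complex.add_im, Complex.real_smul, Complex.real_smul, Complex.im_ofReal_mul,
        Complex.im_ofReal_mul, h1]
      field_simp
      ring
  rw [hw]
  exact Submodule.add_mem _ (Submodule.smul_mem _ _ hyx) (Submodule.smul_mem _ _ hzx)

/-- The edge `k` on the line is the chord. The whole graph lies in the plane through `p` spanned by
`d` and the orthogonal part `u` of one point, and the other two edges form the planar cycle. -/
theorem isConvexCurveWithChord_of_noFourCrossing {f : Theta → E3} (hf : Continuous f)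
    (hinj : Function.Injective f) (H : ∀ e : E3, NoFourCrossing fun x => inner ℝ (f x) e) :
    IsConvexCurveWithChord (Set.range f) := by
  set p := f (edgePt 0 0) with hp
  set d := f (edgePt 0 1) - p with hd'
  have hq : f (edgePt 0 1) = p + d := by rw [hd', add_sub_cancel]
  have hd : d ≠ 0 := sub_ne_zero.2 (hinj.ne vertices_ne).symm
  have hd0 : ‖d‖ ≠ 0 := norm_ne_zero_iff.2 hd
  obtain ⟨k, hk⟩ := exists_edge_on_line hd hp.symm hq H
  obtain ⟨i, j, hij, hik, hjk, hall⟩ := exists_other_edges k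
  obtain ⟨s, hs⟩ := exists_orthPart_ne_zero hf hinj hd hp.symm hq hik hk
  have hpar := exists_orthPart_eq_smul hf hinj hd hp.symm hq H hij hjk hall hk hs
  set u := orthPart p d (f (edgePt i s)) with hu
  have hu0 : ‖u‖ ≠ 0 := norm_ne_zero_iff.2 hs
  have hud : inner ℝ u d = (0 : ℝ) := inner_orthPart hd _
  set a := ‖d‖⁻¹ • d with ha
  set b := ‖u‖⁻¹ • u with hb
  have ha1 : ‖a‖ = 1 := by rw [ha, norm_smul, norm_inv, norm_norm, inv_mul_cancel₀ hd0]
  have hb1 : ‖b‖ = 1 := by rw [hb, norm_smul, norm_inv, norm_norm, inv_mul_cancel₀ hu0]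
  have hab : inner ℝ a b = (0 : ℝ) := by
    rw [ha, hb, real_inner_smul_left, real_inner_smul_right, real_inner_comm, hud]
    simp
  have hda : d = ‖d‖ • a := by rw [ha, smul_smul, mul_inv_cancel₀ hd0, one_smul]
  have hub : u = ‖u‖ • b := by rw [hb, smul_smul, mul_inv_cancel₀ hu0, one_smul]
  have hda1 : inner ℝ d a = ‖d‖ := by
    rw [ha, real_inner_smul_right, real_inner_self_eq_norm_sq]
    field_simp
  have hub1 : inner ℝ u b = ‖u‖ := by
    rw [hb, real_inner_smul_right, real_inner_self_eq_norm_sq]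
    field_simp
  have hdb : inner ℝ d b = (0 : ℝ) := by
    rw [hb, real_inner_smul_right, real_inner_comm, hud, mul_zero]
  clear_value a b
  obtain ⟨φ, hφ⟩ := exists_affineIsometry_of_orthonormal p ha1 hb1 hab
  set g : Theta → ℂ := fun x => ⟨inner ℝ (f x - p) a, inner ℝ (f x - p) b⟩ with hg
  have hgc : Continuous g := by
    have h1 : Continuous fun x => (inner ℝ (f x - p) a : ℝ) :=
      (hf.sub continuous_const).inner continuous_const
    have h2 : Continuous fun x => (inner ℝ (f x - p) b : ℝ) :=
      (hf.sub continuous_const).inner continuous_const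
    have : g = fun x => ((inner ℝ (f x - p) a : ℝ) : ℂ)
        + ((inner ℝ (f x - p) b : ℝ) : ℂ) * Complex.I := by
      ext1 x
      exact Complex.mk_eq_add_mul_I _ _
    rw [this]
    exact (Complex.continuous_ofReal.comp h1).add
      ((Complex.continuous_ofReal.comp h2).mul continuous_const)
  have hφg : ∀ x, φ (g x) = f x := fun x => by
    obtain ⟨r, hr⟩ := hpar x
    obtain ⟨c, hc⟩ : ∃ c : ℝ, f x - p = c • a + (r * ‖u‖) • b := by
      refine ⟨inner ℝ (f x - p) d / ‖d‖ ^ 2 * ‖d‖, ?_⟩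
      have := eq_add_of_orthPart (p := p) (d := d) (x := f x)
      rw [mul_smul, ← hda, mul_smul, ← hub, ← hr]
      nth_rewrite 1 [this]
      abel
    have h1 : (inner ℝ (f x - p) a : ℝ) = c := by
      rw [hc, inner_add_left, real_inner_smul_left, real_inner_smul_left,
        real_inner_self_eq_norm_sq, ha1, real_inner_comm, hab]
      ring
    have h2 : (inner ℝ (f x - p) b : ℝ) = r * ‖u‖ := by
      rw [hc, inner_add_left, real_inner_smul_left, real_inner_smul_left,
        real_inner_self_eq_norm_sq, hb1, hab]
      ring
    rw [hφ]
    simp only [hg, h1, h2]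
    rw [← hc, sub_add_cancel]
  -- A functional on the plane is, up to a constant, the height in the direction `l 1 • a + l
  -- Complex.I • b` in space.
  have hH : ∀ l : ℂ →L[ℝ] ℝ, NoFourCrossing fun x => l (g x) := fun l => by
    have := (H (l 1 • a + l Complex.I • b)).sub_const (inner ℝ p (l 1 • a + l Complex.I • b))
    convert this using 2 with x
    rw [functional_apply, ← inner_sub_left, inner_add_right, real_inner_smul_right,
      real_inner_smul_right]
    simp only [hg]
    ring
  set C := (fun t => g (cycle i j t)) '' Set.Icc (0 : ℝ) 2 with hC
  have hCeq : C = g '' (Set.range (edgePt i) ∪ Set.range (edgePt j)) := by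
    rw [← image_cycle i j, Set.image_image]
  have hmem : ∀ t, g (edgePt i t) ∈ C := fun t => by
    rw [hCeq]
    exact ⟨_, Or.inl ⟨t, rfl⟩, rfl⟩
  have hgp : g (edgePt i 0) = 0 := by
    simp only [hg]
    rw [edgePt_zero i 0, ← hp, sub_self, inner_zero_left, inner_zero_left]
    rfl
  have hgq : g (edgePt i 1) = (‖d‖ : ℂ) := by
    simp only [hg]
    rw [edgePt_one i 0, hq, add_sub_cancel_left]
    refine Complex.ext ?_ ?_
    · simpa only [Complex.ofReal_re] using hda1
    · simpa only [Complex.ofReal_im] using hdb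
  have hgs : (g (edgePt i s)).im = ‖u‖ := by
    have h2 := inner_orthPart_of_orthogonal hdb (p := p) (f (edgePt i s))
    simp only [hg]
    rw [inner_sub_left, ← h2, ← hu, hub1]
  -- The two vertices and a point off their line span a triangle.
  have hint : (interior (convexHull ℝ C)).Nonempty := by
    refine interior_convexHull_nonempty_of_three (hmem 0) (hmem 1) (hmem s) ?_ ?_ ?_
    · rw [hgp, hgq]; simp
    · rw [hgp, hgq]; simpa using hd0
    · rw [hgp, sub_zero, hgs]; exact hu0
  have hfront := image_cycle_eq_frontier hgc hH hij hint
  have hcomp : IsCompact (convexHull ℝ C) := isCompact_convexHull_of_isCompact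
    (isCompact_Icc.image (hgc.comp (continuous_cycle i j)))
  have hcurve := isPlanarConvexCurve_image_frontier φ (convex_convexHull ℝ C) hcomp hint
  rw [← hfront] at hcurve
  have hφC : φ '' C = f '' (Set.range (edgePt i) ∪ Set.range (edgePt j)) := by
    rw [hCeq, Set.image_image]
    exact Set.image_congr fun x _ => hφg x
  rw [hφC] at hcurve
  have hseg := range_edge_eq_segment hf hinj hd hp.symm hq hk
  refine ⟨_, p, p + d, hcurve, ?_, ?_, ?_, ?_, ?_⟩
  · exact ⟨edgePt i 0, Or.inl ⟨0, rfl⟩, by rw [edgePt_zero i 0]⟩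
  · exact ⟨edgePt i 1, Or.inl ⟨1, rfl⟩, by rw [edgePt_one i 0, hq]⟩
  · simpa using hd
  · rw [Set.disjoint_left]
    rintro x hx hxC
    have hxk : x ∈ Set.range fun t => f (edgePt k t) := hseg ▸ openSegment_subset_segment _ _ _ hx
    obtain ⟨t, rfl⟩ := hxk
    obtain ⟨y, hy, hyx⟩ := hxC
    have hyk : y = edgePt k t := hinj hyx
    have hend : t = 0 ∨ t = 1 := by
      rw [hyk] at hy
      rcases hy with ⟨t', ht'⟩ | ⟨t', ht'⟩ <;> rcases edgePt_eq_iff.1 ht' with h | h | h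
      · exact absurd h.1 hik
      · exact Or.inl h.2
      · exact Or.inr h.2
      · exact absurd h.1 hjk
      · exact Or.inl h.2
      · exact Or.inr h.2
    have hne : p ≠ p + d := by simpa using hd
    simp only at hx
    rcases hend with rfl | rfl
    · rw [edgePt_zero k 0, ← hp, left_mem_openSegment_iff] at hx
      exact hne hx
    · rw [edgePt_one k 0, hq, right_mem_openSegment_iff] at hx
      exact hne hx
  · rw [← hseg]
    ext x
    constructor
    · rintro ⟨y, rfl⟩
      obtain ⟨⟨m, t⟩, rfl⟩ := Quotient.exists_rep y
      rcases hall m with rfl | rfl | rfl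
      · exact Or.inl ⟨_, Or.inl ⟨t, rfl⟩, rfl⟩
      · exact Or.inl ⟨_, Or.inr ⟨t, rfl⟩, rfl⟩
      · exact Or.inr ⟨t, rfl⟩
    · rintro (⟨y, -, rfl⟩ | ⟨t, rfl⟩)
      · exact Set.mem_range_self _
      · exact Set.mem_range_self _

end ThetaNTC

end

theorem mainTheorem1 (f : ThetaNTC.Theta → ThetaNTC.E3) (hf : Topology.IsEmbedding f) :
    ENNReal.ofReal (3 * Real.pi) ≤ ThetaNTC.netTotalCurvature f ∧
    (ThetaNTC.netTotalCurvature f = ENNReal.ofReal (3 * Real.pi) ↔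
      ThetaNTC.IsConvexCurveWithChord (Set.range f)) ∧
    (ThetaNTC.netTotalCurvature f < ENNReal.ofReal (4 * Real.pi) →
      ThetaNTC.AmbientIsotopic (Set.range f) ThetaNTC.standardTheta) := by
  have hne := hf.injective.ne ThetaNTC.vertices_ne
  have h3 := ThetaNTC.three_pi_le_netTotalCurvature hne
  refine ⟨h3, ⟨fun h => ?_, fun h => ?_⟩,
    ThetaNTC.ambientIsotopic_of_lt_four_pi hf.continuous hf.injective⟩
  · exact ThetaNTC.isConvexCurveWithChord_of_noFourCrossing hf.continuous hf.injective
      (ThetaNTC.noFourCrossing_inner hf.continuous hne h.le)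
  · exact (ThetaNTC.netTotalCurvature_le_of_isConvexCurveWithChord hf.continuous hf.injective
      h).antisymm h3
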